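/- Let $L$ be a finite relational signature; structures are non-empty. In an $L$-structure $\mathcal A$, $\mathrm{dist}$ is the distance in the graph that joins two distinct elements occurring together in a tuple of some relation; $\mathcal A$ has degree $\le f$ if every element has at most $f$ elements at distance $1$. For $d>0$ let $B_d^{\mathcal A}(a_1,\dots,a_k)=\{b:\mathrm{dist}(a_i,b)<d\text{ for some }i\}$ and $S_d^{\mathcal A}(\bar a)=(\mathcal A\restriction B_d^{\mathcal A}(\bar a),\bar a)$. A (finite) $d$-sphere with $k$ centers is a finite structure with $k$ designated elements $(\mathcal B,\bar c)$ such that $B_d^{\mathcal B}(\bar c)=\mathcal B$; for a sphere $\tau$ given together with such a $d$, called its radius, $\mathrm{sph}_\tau(\bar a)$ says that $S_d^{\mathcal A}(\bar a)\cong\tau$. A formula in Hanf normal form with free variables among $x_1,\dots,x_n$ is a Boolean combination (with $\top,\bot$ allowed) of formulas $\exists^{\ge m}y:\mathrm{sph}_\tau(x_1,\dots,x_n,y)$, with $m\in\mathbb N$ and $\tau$ a sphere with $n+1$ centers. Its length $|\cdot|$ counts one symbol for each connective, and for each such formula $\exists^{\ge m}y:\mathrm{sph}_\tau$ it counts one symbol,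 plus $m$, plus the radius, the number of elements and the number of centers of $\tau$, plus the total number of symbols (relation symbols and arguments) in the list of facts of $\tau$. There are an algorithm and a constant $C$, both depending only on $L$, with the following property. Given $n\ge 0$, $f\ge 1$ and a formula $\varphi$ in Hanf normal form with free variables among $x_1,\dots,x_n,x_{n+1}$, the algorithm constructs a formula $\psi$ in Hanf normal form with free variables among $x_1,\dots,x_n$ such that $\exists x_{n+1}:\varphi$ and $\psi$ are $f$-equivalent, that is, for every $L$-structure $\mathcal A$ of degree $\le f$ and all $a_1,\dots,a_n\in\mathcal A$, \[ \mathcal A\models\exists x_{n+1}:\varphi(\bar a,x_{n+1})\iff\mathcal A\models\psi(\bar a). \] Let $d$ be the largest radius of a sphere appearing in $\varphi$ ($d=0$ if there is none). The running time of the construction, and the length $|\psi|$, are at most $|\varphi|\cdot 2^{(n+2)^{C}\cdot f^{C\cdot d}}$, and the largest radius of a sphere appearing in $\psi$ is $3d$. Here the algorithm is a pure-Lisp while program on binary trees (operations $\mathrm{nil}$, $\mathrm{cons}$, $\mathrm{hd}$, $\mathrm{tl}$, test for $\mathrm{nil}$, sequencing, branching, while loop, each at unit cost), with formulas encoded as trees,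 numbers in unary. -/

import Mathlib

open FirstOrder

universe u v w

namespace HanfNF

/-! ### Distances, balls, degree -/

section Structures

variable (L : FirstOrder.Language.{u, v}) {A : Type w} [L.Structure A]

/-- The Gaifman graph of a structure: distinct elements are adjacent iff they occur together in
some tuple of some relation. -/
def gaifman (A : Type w) [L.Structure A] : SimpleGraph A where
  Adj a b := a ≠ b ∧ ∃ (l : ℕ) (R : L.Relations l) (t : Fin l → A),
    FirstOrder.Language.Structure.RelMap R t ∧ a ∈ Set.range t ∧ b ∈ Set.range t
  symm := ⟨fun _ _ ⟨hne, l, R, t, hR, ha, hb⟩ => ⟨hne.symm, l, R, t, hR, hb, ha⟩⟩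
  loopless := ⟨fun _ h => h.1 rfl⟩

/-- Distance in `ℕ ∪ {∞}`: the distance in the Gaifman graph. -/
noncomputable def dist (a b : A) : ℕ∞ := (gaifman L A).edist a b

/-- `B_d(a₁, …, aₙ)`: the elements at distance `< d` from some `aᵢ`. -/
def ball {n : ℕ} (d : ℕ) (a : Fin n → A) : Set A := {b | ∃ i, dist L (a i) b < (d : ℕ∞)}

/-- The structure has degree at most `f`: every element has at most `f` elements at distance 1. -/
def DegreeLE (A : Type w) [L.Structure A] (f : ℕ) : Prop :=
  ∀ a : A, {b : A | dist L a b = 1}.encard ≤ (f : ℕ∞)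

lemma mem_ball_center {n d : ℕ} (hd : 0 < d) (a : Fin n → A) (i : Fin n) : a i ∈ ball L d a :=
  ⟨i, by simpa [dist] using hd⟩

/-- The substructure induced on `B_d(a₁, …, aₙ)`. -/
def sphereAround [L.IsRelational] {n : ℕ} (d : ℕ) (a : Fin n → A) : L.Substructure A where
  carrier := ball L d a
  fun_mem := fun f => isEmptyElim f

end Structures

/-! ### Finite structures and spheres as syntactic objects -/

/-- A finite structure, written down as its number of elements and the list of its facts `R(t)`;
its universe is `{0, …, size - 1}`. -/
structure FinStr (L : FirstOrder.Language.{u, v}) where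
  size : ℕ
  facts : List (Σ R : (Σ l, L.Relations l), Fin R.1 → Fin size)

/-- The universe of a written finite structure. -/
def FinStr.Carrier {L : FirstOrder.Language.{u, v}} (S : FinStr L) : Type := Fin S.size

instance FinStr.instStructure {L : FirstOrder.Language.{u, v}} [L.IsRelational] (S : FinStr L) :
    L.Structure S.Carrier where
  funMap := fun f => isEmptyElim f
  RelMap := fun {l} R t =>
    (⟨⟨l, R⟩, t⟩ : Σ R : (Σ l, L.Relations l), Fin R.1 → Fin S.size) ∈ S.facts

/-- A finite `d`-sphere with `n` centres, together with `d > 0` (its `radius`): the ball of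
radius `d` around the centres is everything. -/
structure Sphere (L : FirstOrder.Language.{u, v}) [L.IsRelational] (n : ℕ) where
  base : FinStr L
  center : Fin n → base.Carrier
  radius : ℕ
  radius_pos : 0 < radius
  covers : ball L radius center = Set.univ

/-- `sph_τ(a₁, …, aₙ)`: the `d`-sphere around `a₁, …, aₙ` is isomorphic to the `d`-sphere `τ`,
by an isomorphism that maps `aᵢ` to the `i`-th centre. -/
def Sphere.RealisedBy {L : FirstOrder.Language.{u, v}} [L.IsRelational] {n : ℕ} (τ : Sphere L n)
    {A : Type w} [L.Structure A] (a : Fin n → A) : Prop :=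
  ∃ e : sphereAround L τ.radius a ≃[L] τ.base.Carrier,
    ∀ i, e ⟨a i, mem_ball_center L τ.radius_pos a i⟩ = τ.center i

/-! ### Formulas in Hanf normal form -/

/-- Formulas in Hanf normal form with free variables among `x₁, …, xₙ`: Boolean combinations of
Hanf formulas `∃^{≥ m} y : sph_τ(x₁, …, xₙ, y)`, with `τ` a sphere with `n + 1` centres. -/
inductive HNF (L : FirstOrder.Language.{u, v}) [L.IsRelational] (n : ℕ) : Type v
  | verum : HNF L n
  | falsum : HNF L n
  | hanf (m : ℕ) (τ : Sphere L (n + 1)) : HNF L n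
  | neg (φ : HNF L n) : HNF L n
  | conj (φ ψ : HNF L n) : HNF L n
  | disj (φ ψ : HNF L n) : HNF L n

namespace HNF

variable {L : FirstOrder.Language.{u, v}} [L.IsRelational] {n : ℕ}

/-- `A ⊨ φ(a₁, …, aₙ)`. -/
def Realize {A : Type w} [L.Structure A] : HNF L n → (Fin n → A) → Prop
  | verum, _ => True
  | falsum, _ => False
  | hanf m τ, a => ∃ x : Fin m → A, Function.Injective x ∧
      ∀ i, τ.RealisedBy (Fin.snoc a (x i) : Fin (n + 1) → A)
  | neg φ, a => ¬ φ.Realize a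
  | conj φ ψ, a => φ.Realize a ∧ ψ.Realize a
  | disj φ ψ, a => φ.Realize a ∨ ψ.Realize a

/-- The largest radius of a sphere appearing in the formula (`0` if there is none). -/
def maxRadius : HNF L n → ℕ
  | verum => 0
  | falsum => 0
  | hanf _ τ => τ.radius
  | neg φ => φ.maxRadius
  | conj φ ψ => max φ.maxRadius ψ.maxRadius
  | disj φ ψ => max φ.maxRadius ψ.maxRadius

end HNF

/-- The length of a written sphere: its radius, its number of elements, one symbol for each
centre, and one symbol for each relation symbol and each argument in its list of facts. -/
def Sphere.length {L : FirstOrder.Language.{u, v}} [L.IsRelational] {n : ℕ} (τ : Sphere L n) : ℕ :=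
  τ.radius + τ.base.size + n + (τ.base.facts.map fun F => F.1.1 + 1).sum

/-- The length `|φ|` of a formula in Hanf normal form; the threshold `m` counts as `m`. -/
def HNF.length {L : FirstOrder.Language.{u, v}} [L.IsRelational] {n : ℕ} : HNF L n → ℕ
  | .verum => 1
  | .falsum => 1
  | .hanf m τ => m + τ.length + 1
  | .neg φ => φ.length + 1
  | .conj φ ψ => φ.length + ψ.length + 1
  | .disj φ ψ => φ.length + ψ.length + 1

/-! ### A machine model with a step count -/

/-- The data of the machine: binary trees with unlabelled leaves. -/
inductive Val : Type
  | nil : Val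
  | node (l r : Val) : Val

/-- Programs (pure Lisp with while loops). A program acts on one tree. -/
inductive Prog : Type
  | id : Prog
  | nil : Prog
  | cons (p q : Prog) : Prog
  | hd : Prog
  | tl : Prog
  | seq (p q : Prog) : Prog
  | ite (c p q : Prog) : Prog
  | loop (c p : Prog) : Prog

/-- `p.Eval x y t`: on input `x`, the program `p` halts with output `y` after `t` elementary
steps. Each constructor that is executed costs one step, besides its subprograms; `nil` is false
and every other tree is true; `loop c p` is `while c do p`. -/
inductive Prog.Eval : Prog → Val → Val → ℕ → Prop
  | id (x : Val) : Eval .id x x 1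
  | nil (x : Val) : Eval .nil x .nil 1
  | cons {p q : Prog} {x y z : Val} {s t : ℕ} :
      Eval p x y s → Eval q x z t → Eval (.cons p q) x (.node y z) (s + t + 1)
  | hd_nil : Eval .hd .nil .nil 1
  | hd_node (y z : Val) : Eval .hd (.node y z) y 1
  | tl_nil : Eval .tl .nil .nil 1
  | tl_node (y z : Val) : Eval .tl (.node y z) z 1
  | seq {p q : Prog} {x y z : Val} {s t : ℕ} :
      Eval p x y s → Eval q y z t → Eval (.seq p q) x z (s + t + 1)
  | ite_true {c p q : Prog} {x u v y : Val} {s t : ℕ} :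
      Eval c x (.node u v) s → Eval p x y t → Eval (.ite c p q) x y (s + t + 1)
  | ite_false {c p q : Prog} {x y : Val} {s t : ℕ} :
      Eval c x .nil s → Eval q x y t → Eval (.ite c p q) x y (s + t + 1)
  | loop_stop {c p : Prog} {x : Val} {s : ℕ} :
      Eval c x .nil s → Eval (.loop c p) x x (s + 1)
  | loop_step {c p : Prog} {x u v y z : Val} {s t r : ℕ} :
      Eval c x (.node u v) s → Eval p x y t → Eval (.loop c p) y z r →
      Eval (.loop c p) x z (s + t + r + 1)

/-! ### Encoding of formulas as trees -/

namespace Val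

/-- Natural numbers in unary. -/
def ofNat : ℕ → Val
  | 0 => nil
  | k + 1 => node nil (ofNat k)

/-- Lists. -/
def ofList : List Val → Val
  | [] => nil
  | x :: xs => node x (ofList xs)

end Val

section Encoding

variable {L : FirstOrder.Language.{u, v}}

/-- The list of elements `t₀, …, t_{n-1}` of `{0, …, k-1}`. -/
def encodeTuple {n k : ℕ} (t : Fin n → Fin k) : Val :=
  Val.ofList (List.ofFn fun i => Val.ofNat (t i))

/-- A fact `R(t)`: the number of `R` in a fixed enumeration of the relation symbols, and `t`. -/
noncomputable def encodeFact [Finite (Σ l, L.Relations l)] {k : ℕ}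
    (F : Σ R : (Σ l, L.Relations l), Fin R.1 → Fin k) : Val :=
  .node (Val.ofNat (Finite.equivFin (Σ l, L.Relations l) F.1)) (encodeTuple F.2)

noncomputable def Sphere.encode [L.IsRelational] [Finite (Σ l, L.Relations l)] {n : ℕ}
    (τ : Sphere L n) : Val :=
  Val.ofList [Val.ofNat τ.radius, Val.ofNat τ.base.size,
    encodeTuple (k := τ.base.size) τ.center, Val.ofList (τ.base.facts.map encodeFact)]

noncomputable def HNF.encode [L.IsRelational] [Finite (Σ l, L.Relations l)] {n : ℕ} :
    HNF L n → Val
  | .verum => .node (Val.ofNat 0) .nil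
  | .falsum => .node (Val.ofNat 1) .nil
  | .hanf m τ => .node (Val.ofNat 2) (.node (Val.ofNat m) τ.encode)
  | .neg φ => .node (Val.ofNat 3) φ.encode
  | .conj φ ψ => .node (Val.ofNat 4) (.node φ.encode ψ.encode)
  | .disj φ ψ => .node (Val.ofNat 5) (.node φ.encode ψ.encode)

/-- The input `(n, f, φ)` of the construction. -/
noncomputable def encodeInput [L.IsRelational] [Finite (Σ l, L.Relations l)] (n f : ℕ)
    (φ : HNF L (n + 1)) : Val :=
  .node (Val.ofNat n) (.node (Val.ofNat f) φ.encode)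

end Encoding

end HanfNF

set_option linter.unusedSectionVars false

namespace HanfNF

/-! Let `d` be the largest radius in `φ`, and let `N = 2(n+2)f^(3d)`. In a structure of degree at
most `f`, a ball of radius at most `3d` around at most `n+2` elements has at most `N` elements
(`encard_ball_le`). Hence every tuple `(a, b)` realises some sphere `τ` of radius `3d` with `n+1`
centres and at most `N` elements, and there are finitely many written candidates for `τ`. The
formula `ψ` is the disjunction over these `τ` of `∃^{≥1} y : sph_τ(x, y) ∧ φ_τ(x)`, where `φ_τ`
arises from `φ` by replacing every Hanf formula with one that does not mention `x_{n+1}` and is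
equivalent to it whenever `(a, b)` realises `τ`.

The replacement (`exists_atom`) of `∃^{≥m} y : sph_σ(x, x_{n+1}, y)`, with `σ` of radius `e ≤ d`,
has three cases. If `σ` has more than `N` elements, nothing realises it, and only `m = 0` gives a
true formula. If the last centre of `σ` is connected with the others inside `σ`, or if the
`e`-sphere around the other centres is not that of `τ`, then all realisations lie within distance
`2e` of `(a, b)`. The `e`-balls around such elements are visible in a sphere of radius `3e`, so the
realisations can be counted in `τ` (`SphereMap.encard_of_not_far`), and the formula becomes a
constant. Otherwise let `σ'` be the sphere of `σ` around its centres without the last but one. Every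
realisation of `σ` by `(a, b, y)` is one of `σ'` by `(a, y)`. Conversely, if `y` is at distance at
least `2e` from `(a, b)` and `(a, y)` realises `σ'`, then the spheres around `(a, b)` and around `y`
can be glued (`SphereIso.glue`), and `y` realises `σ`. So the two numbers of realisations differ by
a number of elements near `(a, b)` that can be read off from `τ`. This number is added to the
threshold (`SphereMap.encard_of_far`).

For the running time, programs are built from combinators whose cost is tracked with two parameters:
a measure, which may enter polynomially, and a weight, which may enter only linearly. The measure is
`2^((N+2)^c)`, large enough to enumerate all written structures with at most `N` elements and all
maps between them. The weight is the length of the part of `φ` that is being read. Radii, thresholds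
and lists of facts in `φ` are not bounded in terms of `N`. They are scanned once, and what is
computed from them is first truncated (`Cmp.min_big`, `ball_eq_of_size_le`, `normFacts`). Hence a
Hanf formula costs its own length times a polynomial in the measure (`Tm.atomVal`). These costs add
up over the formula (`eval_traverse`, `Tm.bindVal`), and `exists_exponent` absorbs the polynomial in
the exponent of the claimed bound.

If no sphere appears in `φ`, it is a Boolean combination of constants and its code is returned
unchanged. -/

lemma Prog.Eval.loop_exit {c p : Prog} {x : Val} {s : ℕ} (h : c.Eval x .nil s) :
    (Prog.loop c p).Eval x x (s + 1) := by
  constructor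
  exact h

/-! ### Sizes of trees, encodings, contexts -/

/-- The number of vertices of a tree. -/
def Val.size : Val → ℕ
  | .nil => 1
  | .node l r => l.size + r.size + 1

lemma Val.size_pos (x : Val) : 1 ≤ x.size := by cases x <;> simp [Val.size]

/-- Types whose elements are written as trees. -/
class Enc (α : Type*) where
  enc : α → Val

open Enc (enc)

instance : Enc Val := ⟨fun x => x⟩
instance : Enc ℕ := ⟨Val.ofNat⟩
instance : Enc Unit := ⟨fun _ => .nil⟩
-- These are the values on which `ite` and `loop` branch, so a computed truth value can serve
-- directly as a condition.
instance : Enc Bool := ⟨fun b => bif b then .node .nil .nil else .nil⟩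
instance {α β : Type*} [Enc α] [Enc β] : Enc (α × β) := ⟨fun p => .node (enc p.1) (enc p.2)⟩
instance {α : Type*} [Enc α] : Enc (List α) := ⟨fun l => Val.ofList (l.map enc)⟩

/-- Encodings that are injective. -/
class EncInj (α : Type*) [Enc α] : Prop where
  inj : Function.Injective (enc : α → Val)

lemma Val.ofNat_injective : Function.Injective Val.ofNat := by
  intro a
  induction a with
  | zero => intro b h; cases b <;> simp_all [Val.ofNat]
  | succ a ih =>
    intro b h
    cases b with
    | zero => simp [Val.ofNat] at h
    | succ b => simp only [Val.ofNat, Val.node.injEq, true_and] at h; rw [ih h]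

lemma Val.ofList_injective : Function.Injective Val.ofList := by
  intro a
  induction a with
  | nil => intro b h; cases b <;> simp_all [Val.ofList]
  | cons x a ih =>
    intro b h
    cases b with
    | nil => simp [Val.ofList] at h
    | cons y b => simp only [Val.ofList, Val.node.injEq] at h; rw [ih h.2, h.1]

instance : EncInj ℕ := ⟨Val.ofNat_injective⟩
instance {α β : Type*} [Enc α] [Enc β] [EncInj α] [EncInj β] : EncInj (α × β) :=
  ⟨fun p q h => by
    have h' : enc p.1 = enc q.1 ∧ enc p.2 = enc q.2 := by simpa [enc] using h
    exact Prod.ext (EncInj.inj h'.1) (EncInj.inj h'.2)⟩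
instance {α : Type*} [Enc α] [EncInj α] : EncInj (List α) :=
  ⟨fun _ _ h => List.map_injective_iff.2 EncInj.inj (Val.ofList_injective h)⟩

@[simp] lemma enc_val (x : Val) : enc x = x := rfl
@[simp] lemma enc_pair {α β : Type*} [Enc α] [Enc β] (a : α) (b : β) :
    enc (a, b) = .node (enc a) (enc b) := rfl
@[simp] lemma enc_nil {α : Type*} [Enc α] : enc ([] : List α) = .nil := rfl
@[simp] lemma enc_cons {α : Type*} [Enc α] (a : α) (l : List α) :
    enc (a :: l) = .node (enc a) (enc l) := rfl
@[simp] lemma enc_zero : enc 0 = Val.nil := rfl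
@[simp] lemma enc_succ (n : ℕ) : enc (n + 1) = .node .nil (enc n) := rfl
@[simp] lemma enc_true : enc true = Val.node .nil .nil := rfl
@[simp] lemma enc_false : enc false = Val.nil := rfl

lemma size_enc_nat (n : ℕ) : (enc n).size = 2 * n + 1 := by
  induction n with
  | zero => rfl
  | succ n ih => simp only [enc_succ, Val.size, ih]; ring

lemma size_enc_list {α : Type*} [Enc α] (l : List α) :
    (enc l).size = (l.map fun x => (enc x).size + 1).sum + 1 := by
  induction l with
  | nil => rfl
  | cons x l ih => simp only [enc_cons, Val.size, ih, List.map_cons, List.sum_cons]; ring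

lemma size_enc_mem {α : Type*} [Enc α] {l : List α} {x : α} (h : x ∈ l) :
    (enc x).size ≤ (enc l).size := by
  rw [size_enc_list]
  have := List.single_le_sum (l := l.map fun x => (enc x).size + 1) (by simp) _
    (List.mem_map_of_mem h)
  omega

lemma length_le_size {α : Type*} [Enc α] (l : List α) : l.length ≤ (enc l).size := by
  induction l with
  | nil => simp
  | cons x l ih => simp only [enc_cons, Val.size, List.length_cons]; omega

lemma size_enc_list_le {α : Type*} [Enc α] (l : List α) (B : ℕ)
    (h : ∀ x ∈ l, (enc x).size ≤ B) : (enc l).size ≤ l.length * (B + 1) + 1 := by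
  rw [size_enc_list]
  have := List.sum_le_card_nsmul (l.map fun x => (enc x).size + 1) (B + 1) (by
    intro y hy
    obtain ⟨x, hx, rfl⟩ := List.mem_map.1 hy
    have := h x hx
    omega)
  simpa using this

/-- A context: the inputs under consideration, a weight that may enter running times linearly,
and a measure that may enter running times and sizes polynomially. -/
structure Ctx (Γ : Type*) where
  ok : Γ → Prop
  w : Γ → ℕ
  μ : Γ → ℕ

section Ctx
variable {Γ : Type*} {Δ : Type*} {α : Type*} {β : Type*} {δ : Type*}

/-- Adds a variable that satisfies `P`. -/
def Ctx.ext [Enc α] (c : Ctx Γ) (P : Γ → α → Prop) : Ctx (Γ × α) where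
  ok p := c.ok p.1 ∧ P p.1 p.2
  w p := c.w p.1
  μ p := c.μ p.1 + (enc p.2).size

/-- Adds a promise. -/
def Ctx.restrict (c : Ctx Γ) (P : Γ → Prop) : Ctx Γ where
  ok γ := c.ok γ ∧ P γ
  w := c.w
  μ := c.μ

/-- Drops the weight. -/
def Ctx.light (c : Ctx Γ) : Ctx Γ where
  ok := c.ok
  w _ := 0
  μ := c.μ

/-- `T` is polynomially bounded by the measure of the context. -/
def PB (c : Ctx Γ) (T : Γ → ℕ) : Prop := ∃ k, ∀ γ, c.ok γ → T γ ≤ (c.μ γ + 2) ^ k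

lemma PB.mono {c : Ctx Γ} {S T : Γ → ℕ} (hT : PB c T) (h : ∀ γ, c.ok γ → S γ ≤ T γ) : PB c S := by
  obtain ⟨k, hk⟩ := hT
  exact ⟨k, fun γ hγ => (h γ hγ).trans (hk γ hγ)⟩

lemma PB.const (c : Ctx Γ) (m : ℕ) : PB c fun _ => m :=
  ⟨m, fun γ _ => (Nat.lt_two_pow_self).le.trans (Nat.pow_le_pow_left (by omega) m)⟩

lemma PB.mu (c : Ctx Γ) : PB c c.μ := ⟨1, fun γ _ => by rw [pow_one]; omega⟩

lemma PB.add {c : Ctx Γ} {S T : Γ → ℕ} (hS : PB c S) (hT : PB c T) : PB c fun γ => S γ + T γ := by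
  obtain ⟨k, hk⟩ := hS
  obtain ⟨l, hl⟩ := hT
  refine ⟨max k l + 1, fun γ hγ => ?_⟩
  have h1 := (hk γ hγ).trans (Nat.pow_le_pow_right (by omega) (le_max_left k l))
  have h2 := (hl γ hγ).trans (Nat.pow_le_pow_right (by omega) (le_max_right k l))
  rw [pow_succ]
  have : 0 ≤ (c.μ γ + 2) ^ max k l * c.μ γ := Nat.zero_le _
  nlinarith

lemma PB.mul {c : Ctx Γ} {S T : Γ → ℕ} (hS : PB c S) (hT : PB c T) : PB c fun γ => S γ * T γ := by
  obtain ⟨k, hk⟩ := hS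
  obtain ⟨l, hl⟩ := hT
  exact ⟨k + l, fun γ hγ => by rw [pow_add]; exact Nat.mul_le_mul (hk γ hγ) (hl γ hγ)⟩

lemma PB.pow {c : Ctx Γ} {S : Γ → ℕ} (hS : PB c S) (m : ℕ) : PB c fun γ => S γ ^ m := by
  obtain ⟨k, hk⟩ := hS
  exact ⟨k * m, fun γ hγ => by rw [pow_mul]; exact Nat.pow_le_pow_left (hk γ hγ) m⟩

lemma PB.comp {c : Ctx Γ} {c' : Ctx Δ} {T : Δ → ℕ} {f : Γ → Δ} (hT : PB c' T)
    (hok : ∀ γ, c.ok γ → c'.ok (f γ)) (hμ : PB c fun γ => c'.μ (f γ)) : PB c fun γ => T (f γ) := by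
  obtain ⟨k, hk⟩ := hT
  exact ((hμ.add (PB.const c 2)).pow k).mono fun γ hγ => hk _ (hok γ hγ)

lemma PB.weaken [Enc α] {c : Ctx Γ} {P : Γ → α → Prop} {T : Γ → ℕ} (h : PB c T) :
    PB (c.ext P) fun p => T p.1 :=
  h.comp (fun _ h => h.1) ((PB.mu (c.ext P)).mono fun _ _ => Nat.le_add_right _ _)

/-! ### Composition of programs with resource bounds -/

/-- `f` is computed in time `(w + 1) · poly(μ)`. -/
def Tm [Enc Γ] [Enc α] (c : Ctx Γ) (f : Γ → α) : Prop :=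
  ∃ (p : Prog) (T : Γ → ℕ), PB c T ∧
    ∀ γ, c.ok γ → ∃ t ≤ (c.w γ + 1) * T γ, p.Eval (enc γ) (enc (f γ)) t

/-- `f` is computed in time `(w + 1) · poly(μ)`, and its values have size `poly(μ)`. -/
structure Cmp [Enc Γ] [Enc α] (c : Ctx Γ) (f : Γ → α) : Prop where
  tm : Tm c f
  sz : PB c fun γ => (enc (f γ)).size

variable [Enc Γ] [Enc Δ] [Enc α] [Enc β] [Enc δ] {c : Ctx Γ}

lemma PB.const_le {w : ℕ} {m T : ℕ} (h : m ≤ T) : m ≤ (w + 1) * T :=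
  h.trans (Nat.le_mul_of_pos_left _ (Nat.succ_pos _))

lemma Tm.id : Tm c fun γ : Γ => γ :=
  ⟨.id, fun _ => 1, PB.const c 1, fun _ _ => ⟨1, PB.const_le le_rfl, .id _⟩⟩

lemma exists_prog_const (y : Val) : ∃ (p : Prog) (t : ℕ), ∀ x, p.Eval x y t := by
  induction y with
  | nil => exact ⟨.nil, 1, fun x => .nil x⟩
  | node y z hy hz =>
    obtain ⟨p, s, hp⟩ := hy
    obtain ⟨q, t, hq⟩ := hz
    exact ⟨.cons p q, s + t + 1, fun x => .cons (hp x) (hq x)⟩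

lemma Cmp.const (a : α) : Cmp c fun _ => a := by
  obtain ⟨p, t, hp⟩ := exists_prog_const (enc a)
  exact ⟨⟨p, fun _ => t, PB.const c t, fun _ _ => ⟨t, PB.const_le le_rfl, hp _⟩⟩, PB.const c _⟩

/-- Postprocessing by a program that runs in constant time. -/
lemma Tm.map_const {f : Γ → α} {g : Γ → β} (hf : Tm c f) (q : Prog) (s : ℕ)
    (hq : ∀ γ, c.ok γ → ∃ t ≤ s, q.Eval (enc (f γ)) (enc (g γ)) t) : Tm c g := by
  obtain ⟨p, T, hT, hp⟩ := hf
  refine ⟨.seq p q, fun γ => T γ + (s + 1), hT.add (PB.const c _), fun γ hγ => ?_⟩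
  obtain ⟨t, ht, h⟩ := hp γ hγ
  obtain ⟨t', ht', h'⟩ := hq γ hγ
  refine ⟨_, ?_, .seq h h'⟩
  rw [Nat.mul_add]
  have := PB.const_le (w := c.w γ) (le_refl (s + 1))
  omega

/-- The two resources compose differently. The measure of the intermediate value may grow
polynomially, but its weight must not grow at all, because the weight may enter the running time
only linearly. -/
lemma Tm.comp {c' : Ctx Δ} {f : Γ → Δ} {g : Δ → α} (hg : Tm c' g) (hf : Tm c f)
    (hok : ∀ γ, c.ok γ → c'.ok (f γ)) (hw : ∀ γ, c.ok γ → c'.w (f γ) ≤ c.w γ)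
    (hμ : PB c fun γ => c'.μ (f γ)) : Tm c fun γ => g (f γ) := by
  obtain ⟨p, T, hT, hp⟩ := hf
  obtain ⟨q, S, hS, hq⟩ := hg
  refine ⟨.seq p q, fun γ => T γ + S (f γ) + 1, (hT.add (hS.comp hok hμ)).add (PB.const c _),
    fun γ hγ => ?_⟩
  obtain ⟨t, ht, h⟩ := hp γ hγ
  obtain ⟨t', ht', h'⟩ := hq _ (hok γ hγ)
  refine ⟨_, ?_, .seq h h'⟩
  have h1 : (c'.w (f γ) + 1) * S (f γ) ≤ (c.w γ + 1) * S (f γ) :=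
    Nat.mul_le_mul_right _ (Nat.succ_le_succ (hw γ hγ))
  rw [Nat.mul_add, Nat.mul_add]
  omega

lemma Cmp.comp {c' : Ctx Δ} {f : Γ → Δ} {g : Δ → α} (hg : Cmp c' g) (hf : Tm c f)
    (hok : ∀ γ, c.ok γ → c'.ok (f γ)) (hw : ∀ γ, c.ok γ → c'.w (f γ) ≤ c.w γ)
    (hμ : PB c fun γ => c'.μ (f γ)) : Cmp c fun γ => g (f γ) :=
  ⟨hg.tm.comp hf hok hw hμ, hg.sz.comp hok hμ⟩

lemma Tm.congr {f g : Γ → α} (hf : Tm c f) (h : ∀ γ, c.ok γ → f γ = g γ) : Tm c g := by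
  obtain ⟨p, T, hT, hp⟩ := hf
  exact ⟨p, T, hT, fun γ hγ => h γ hγ ▸ hp γ hγ⟩

/-- Programs see trees only. Functions into different types with equal codes share a program, which
lets numbers pass for lists and nested pairs for written formulas. -/
lemma Tm.recode {f : Γ → α} {g : Γ → β} (hf : Tm c f) (h : ∀ γ, c.ok γ → enc (f γ) = enc (g γ)) :
    Tm c g := by
  obtain ⟨p, T, hT, hp⟩ := hf
  exact ⟨p, T, hT, fun γ hγ => h γ hγ ▸ hp γ hγ⟩

lemma Cmp.recode {f : Γ → α} {g : Γ → β} (hf : Cmp c f)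
    (h : ∀ γ, c.ok γ → enc (f γ) = enc (g γ)) : Cmp c g :=
  ⟨hf.tm.recode h, hf.sz.mono fun γ hγ => (h γ hγ ▸ le_rfl)⟩

lemma Cmp.congr {f g : Γ → α} (hf : Cmp c f) (h : ∀ γ, c.ok γ → f γ = g γ) : Cmp c g :=
  hf.recode fun γ hγ => by rw [h γ hγ]

/-- Change of the weight, measure and promises. -/
lemma Tm.change {c' : Ctx Γ} {f : Γ → α} (hf : Tm c' f) (hok : ∀ γ, c.ok γ → c'.ok γ)
    (hw : ∀ γ, c.ok γ → c'.w γ ≤ c.w γ) (hμ : PB c c'.μ) : Tm c f :=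
  Tm.comp (f := fun γ => γ) hf Tm.id hok hw hμ

lemma Cmp.change {c' : Ctx Γ} {f : Γ → α} (hf : Cmp c' f) (hok : ∀ γ, c.ok γ → c'.ok γ)
    (hw : ∀ γ, c.ok γ → c'.w γ ≤ c.w γ) (hμ : PB c c'.μ) : Cmp c f :=
  ⟨hf.tm.change hok hw hμ, hf.sz.comp (f := fun γ => γ) hok hμ⟩

lemma Tm.restrict {f : Γ → α} {P : Γ → Prop} (hf : Tm c f) : Tm (c.restrict P) f :=
  hf.change (fun _ h => h.1) (fun _ _ => le_rfl) (PB.mu (c.restrict P))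

lemma Cmp.restrict {f : Γ → α} {P : Γ → Prop} (hf : Cmp c f) : Cmp (c.restrict P) f :=
  hf.change (fun _ h => h.1) (fun _ _ => le_rfl) (PB.mu (c.restrict P))

omit [Enc Γ] in
lemma PB.restrict {f : Γ → ℕ} {P : Γ → Prop} (hf : PB c f) : PB (c.restrict P) f :=
  hf.comp (f := fun γ => γ) (fun _ h => h.1) (PB.mu (c.restrict P))

lemma Cmp.of_light {f : Γ → α} (hf : Cmp c.light f) : Cmp c f :=
  hf.change (fun _ h => h) (fun _ _ => Nat.zero_le _) (PB.mu c)

omit [Enc Γ] in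
lemma PB.light {f : Γ → ℕ} (hf : PB c f) : PB c.light f := hf

lemma Tm.pair {f : Γ → α} {g : Γ → β} (hf : Tm c f) (hg : Tm c g) : Tm c fun γ => (f γ, g γ) := by
  obtain ⟨p, T, hT, hp⟩ := hf
  obtain ⟨q, S, hS, hq⟩ := hg
  refine ⟨.cons p q, fun γ => T γ + S γ + 1, (hT.add hS).add (PB.const c _), fun γ hγ => ?_⟩
  obtain ⟨t, ht, h⟩ := hp γ hγ
  obtain ⟨t', ht', h'⟩ := hq γ hγ
  refine ⟨_, ?_, .cons h h'⟩
  rw [Nat.mul_add, Nat.mul_add]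
  omega

lemma Cmp.pair {f : Γ → α} {g : Γ → β} (hf : Cmp c f) (hg : Cmp c g) :
    Cmp c fun γ => (f γ, g γ) :=
  ⟨hf.tm.pair hg.tm, (hf.sz.add hg.sz).add (PB.const c 1)⟩

lemma Tm.fst {f : Γ → α × β} (hf : Tm c f) : Tm c fun γ => (f γ).1 :=
  hf.map_const .hd 1 fun _ _ => ⟨1, le_rfl, .hd_node _ _⟩

lemma Tm.snd {f : Γ → α × β} (hf : Tm c f) : Tm c fun γ => (f γ).2 :=
  hf.map_const .tl 1 fun _ _ => ⟨1, le_rfl, .tl_node _ _⟩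

lemma size_fst (p : α × β) : (enc p.1).size ≤ (enc p).size := by
  change _ ≤ (enc p.1).size + (enc p.2).size + 1; omega

lemma size_snd (p : α × β) : (enc p.2).size ≤ (enc p).size := by
  change _ ≤ (enc p.1).size + (enc p.2).size + 1; omega

lemma Cmp.fst {f : Γ → α × β} (hf : Cmp c f) : Cmp c fun γ => (f γ).1 :=
  ⟨hf.tm.fst, hf.sz.mono fun _ _ => size_fst _⟩

lemma Cmp.snd {f : Γ → α × β} (hf : Cmp c f) : Cmp c fun γ => (f γ).2 :=
  ⟨hf.tm.snd, hf.sz.mono fun _ _ => size_snd _⟩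

lemma Tm.weaken {P : Γ → α → Prop} {f : Γ → β} (hf : Tm c f) :
    Tm (c.ext P) fun p => f p.1 :=
  hf.comp (Tm.id.fst) (fun _ h => h.1) (fun _ _ => le_rfl)
    ((PB.mu (c.ext P)).mono fun _ _ => Nat.le_add_right _ _)

lemma Cmp.weaken {P : Γ → α → Prop} {f : Γ → β} (hf : Cmp c f) :
    Cmp (c.ext P) fun p => f p.1 :=
  ⟨hf.tm.weaken, hf.sz.weaken⟩

lemma Cmp.var {P : Γ → α → Prop} : Cmp (c.ext P) fun p => p.2 :=
  ⟨Tm.id.snd, (PB.mu (c.ext P)).mono fun _ _ => Nat.le_add_left _ _⟩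

lemma Tm.node {f : Γ → Val} {g : Γ → Val} (hf : Tm c f) (hg : Tm c g) :
    Tm c fun γ => Val.node (f γ) (g γ) :=
  (hf.pair hg).recode fun _ _ => rfl

lemma Tm.cons {f : Γ → α} {g : Γ → List α} (hf : Tm c f) (hg : Tm c g) :
    Tm c fun γ => f γ :: g γ :=
  (hf.pair hg).recode fun _ _ => rfl

lemma Cmp.cons {f : Γ → α} {g : Γ → List α} (hf : Cmp c f) (hg : Cmp c g) :
    Cmp c fun γ => f γ :: g γ :=
  (hf.pair hg).recode fun _ _ => rfl

lemma Tm.succ {f : Γ → ℕ} (hf : Tm c f) : Tm c fun γ => f γ + 1 :=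
  ((Cmp.const ()).tm.pair hf).recode fun _ _ => rfl

lemma Cmp.succ {f : Γ → ℕ} (hf : Cmp c f) : Cmp c fun γ => f γ + 1 :=
  ((Cmp.const ()).pair hf).recode fun _ _ => rfl

lemma Tm.tail {f : Γ → List α} (hf : Tm c f) : Tm c fun γ => (f γ).tail :=
  hf.map_const .tl 1 fun γ _ => ⟨1, le_rfl, by cases f γ <;> constructor⟩

lemma size_tail (l : List α) : (enc l.tail).size ≤ (enc l).size := by
  cases l with
  | nil => exact le_rfl
  | cons x l => simp only [List.tail_cons, enc_cons, Val.size]; omega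

lemma Cmp.tail {f : Γ → List α} (hf : Cmp c f) : Cmp c fun γ => (f γ).tail :=
  ⟨hf.tm.tail, hf.sz.mono fun _ _ => size_tail _⟩

lemma Cmp.headD {f : Γ → List ℕ} (hf : Cmp c f) : Cmp c fun γ => (f γ).headD 0 :=
  ⟨hf.tm.map_const .hd 1 fun γ _ => ⟨1, le_rfl, by cases f γ <;> constructor⟩,
    (hf.sz.add (PB.const c 1)).mono fun γ _ => by
      cases f γ with
      | nil => simp [Val.size]
      | cons x l => simp only [List.headD_cons, enc_cons, Val.size]; omega⟩

lemma Cmp.pred {f : Γ → ℕ} (hf : Cmp c f) : Cmp c fun γ => f γ - 1 :=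
  ⟨hf.tm.map_const .tl 1 fun γ _ => ⟨1, le_rfl, by cases f γ <;> constructor⟩,
    hf.sz.mono fun γ _ => by rw [size_enc_nat, size_enc_nat]; omega⟩

lemma Tm.ite {b : Γ → Bool} {f g : Γ → α} (hb : Tm c b)
    (hf : Tm (c.restrict fun γ => b γ = true) f) (hg : Tm (c.restrict fun γ => b γ = false) g) :
    Tm c fun γ => if b γ = true then f γ else g γ := by
  obtain ⟨p, T, hT, hp⟩ := hb
  obtain ⟨q, S, ⟨k, hk⟩, hq⟩ := hf
  obtain ⟨r, R, ⟨l, hl⟩, hr⟩ := hg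
  -- The bounds of the branches are controlled only under their promises, so the powers that
  -- dominate them there are used in their place.
  refine ⟨.ite p q r, fun γ => T γ + ((c.μ γ + 2) ^ k + (c.μ γ + 2) ^ l) + 1,
    (hT.add (PB.add ⟨k, fun _ _ => le_rfl⟩ ⟨l, fun _ _ => le_rfl⟩)).add (PB.const c _),
    fun γ hγ => ?_⟩
  obtain ⟨t, ht, h⟩ := hp γ hγ
  rw [Nat.mul_add, Nat.mul_add, Nat.mul_add]
  cases hb : b γ
  · obtain ⟨t', ht', h'⟩ := hr γ ⟨hγ, hb⟩
    rw [hb] at h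
    refine ⟨_, ?_, by beta_reduce; rw [if_neg (by simp [hb])]; exact .ite_false h h'⟩
    have : t' ≤ (c.w γ + 1) * (c.μ γ + 2) ^ l :=
      ht'.trans (Nat.mul_le_mul_left (c.w γ + 1) (hl γ ⟨hγ, hb⟩))
    omega
  · obtain ⟨t', ht', h'⟩ := hq γ ⟨hγ, hb⟩
    rw [hb] at h
    refine ⟨_, ?_, by beta_reduce; rw [if_pos hb]; exact .ite_true h h'⟩
    have : t' ≤ (c.w γ + 1) * (c.μ γ + 2) ^ k :=
      ht'.trans (Nat.mul_le_mul_left (c.w γ + 1) (hk γ ⟨hγ, hb⟩))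
    omega

omit [Enc Γ] in
lemma PB.ite {b : Γ → Bool} {f g : Γ → ℕ}
    (hf : PB (c.restrict fun γ => b γ = true) f) (hg : PB (c.restrict fun γ => b γ = false) g) :
    PB c fun γ => if b γ = true then f γ else g γ := by
  obtain ⟨k, hk⟩ := hf
  obtain ⟨l, hl⟩ := hg
  refine PB.mono (PB.add (S := fun γ => (c.μ γ + 2) ^ k) (T := fun γ => (c.μ γ + 2) ^ l)
    ⟨k, fun _ _ => le_rfl⟩ ⟨l, fun _ _ => le_rfl⟩) fun γ hγ => ?_
  cases hb : b γ
  · rw [if_neg (by simp)]; exact (hl γ ⟨hγ, hb⟩).trans (Nat.le_add_left _ _)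
  · rw [if_pos rfl]; exact (hk γ ⟨hγ, hb⟩).trans (Nat.le_add_right _ _)

lemma Cmp.ite {b : Γ → Bool} {f g : Γ → α} (hb : Tm c b)
    (hf : Cmp (c.restrict fun γ => b γ = true) f) (hg : Cmp (c.restrict fun γ => b γ = false) g) :
    Cmp c fun γ => if b γ = true then f γ else g γ :=
  ⟨hb.ite hf.tm hg.tm, (PB.ite hf.sz hg.sz).mono fun γ _ => by split_ifs <;> exact le_rfl⟩

lemma Cmp.and {b d : Γ → Bool} (hb : Cmp c b) (hd : Cmp c d) : Cmp c fun γ => b γ && d γ :=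
  (Cmp.ite hb.tm hd.restrict (Cmp.const false)).congr fun γ _ => by cases b γ <;> simp

lemma Cmp.or {b d : Γ → Bool} (hb : Cmp c b) (hd : Cmp c d) : Cmp c fun γ => b γ || d γ :=
  (Cmp.ite hb.tm (Cmp.const true) hd.restrict).congr fun γ _ => by cases b γ <;> simp

lemma Cmp.not {b : Γ → Bool} (hb : Cmp c b) : Cmp c fun γ => !b γ :=
  (Cmp.ite hb.tm (Cmp.const false) (Cmp.const true)).congr fun γ _ => by cases b γ <;> simp

lemma Cmp.null {f : Γ → ℕ} (hf : Tm c f) : Cmp c fun γ => decide (f γ = 0) := by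
  refine ⟨hf.map_const (.ite .id .nil (.cons .nil .nil)) 10 fun γ _ => ?_,
    (PB.const c 3).mono fun γ _ => ?_⟩
  · cases f γ with
    | zero => exact ⟨_, by decide, .ite_false (.id _) (.cons (.nil _) (.nil _))⟩
    | succ m => exact ⟨_, by decide, .ite_true (.id _) (.nil _)⟩
  · by_cases h : f γ = 0 <;> simp [h, Val.size]

end Ctx

/-! ### Folds over lists -/

section Fold
variable {Γ : Type*} {Δ : Type*} {α : Type*} {β : Type*} {δ : Type*}
variable [Enc Γ] [Enc Δ] [Enc α] [Enc β] [Enc δ] {c : Ctx Γ}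

/-- The program of a fold over a list. -/
def foldProg (pl pi ps : Prog) : Prog :=
  .seq (.cons .id (.cons pi pl))
    (.seq
      (.loop (.seq .tl .tl)
        (.cons .hd (.cons
          (.seq (.cons .hd (.cons (.seq .tl .hd) (.seq .tl (.seq .tl .hd)))) ps)
          (.seq .tl (.seq .tl .tl)))))
      (.seq .tl .hd))

/-- The state is `(γ, (acc, rest))`. The invariant may refer to the remaining list, so that it can
describe how far the fold has come. The constant 40 pays for unpacking and rebuilding the state in
one turn. -/
lemma loop_foldl (ps : Prog) (γ : Γ) (step : β → α → β) (I : List α → β → Prop) (B : ℕ) (l : List α)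
    (hs : ∀ x m acc, x :: m <:+ l → I (x :: m) acc → I m (step acc x) ∧
      ∃ t ≤ B, ps.Eval (enc (γ, (acc, x))) (enc (step acc x)) t) :
    ∀ acc, I l acc → ∃ t ≤ l.length * (B + 40) + 10,
      (Prog.loop (.seq .tl .tl)
        (.cons .hd (.cons
          (.seq (.cons .hd (.cons (.seq .tl .hd) (.seq .tl (.seq .tl .hd)))) ps)
          (.seq .tl (.seq .tl .tl))))).Eval (enc (γ, (acc, l)))
        (enc (γ, (l.foldl step acc, ([] : List α)))) t := by
  induction l with
  | nil =>
    intro acc _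
    exact ⟨_, by simp, .loop_exit (.seq (.tl_node _ _) (.tl_node _ _))⟩
  | cons x l ih =>
    intro acc hacc
    obtain ⟨hI, t, ht, h⟩ := hs x l acc List.suffix_rfl hacc
    obtain ⟨t', ht', h'⟩ := ih
      (fun y m acc hm => hs y m acc (hm.trans (List.suffix_cons x l))) _ hI
    refine ⟨_, ?_, .loop_step (.seq (.tl_node _ _) (.tl_node _ _))
      (.cons (.hd_node _ _) (.cons (.seq (.cons (.hd_node _ _) (.cons
        (.seq (.tl_node _ _) (.hd_node _ _))
        (.seq (.tl_node _ _) (.seq (.tl_node _ _) (.hd_node _ _))))) h)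
        (.seq (.tl_node _ _) (.seq (.tl_node _ _) (.tl_node _ _))))) h'⟩
    simp only [List.length_cons, Nat.add_mul]
    omega

/-- The running time of a fold: the accumulator satisfies an invariant under which a step has
weight at most `W` and measure at most `B`. -/
lemma Tm.foldl_core {c' : Ctx (Γ × (β × α))} {l : Γ → List α} {ini : Γ → β}
    {step : Γ → β → α → β} (I : Γ → List α → β → Prop) (B W M : Γ → ℕ)
    (hl : Tm c l) (hi : Tm c ini) (hs : Tm c' fun p => step p.1 p.2.1 p.2.2)
    (hB : PB c B) (hM : PB c M)
    (hI₀ : ∀ γ, c.ok γ → I γ (l γ) (ini γ))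
    (hI : ∀ γ acc x m, c.ok γ → I γ (x :: m) acc → x ∈ l γ → I γ m (step γ acc x) ∧
      c'.ok (γ, (acc, x)) ∧ c'.w (γ, (acc, x)) ≤ W γ ∧ c'.μ (γ, (acc, x)) ≤ B γ)
    (hlen : ∀ γ, c.ok γ → ((l γ).length + 1) * (W γ + 1) ≤ (c.w γ + 1) * M γ) :
    Tm c fun γ => (l γ).foldl (step γ) (ini γ) := by
  obtain ⟨pl, Tl, hTl, hl⟩ := hl
  obtain ⟨pi, Ti, hTi, hi⟩ := hi
  obtain ⟨ps, Ts, ⟨k, hk⟩, hs⟩ := hs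
  refine ⟨foldProg pl pi ps, fun γ => Tl γ + Ti γ + M γ * ((B γ + 2) ^ k + 40) + 40,
    (((hTl.add hTi).add (hM.mul (((hB.add (PB.const c 2)).pow k).add (PB.const c 40))))).add
      (PB.const c 40), fun γ hγ => ?_⟩
  obtain ⟨tl, htl, el⟩ := hl γ hγ
  obtain ⟨ti, hti, ei⟩ := hi γ hγ
  obtain ⟨t, ht, e⟩ := loop_foldl ps γ (step γ) (I γ) ((W γ + 1) * (B γ + 2) ^ k) (l γ)
    (fun x m acc hx hacc => by
      obtain ⟨h1, h2, h3, h4⟩ := hI γ acc x m hγ hacc (hx.subset (by simp))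
      obtain ⟨t, ht, e⟩ := hs _ h2
      exact ⟨h1, t, ht.trans (Nat.mul_le_mul (Nat.succ_le_succ h3)
        ((hk _ h2).trans (Nat.pow_le_pow_left (Nat.add_le_add_right h4 2) k))), e⟩)
    (ini γ) (hI₀ γ hγ)
  refine ⟨_, ?_, .seq (.cons (.id _) (.cons ei el)) (.seq e (.seq (.tl_node _ _) (.hd_node _ _)))⟩
  -- The hypothesis `hlen` is one budget for two kinds of folds: short lists whose steps use the
  -- full weight, and lists as long as the weight whose steps use none.
  have h1 : (l γ).length * ((W γ + 1) * (B γ + 2) ^ k + 40) ≤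
      (c.w γ + 1) * (M γ * ((B γ + 2) ^ k + 40)) := by
    calc (l γ).length * ((W γ + 1) * (B γ + 2) ^ k + 40)
        ≤ ((l γ).length + 1) * ((W γ + 1) * ((B γ + 2) ^ k + 40)) := by
          apply Nat.mul_le_mul (Nat.le_succ _)
          rw [Nat.mul_add]
          have := PB.const_le (w := W γ) (le_refl 40)
          omega
      _ = (((l γ).length + 1) * (W γ + 1)) * ((B γ + 2) ^ k + 40) := by ring
      _ ≤ ((c.w γ + 1) * M γ) * ((B γ + 2) ^ k + 40) := Nat.mul_le_mul_right _ (hlen γ hγ)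
      _ = _ := by ring
  have h2 := PB.const_le (w := c.w γ) (le_refl 40)
  rw [Nat.mul_add, Nat.mul_add, Nat.mul_add]
  omega

omit [Enc α] [Enc β] in
lemma foldl_invariant (l : List α) (step : β → α → β) (I : β → Prop) {b : β} (hb : I b)
    (h : ∀ acc, I acc → ∀ x ∈ l, I (step acc x)) : I (l.foldl step b) := by
  induction l generalizing b with
  | nil => exact hb
  | cons x l ih => exact ih (h b hb x (by simp)) fun acc ha y hy => h acc ha y (by simp [hy])

/-- A fold over a small list whose intermediate results are small. -/
lemma Cmp.foldl_prefix {l : Γ → List α} {ini : Γ → β} {step : Γ → β → α → β}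
    (S : Γ → ℕ) (hl : Cmp c l) (hi : Tm c ini)
    (hs : Tm (c.ext fun γ (q : β × α) => ∃ m m', m ++ q.2 :: m' = l γ ∧
      m.foldl (step γ) (ini γ) = q.1) fun p => step p.1 p.2.1 p.2.2)
    (hS : PB c S)
    (hIS : ∀ γ m, c.ok γ → m <+: l γ → (enc (m.foldl (step γ) (ini γ))).size ≤ S γ) :
    Cmp c fun γ => (l γ).foldl (step γ) (ini γ) := by
  refine ⟨?_, hS.mono fun γ hγ => hIS γ _ hγ List.prefix_rfl⟩
  refine Tm.foldl_core (fun γ r acc => ∃ m, m ++ r = l γ ∧ m.foldl (step γ) (ini γ) = acc)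
    (fun γ => c.μ γ + (S γ + (enc (l γ)).size + 1)) c.w
    (fun γ => (enc (l γ)).size + 1) hl.tm hi hs
    ((PB.mu c).add ((hS.add hl.sz).add (PB.const c 1))) (hl.sz.add (PB.const c 1))
    (fun γ _ => ⟨[], rfl, rfl⟩)
    (fun γ acc x m' hγ ⟨m, hm, ha⟩ hx => ⟨⟨m ++ [x], by simpa using hm, by simp [ha]⟩,
      ⟨hγ, m, m', hm, ha⟩, le_rfl, ?_⟩) fun γ _ => ?_
  · have h1 := hIS γ m hγ ⟨_, hm⟩
    have h2 := size_enc_mem hx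
    rw [ha] at h1
    simp only [Ctx.ext, enc_pair, Val.size]
    omega
  · rw [Nat.mul_comm]
    exact Nat.mul_le_mul_left _ (Nat.succ_le_succ (length_le_size _))

/-- A fold over a large list with small elements and accumulators. -/
lemma Cmp.foldl_big {l : Γ → List α} {ini : Γ → β} {step : Γ → β → α → β} (I : Γ → β → Prop)
    (S R : Γ → ℕ) (hl : Tm c l) (hi : Tm c ini)
    (hs : Tm (c.light.ext fun γ (q : β × α) => I γ q.1 ∧ q.2 ∈ l γ) fun p => step p.1 p.2.1 p.2.2)
    (hI₀ : ∀ γ, c.ok γ → I γ (ini γ))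
    (hI : ∀ γ acc x, c.ok γ → I γ acc → x ∈ l γ → I γ (step γ acc x))
    (hS : PB c S) (hIS : ∀ γ acc, c.ok γ → I γ acc → (enc acc).size ≤ S γ)
    (hR : PB c R) (hRl : ∀ γ, c.ok γ → ∀ x ∈ l γ, (enc x).size ≤ R γ)
    (hlen : ∀ γ, c.ok γ → (l γ).length ≤ c.w γ) :
    Cmp c fun γ => (l γ).foldl (step γ) (ini γ) := by
  constructor
  · refine Tm.foldl_core (fun γ _ => I γ) (fun γ => c.μ γ + (S γ + R γ + 1)) (fun _ => 0)
      (fun γ => 1) hl hi hs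
      ((PB.mu c).add ((hS.add hR).add (PB.const c 1))) (PB.const c 1) hI₀
      (fun γ acc x _ hγ ha hx => ⟨hI γ acc x hγ ha hx, ⟨hγ, ha, hx⟩, le_rfl, ?_⟩) fun γ hγ => ?_
    · have h1 := hIS γ acc hγ ha
      have h2 := hRl γ hγ x hx
      simp only [Ctx.ext, Ctx.light, enc_pair, Val.size]
      omega
    · have := hlen γ hγ
      omega
  · exact hS.mono fun γ hγ => hIS γ _ hγ
      (foldl_invariant _ _ (I γ) (hI₀ γ hγ) fun acc ha x hx => hI γ acc x hγ ha hx)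

/-- The context of the step of a fold in which the accumulator is not measured. -/
def Ctx.step (c : Ctx Γ) (β : Type*) (P : Γ → α → Prop) : Ctx (Γ × (β × α)) where
  ok p := c.ok p.1 ∧ P p.1 p.2.2
  w p := c.w p.1
  μ p := c.μ p.1 + (enc p.2.2).size

/-- A fold over a small list with large accumulators. -/
lemma Tm.foldl {l : Γ → List α} {ini : Γ → β} {step : Γ → β → α → β}
    (hl : Cmp c l) (hi : Tm c ini)
    (hs : Tm (c.step β fun γ x => x ∈ l γ) fun p => step p.1 p.2.1 p.2.2) :
    Tm c fun γ => (l γ).foldl (step γ) (ini γ) := by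
  refine Tm.foldl_core (fun _ _ _ => True)
    (fun γ => c.μ γ + (enc (l γ)).size) c.w (fun γ => (enc (l γ)).size + 1) hl.tm hi hs
    ((PB.mu c).add hl.sz) (hl.sz.add (PB.const c 1)) (fun _ _ => trivial)
    (fun γ acc x _ hγ _ hx => ⟨trivial, ⟨hγ, hx⟩, le_rfl, ?_⟩) fun γ _ => ?_
  · exact Nat.add_le_add_left (size_enc_mem hx) _
  · rw [Nat.mul_comm]
    exact Nat.mul_le_mul_left _ (Nat.succ_le_succ (length_le_size _))

lemma Tm.weaken_step {P : Γ → α → Prop} {g : Γ → α → δ} (hg : Tm (c.ext P) fun p => g p.1 p.2) :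
    Tm (c.step β P) fun p => g p.1 p.2.2 :=
  hg.comp (c := c.step β P) (f := fun p => (p.1, p.2.2)) (Tm.id.fst.pair Tm.id.snd.snd)
    (fun _ h => h) (fun _ _ => le_rfl) (PB.mu (c.step β P))

lemma Cmp.weaken_step {P : Γ → α → Prop} {g : Γ → α → δ} (hg : Cmp (c.ext P) fun p => g p.1 p.2) :
    Cmp (c.step β P) fun p => g p.1 p.2.2 :=
  hg.comp (c := c.step β P) (f := fun p => (p.1, p.2.2)) (Tm.id.fst.pair Tm.id.snd.snd)
    (fun _ h => h) (fun _ _ => le_rfl) (PB.mu (c.step β P))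

lemma Cmp.to_step {P : Γ → α → Prop} {f : Γ → δ} (hf : Cmp c f) :
    Cmp (c.step β P) fun p => f p.1 :=
  Cmp.weaken_step (g := fun γ _ => f γ) hf.weaken

lemma foldl_cons_eq {α β : Type*} (f : α → β) (l : List α) (acc : List β) :
    l.foldl (fun acc x => f x :: acc) acc = (l.map f).reverse ++ acc := by
  induction l generalizing acc with
  | nil => rfl
  | cons x l ih => simp [ih]

lemma Tm.reverse_map {l : Γ → List α} {g : Γ → α → β} (hl : Cmp c l)
    (hg : Tm (c.ext fun γ x => x ∈ l γ) fun p => g p.1 p.2) :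
    Tm c fun γ => ((l γ).map (g γ)).reverse :=
  (Tm.foldl (step := fun γ (acc : List β) x => g γ x :: acc) (ini := fun _ => []) hl
    (Cmp.const _).tm (hg.weaken_step.cons Tm.id.snd.fst)).congr fun γ _ => by
      simp [foldl_cons_eq (g γ) (l γ) ([] : List β)]

lemma size_enc_map (l : List α) (f : α → β) (S : ℕ) (h : ∀ x ∈ l, (enc (f x)).size ≤ S) :
    (enc (l.map f)).size ≤ (enc l).size * (S + 1) + 1 := by
  refine (size_enc_list_le (l.map f) S (by simpa using h)).trans ?_
  rw [List.length_map]
  exact Nat.succ_le_succ (Nat.mul_le_mul_right _ (length_le_size l))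

lemma size_reverse (l : List α) : (enc l.reverse).size = (enc l).size := by
  rw [size_enc_list, size_enc_list, List.map_reverse, List.sum_reverse]

/-- An element is no larger than the list that contains it, so a bound that depends on the element
can be made uniform over the list. -/
lemma PB.exists_bound {T : Γ × α → ℕ} {l : Γ → List α}
    (hT : PB (c.ext fun γ x => x ∈ l γ) T) (hl : PB c fun γ => (enc (l γ)).size) :
    ∃ S, PB c S ∧ ∀ γ, c.ok γ → ∀ x ∈ l γ, T (γ, x) ≤ S γ := by
  obtain ⟨k, hk⟩ := hT
  refine ⟨fun γ => (c.μ γ + (enc (l γ)).size + 2) ^ k,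
    (((PB.mu c).add hl).add (PB.const c 2)).pow k, fun γ hγ x hx => ?_⟩
  refine (hk (γ, x) ⟨hγ, hx⟩).trans (Nat.pow_le_pow_left ?_ k)
  have := size_enc_mem hx
  simp only [Ctx.ext]
  omega

lemma Cmp.reverse {l : Γ → List α} (hl : Cmp c l) : Cmp c fun γ => (l γ).reverse :=
  ⟨(Tm.reverse_map (g := fun _ x => x) hl Cmp.var.tm).congr fun _ _ => by simp,
    hl.sz.mono fun _ _ => (size_reverse _).le⟩

lemma Cmp.map {l : Γ → List α} {g : Γ → α → β} (hl : Cmp c l)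
    (hg : Cmp (c.ext fun γ x => x ∈ l γ) fun p => g p.1 p.2) : Cmp c fun γ => (l γ).map (g γ) := by
  obtain ⟨S, hS, hb⟩ := hg.sz.exists_bound hl.sz
  have hsz : PB c fun γ => (enc ((l γ).map (g γ))).size :=
    ((hl.sz.mul (hS.add (PB.const c 1))).add (PB.const c 1)).mono fun γ hγ =>
      size_enc_map _ _ _ (hb γ hγ)
  have h : Cmp c fun γ => ((l γ).map (g γ)).reverse :=
    ⟨Tm.reverse_map hl hg.tm, hsz.mono fun _ _ => (size_reverse _).le⟩
  exact h.reverse.congr fun _ _ => by simp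

lemma size_append (l m : List α) : (enc (l ++ m)).size ≤ (enc l).size + (enc m).size := by
  rw [size_enc_list, size_enc_list, size_enc_list, List.map_append, List.sum_append]
  omega

/-- Only the left list is traversed. The right one is the initial accumulator, which is never
inspected and so may have any size. -/
lemma Tm.append {l m : Γ → List α} (hl : Cmp c l) (hm : Tm c m) : Tm c fun γ => l γ ++ m γ :=
  (Tm.foldl (step := fun _ (acc : List α) x => x :: acc) (ini := m) hl.reverse hm
    ((Tm.id.snd.snd).cons Tm.id.snd.fst)).congr fun γ _ => by
      rw [foldl_cons_eq (fun x => x)]; simp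

lemma Cmp.append {l m : Γ → List α} (hl : Cmp c l) (hm : Cmp c m) : Cmp c fun γ => l γ ++ m γ :=
  ⟨Tm.append hl hm.tm, (hl.sz.add hm.sz).mono fun _ _ => size_append _ _⟩

lemma foldl_append_eq {α β : Type*} (f : α → List β) (l : List α) (acc : List β) :
    l.foldl (fun acc x => f x ++ acc) acc = l.reverse.flatMap f ++ acc := by
  induction l generalizing acc with
  | nil => simp
  | cons x l ih => simp [ih]

lemma size_flatMap (l : List α) (f : α → List β) (S : ℕ) (h : ∀ x ∈ l, (enc (f x)).size ≤ S) :
    (enc (l.flatMap f)).size ≤ l.length * S + 1 := by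
  induction l with
  | nil => simp [Val.size]
  | cons x l ih =>
    have h1 := ih fun y hy => h y (by simp [hy])
    have h2 := h x (by simp)
    rw [List.flatMap_cons, List.length_cons, Nat.add_mul]
    have := size_append (f x) (l.flatMap f)
    omega

lemma Cmp.flatMap {l : Γ → List α} {g : Γ → α → List β} (hl : Cmp c l)
    (hg : Cmp (c.ext fun γ x => x ∈ l γ) fun p => g p.1 p.2) :
    Cmp c fun γ => (l γ).flatMap (g γ) := by
  obtain ⟨S, hS, hb⟩ := hg.sz.exists_bound hl.sz
  refine ⟨(Tm.foldl (step := fun γ (acc : List β) x => g γ x ++ acc) (ini := fun _ => [])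
    hl.reverse (Cmp.const _).tm ?_).congr fun γ _ => ?_,
    ((hl.sz.mul hS).add (PB.const c 1)).mono fun γ hγ =>
      (size_flatMap _ _ _ (hb γ hγ)).trans
        (Nat.succ_le_succ (Nat.mul_le_mul_right _ (length_le_size _)))⟩
  · have hg' : Cmp (c.ext fun γ x => x ∈ (l γ).reverse) fun p => g p.1 p.2 := by simpa using hg
    exact Tm.append hg'.weaken_step Tm.id.snd.fst
  · rw [foldl_append_eq]; simp

/-! ### Boolean operations on lists -/

lemma Cmp.any {l : Γ → List α} {g : Γ → α → Bool} (hl : Cmp c l)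
    (hg : Cmp (c.ext fun γ x => x ∈ l γ) fun p => g p.1 p.2) :
    Cmp c fun γ => (l γ).any (g γ) := by
  refine Cmp.congr (f := fun γ => (l γ).foldl (fun acc x => acc || g γ x) false)
    ⟨Tm.foldl (step := fun γ acc x => acc || g γ x) hl (Cmp.const _).tm ?_, ?_⟩ fun γ _ => ?_
  · refine (Tm.ite (b := fun p => p.2.1) (f := fun _ => true) (g := fun p => g p.1 p.2.2)
      Tm.id.snd.fst (Cmp.const _).tm hg.weaken_step.tm.restrict).congr fun p _ => ?_
    cases p.2.1 <;> simp
  · exact (PB.const c 3).mono fun γ _ => by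
      cases (l γ).foldl (fun acc x => acc || g γ x) false <;> simp [Val.size]
  · have : ∀ (m : List α) b, m.foldl (fun acc x => acc || g γ x) b = (b || m.any (g γ)) := by
      intro m
      induction m with
      | nil => simp
      | cons x m ih => intro b; simp [ih, Bool.or_assoc]
    simp [this]

lemma Cmp.all {l : Γ → List α} {g : Γ → α → Bool} (hl : Cmp c l)
    (hg : Cmp (c.ext fun γ x => x ∈ l γ) fun p => g p.1 p.2) :
    Cmp c fun γ => (l γ).all (g γ) :=
  (Cmp.any (g := fun γ x => !g γ x) hl hg.not).not.congr fun γ _ => by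
    rw [List.not_any_eq_all_not]; simp

/-- The list may be as long as the weight because each test is done at weight zero. It serves to
search the facts of a sphere that is part of the input formula. -/
lemma Cmp.any_big {l : Γ → List α} {g : Γ → α → Bool} (R : Γ → ℕ) (hl : Tm c l)
    (hg : Cmp (c.light.ext fun γ x => x ∈ l γ) fun p => g p.1 p.2)
    (hR : PB c R) (hRl : ∀ γ, c.ok γ → ∀ x ∈ l γ, (enc x).size ≤ R γ)
    (hlen : ∀ γ, c.ok γ → (l γ).length ≤ c.w γ) :
    Cmp c fun γ => (l γ).any (g γ) := by
  refine Cmp.congr (f := fun γ => (l γ).foldl (fun acc x => acc || g γ x) false)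
    (Cmp.foldl_big (step := fun γ acc x => acc || g γ x) (fun _ _ => True) (fun _ => 3) R hl
      (Cmp.const _).tm ?_ (fun _ _ => trivial) (fun _ _ _ _ _ _ => trivial) (PB.const c 3) ?_
      hR hRl hlen) fun γ _ => ?_
  · have hg' := hg.comp (c := c.light.ext fun γ (q : Bool × α) => True ∧ q.2 ∈ l γ)
      (f := fun p => (p.1, p.2.2)) (Tm.id.fst.pair Tm.id.snd.snd)
      (fun _ h => ⟨h.1, h.2.2⟩) (fun _ _ => le_rfl)
      ((PB.mu _).mono fun p _ => Nat.add_le_add_left (size_snd p.2) (c.μ p.1))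
    refine (Tm.ite (b := fun p => p.2.1) (f := fun _ => true) (g := fun p => g p.1 p.2.2)
      Tm.id.snd.fst (Cmp.const _).tm hg'.tm.restrict).congr fun p _ => ?_
    cases p.2.1 <;> simp
  · intro γ acc _ _
    cases acc <;> simp [Val.size]
  · have : ∀ (m : List α) b, m.foldl (fun acc x => acc || g γ x) b = (b || m.any (g γ)) := by
      intro m
      induction m with
      | nil => simp
      | cons x m ih => intro b; simp [ih, Bool.or_assoc]
    simp [this]

lemma Cmp.filter {l : Γ → List α} {g : Γ → α → Bool} (hl : Cmp c l)
    (hg : Cmp (c.ext fun γ x => x ∈ l γ) fun p => g p.1 p.2) :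
    Cmp c fun γ => (l γ).filter (g γ) :=
  (Cmp.flatMap (g := fun γ x => if g γ x = true then [x] else []) hl
    (Cmp.ite hg.tm ((Cmp.var.cons (Cmp.const [])).restrict) (Cmp.const []))).congr fun γ _ => by
      induction l γ with
      | nil => rfl
      | cons x l ih => by_cases h : g γ x <;> simp [h, ih]

/-! ### Numbers -/

/-- Numbers as lists. -/
lemma Tm.unary {k : Γ → ℕ} (hk : Tm c k) : Tm c fun γ => List.replicate (k γ) Val.nil :=
  hk.recode fun γ _ => by
    induction k γ with
    | zero => rfl
    | succ k ih => rw [List.replicate_succ, enc_cons, enc_succ, ih, enc_val]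

lemma Cmp.unary {k : Γ → ℕ} (hk : Cmp c k) : Cmp c fun γ => List.replicate (k γ) Val.nil :=
  ⟨hk.tm.unary, hk.sz.mono fun γ _ => by
    rw [size_enc_nat, size_enc_list]; simp [Val.size]; omega⟩

lemma foldl_replicate {α β : Type*} (a : α) (f : β → β) (k : ℕ) (b : β) :
    (List.replicate k a).foldl (fun acc _ => f acc) b = f^[k] b := by
  induction k generalizing b with
  | zero => rfl
  | succ k ih => rw [List.replicate_succ, List.foldl_cons, ih, Function.iterate_succ_apply]

lemma Cmp.iterate {k : Γ → ℕ} {ini : Γ → β} {step : Γ → β → β}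
    (S : Γ → ℕ) (hk : Cmp c k) (hi : Tm c ini)
    (hs : Tm (c.ext fun γ b => ∃ j < k γ, (step γ)^[j] (ini γ) = b) fun p => step p.1 p.2)
    (hS : PB c S)
    (hIS : ∀ γ j, c.ok γ → j ≤ k γ → (enc ((step γ)^[j] (ini γ))).size ≤ S γ) :
    Cmp c fun γ => (step γ)^[k γ] (ini γ) := by
  refine (Cmp.foldl_prefix (step := fun γ (acc : β) (_ : Val) => step γ acc) S hk.unary hi
    (hs.comp (f := fun p : Γ × (β × Val) => (p.1, p.2.1)) (Tm.id.fst.pair Tm.id.snd.fst)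
      ?_ (fun _ _ => le_rfl)
      ((PB.mu _).mono fun p _ => Nat.add_le_add_left (size_fst p.2) (c.μ p.1))) hS
    ?_).congr fun _ _ => foldl_replicate _ _ _ _
  · rintro ⟨γ, b, x⟩ ⟨hγ, m, m', hm, ha⟩
    refine ⟨hγ, m.length, ?_, ?_⟩
    · have := congrArg List.length hm
      simp only [List.length_append, List.length_cons, List.length_replicate] at this
      change m.length < k γ
      omega
    · obtain ⟨-, h2, -⟩ := List.append_eq_replicate_iff.1 hm
      rw [h2] at ha
      simpa [foldl_replicate Val.nil (step γ)] using ha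
  · rintro γ m hγ ⟨m', hm⟩
    obtain ⟨h1, h2, -⟩ := List.append_eq_replicate_iff.1 hm
    rw [h2, foldl_replicate Val.nil (step γ)]
    exact hIS γ _ hγ (by omega)

/-- The successor is applied `b` times to `a`, so only `b` has to be small. This allows `a` to be
the threshold of a Hanf formula. -/
lemma Tm.add {a b : Γ → ℕ} (ha : Tm c a) (hb : Cmp c b) : Tm c fun γ => a γ + b γ :=
  (Tm.foldl (step := fun _ (acc : ℕ) (_ : Val) => acc + 1) hb.unary ha
    (Tm.id.snd.fst.succ)).congr fun γ _ => by
      rw [foldl_replicate _ (fun x => x + 1)]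
      generalize b γ = n
      induction n with
      | zero => rfl
      | succ n ih => rw [Function.iterate_succ_apply', ih]; rfl

lemma PB.size_nat {a : Γ → ℕ} (h : PB c a) : PB c fun γ => (enc (a γ)).size :=
  (((PB.const c 2).mul h).add (PB.const c 1)).mono fun _ _ => (size_enc_nat _).le

lemma PB.of_size {a : Γ → ℕ} (h : PB c fun γ => (enc (a γ)).size) : PB c a :=
  h.mono fun _ _ => by rw [size_enc_nat]; omega

lemma Cmp.pb {a : Γ → ℕ} (h : Cmp c a) : PB c a := h.sz.of_size

lemma Cmp.pb_length {l : Γ → List α} (h : Cmp c l) : PB c fun γ => (l γ).length :=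
  h.sz.mono fun _ _ => length_le_size _

lemma Cmp.add {a b : Γ → ℕ} (ha : Cmp c a) (hb : Cmp c b) : Cmp c fun γ => a γ + b γ :=
  ⟨ha.tm.add hb, (ha.pb.add hb.pb).size_nat⟩

lemma Cmp.mul {a b : Γ → ℕ} (ha : Cmp c a) (hb : Cmp c b) : Cmp c fun γ => a γ * b γ := by
  refine ⟨(Tm.foldl (step := fun γ (acc : ℕ) (_ : Val) => acc + a γ) hb.unary (Cmp.const 0).tm
    (Tm.id.snd.fst.add ha.to_step)).congr fun γ _ => ?_, (ha.pb.mul hb.pb).size_nat⟩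
  rw [foldl_replicate _ (fun x => x + a γ)]
  generalize b γ = n
  induction n with
  | zero => rfl
  | succ n ih => rw [Function.iterate_succ_apply', ih, Nat.mul_succ]

lemma Cmp.sub {a b : Γ → ℕ} (ha : Cmp c a) (hb : Cmp c b) : Cmp c fun γ => a γ - b γ := by
  have h : ∀ m n : ℕ, (fun x => x - 1)^[n] m = m - n := by
    intro m n
    induction n with
    | zero => rfl
    | succ n ih => rw [Function.iterate_succ_apply', ih, Nat.sub_succ]; rfl
  refine (Cmp.iterate (step := fun _ x => x - 1)
    (fun γ => (enc (a γ)).size) hb ha.tm Cmp.var.pred.tm ha.sz ?_).congr fun γ _ => h _ _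
  intro γ j _ _
  rw [size_enc_nat, size_enc_nat, h]
  omega

lemma Cmp.le {a b : Γ → ℕ} (ha : Cmp c a) (hb : Cmp c b) : Cmp c fun γ => decide (a γ ≤ b γ) :=
  (Cmp.null (ha.sub hb).tm).congr fun γ _ => by simp [Nat.sub_eq_zero_iff_le]

lemma Cmp.length {l : Γ → List α} (hl : Cmp c l) : Cmp c fun γ => (l γ).length :=
  ⟨(hl.map (g := fun _ _ => Val.nil) (Cmp.const _)).tm.recode fun γ _ => by
    induction l γ with
    | nil => rfl
    | cons x l ih => rw [List.map_cons, enc_cons, ih]; rfl, hl.pb_length.size_nat⟩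

/-- The loop runs through the large number `a`, at a cost linear in the weight, with an accumulator
that stops at `b`. In this way unary numbers from the input formula become data of size polynomial
in the measure. -/
lemma Cmp.min_big {a b : Γ → ℕ} (ha : Tm c a) (hb : Cmp c.light b) (hw : ∀ γ, c.ok γ → a γ ≤ c.w γ) :
    Cmp c fun γ => min (a γ) (b γ) := by
  have hS : PB c fun γ => (enc (b γ)).size := hb.sz
  refine (Cmp.foldl_big (l := fun γ => List.replicate (a γ) Val.nil) (ini := fun _ => 0)
    (step := fun γ x _ => if decide (b γ ≤ x) = true then x else x + 1)
    (fun γ x => x ≤ b γ) (fun γ => (enc (b γ)).size) (fun _ => 1) ha.unary (Cmp.const 0).tm ?_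
    (fun _ _ => Nat.zero_le _) ?_ hS ?_ (PB.const c 1) ?_ ?_).congr fun γ _ => ?_
  · exact Tm.ite (hb.weaken.le Cmp.var.fst).tm Cmp.var.fst.tm.restrict Cmp.var.fst.succ.tm.restrict
  · intro γ x _ _ h _
    by_cases hx : b γ ≤ x <;> simp [hx] <;> omega
  · intro γ x _ h
    rw [size_enc_nat, size_enc_nat]
    omega
  · intro γ _ x hx
    rw [List.eq_of_mem_replicate hx]
    exact le_rfl
  · intro γ hγ
    simpa using hw γ hγ
  · rw [foldl_replicate _ (fun x => if decide (b γ ≤ x) = true then x else x + 1)]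
    generalize a γ = n
    induction n with
    | zero => simp
    | succ n ih =>
      rw [Function.iterate_succ_apply', ih]
      by_cases hx : b γ ≤ min n (b γ) <;> simp only [hx, decide_true, decide_false] <;>
        simp at hx ⊢ <;> omega

/-! ### Equality test -/

/-- The loop body of the equality test. The state is a failure flag and a list of pairs that
remain to be compared. -/
def eqBody : Prog :=
  .ite (.seq .tl (.seq .hd .hd))
    (.ite (.seq .tl (.seq .hd .tl))
      (.cons .hd (.cons (.cons (.seq .tl (.seq .hd (.seq .hd .hd))) (.seq .tl (.seq .hd (.seq .tl .hd))))
        (.cons (.cons (.seq .tl (.seq .hd (.seq .hd .tl))) (.seq .tl (.seq .hd (.seq .tl .tl))))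
          (.seq .tl .tl))))
      (.cons (.cons .nil .nil) .nil))
    (.ite (.seq .tl (.seq .hd .tl)) (.cons (.cons .nil .nil) .nil)
      (.cons .hd (.seq .tl .tl)))

lemma eqBody_node (a a' b b' rest : Val) : ∃ t ≤ 60, eqBody.Eval
    (.node .nil (.node (.node (.node a a') (.node b b')) rest))
    (.node .nil (.node (.node a b) (.node (.node a' b') rest))) t :=
  ⟨_, by decide, .ite_true (.seq (.tl_node _ _) (.seq (.hd_node _ _) (.hd_node _ _)))
    (.ite_true (.seq (.tl_node _ _) (.seq (.hd_node _ _) (.tl_node _ _)))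
      (.cons (.hd_node _ _) (.cons
        (.cons (.seq (.tl_node _ _) (.seq (.hd_node _ _) (.seq (.hd_node _ _) (.hd_node _ _))))
          (.seq (.tl_node _ _) (.seq (.hd_node _ _) (.seq (.tl_node _ _) (.hd_node _ _)))))
        (.cons
          (.cons (.seq (.tl_node _ _) (.seq (.hd_node _ _) (.seq (.hd_node _ _) (.tl_node _ _))))
            (.seq (.tl_node _ _) (.seq (.hd_node _ _) (.seq (.tl_node _ _) (.tl_node _ _)))))
          (.seq (.tl_node _ _) (.tl_node _ _))))))⟩

lemma eqBody_nil (rest : Val) : ∃ t ≤ 60, eqBody.Eval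
    (.node .nil (.node (.node .nil .nil) rest)) (.node .nil rest) t :=
  ⟨_, by decide, .ite_false (.seq (.tl_node _ _) (.seq (.hd_node _ _) (.hd_node _ _)))
    (.ite_false (.seq (.tl_node _ _) (.seq (.hd_node _ _) (.tl_node _ _)))
      (.cons (.hd_node _ _) (.seq (.tl_node _ _) (.tl_node _ _))))⟩

lemma eqBody_left (a a' rest : Val) : ∃ t ≤ 60, eqBody.Eval
    (.node .nil (.node (.node (.node a a') .nil) rest)) (.node (.node .nil .nil) .nil) t :=
  ⟨_, by decide, .ite_true (.seq (.tl_node _ _) (.seq (.hd_node _ _) (.hd_node _ _)))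
    (.ite_false (.seq (.tl_node _ _) (.seq (.hd_node _ _) (.tl_node _ _)))
      (.cons (.cons (.nil _) (.nil _)) (.nil _)))⟩

lemma eqBody_right (b b' rest : Val) : ∃ t ≤ 60, eqBody.Eval
    (.node .nil (.node (.node .nil (.node b b')) rest)) (.node (.node .nil .nil) .nil) t :=
  ⟨_, by decide, .ite_false (.seq (.tl_node _ _) (.seq (.hd_node _ _) (.hd_node _ _)))
    (.ite_true (.seq (.tl_node _ _) (.seq (.hd_node _ _) (.tl_node _ _)))
      (.cons (.cons (.nil _) (.nil _)) (.nil _)))⟩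

/-- In continuation form: if the first pair agrees, any run on the remaining pairs extends to a run
with this pair in front. The induction can then push the pairs of subtrees one after the other.
After a mismatch the list is emptied, which ends the loop. The time is charged to the left tree
alone, so `Cmp.eq` needs no size bound for its right argument. -/
lemma loop_eq (a : Val) : ∀ b rest,
    (a = b → ∀ y t, (Prog.loop .tl eqBody).Eval (.node .nil rest) y t → ∃ t' ≤ t + 100 * a.size,
      (Prog.loop .tl eqBody).Eval (.node .nil (.node (.node a b) rest)) y t') ∧
    (a ≠ b → ∃ t' ≤ 100 * a.size, (Prog.loop .tl eqBody).Eval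
      (.node .nil (.node (.node a b) rest)) (.node (.node .nil .nil) .nil) t') := by
  have hfail : (Prog.loop .tl eqBody).Eval (.node (.node .nil .nil) .nil)
      (.node (.node .nil .nil) .nil) 2 := .loop_exit (.tl_node _ _)
  induction a with
  | nil =>
    intro b rest
    constructor
    · rintro rfl y t h
      obtain ⟨s, hs, e⟩ := eqBody_nil rest
      exact ⟨_, by simp only [Val.size]; omega, .loop_step (.tl_node _ _) e h⟩
    · intro hne
      cases b with
      | nil => exact absurd rfl hne
      | node b b' =>
        obtain ⟨s, hs, e⟩ := eqBody_right b b' rest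
        exact ⟨_, by simp only [Val.size]; omega, .loop_step (.tl_node _ _) e hfail⟩
  | node a a' ih ih' =>
    intro b rest
    constructor
    · rintro rfl y t h
      obtain ⟨s, hs, e⟩ := eqBody_node a a' a a' rest
      obtain ⟨t', ht', h'⟩ := (ih' a' rest).1 rfl y t h
      obtain ⟨t'', ht'', h''⟩ := (ih a (.node (.node a' a') rest)).1 rfl _ _ h'
      exact ⟨_, by simp only [Val.size]; omega, .loop_step (.tl_node _ _) e h''⟩
    · intro hne
      cases b with
      | nil =>
        obtain ⟨s, hs, e⟩ := eqBody_left a a' rest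
        exact ⟨_, by simp only [Val.size]; omega, .loop_step (.tl_node _ _) e hfail⟩
      | node b b' =>
        obtain ⟨s, hs, e⟩ := eqBody_node a a' b b' rest
        by_cases hab : a = b
        · have hab' : a' ≠ b' := fun h => hne (by rw [hab, h])
          obtain ⟨t', ht', h'⟩ := (ih' b' rest).2 hab'
          obtain ⟨t'', ht'', h''⟩ := (ih b (.node (.node a' b') rest)).1 hab _ _ h'
          exact ⟨_, by simp only [Val.size]; omega, .loop_step (.tl_node _ _) e h''⟩
        · obtain ⟨t'', ht'', h''⟩ := (ih b (.node (.node a' b') rest)).2 hab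
          exact ⟨_, by simp only [Val.size]; omega, .loop_step (.tl_node _ _) e h''⟩

lemma PB.size_bool {b : Γ → Bool} : PB c fun γ => (enc (b γ)).size :=
  (PB.const c 3).mono fun γ _ => by cases b γ <;> simp [Val.size]

lemma Cmp.eq [EncInj α] {f g : Γ → α} [∀ γ, Decidable (f γ = g γ)] (hf : Cmp c f) (hg : Tm c g) :
    Cmp c fun γ => decide (f γ = g γ) := by
  refine ⟨?_, PB.size_bool⟩
  obtain ⟨k, hk⟩ := hf.sz
  obtain ⟨p, T, hT, hp⟩ := hf.tm.pair hg
  refine ⟨.seq p (.seq (.cons .nil (.cons .id .nil)) (.seq (.loop .tl eqBody)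
    (.ite .hd .nil (.cons .nil .nil)))), fun γ => T γ + (100 * (c.μ γ + 2) ^ k + 50),
    hT.add (((PB.const c 100).mul ⟨k, fun _ _ => le_rfl⟩).add (PB.const c 50)), fun γ hγ => ?_⟩
  obtain ⟨t, ht, e⟩ := hp γ hγ
  have hk' : 100 * (enc (f γ)).size ≤ _ := Nat.mul_le_mul_left 100 (hk γ hγ)
  have hb : ∀ r, r ≤ 100 * (c.μ γ + 2) ^ k + 50 →
      t + r ≤ (c.w γ + 1) * (T γ + (100 * (c.μ γ + 2) ^ k + 50)) := fun r hr => by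
    rw [Nat.mul_add]
    exact Nat.add_le_add ht (PB.const_le hr)
  by_cases h : f γ = g γ
  · obtain ⟨t', ht', e'⟩ := (loop_eq (enc (f γ)) (enc (g γ)) .nil).1 (by rw [h]) _ _
      (.loop_exit (.tl_node _ _))
    simp only [h, decide_true]
    simp only [h] at e e' ht'
    refine ⟨_, ?_, .seq e (.seq (.cons (.nil _) (.cons (.id _) (.nil _))) (.seq e'
      (.ite_false (.hd_node _ _) (.cons (.nil _) (.nil _)))))⟩
    simp only [h] at hk'
    have := hb (t' + 13) (by omega)
    omega
  · obtain ⟨t', ht', e'⟩ := (loop_eq (enc (f γ)) (enc (g γ)) .nil).2 fun h' => h (EncInj.inj h')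
    simp only [h, decide_false]
    refine ⟨_, ?_, .seq e (.seq (.cons (.nil _) (.cons (.id _) (.nil _))) (.seq e'
      (.ite_true (.hd_node _ _) (.nil _))))⟩
    have := hb (t' + 12) (by omega)
    omega

lemma Cmp.mem [EncInj α] {l : Γ → List α} {a : Γ → α} [∀ γ, Decidable (a γ ∈ l γ)]
    (hl : Cmp c l) (ha : Cmp c a) : Cmp c fun γ => decide (a γ ∈ l γ) := by
  classical
  exact (Cmp.any (g := fun γ x => decide (a γ = x)) hl (ha.weaken.eq Cmp.var.tm)).congr fun γ _ => by
    rw [Bool.eq_iff_iff]; simp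

lemma Cmp.subset [EncInj α] {l m : Γ → List α} [∀ γ x, Decidable (x ∈ m γ)] (hl : Cmp c l)
    (hm : Cmp c m) :
    Cmp c fun γ => (l γ).all fun x => decide (x ∈ m γ) :=
  Cmp.all (g := fun γ x => decide (x ∈ m γ)) hl (hm.weaken.mem Cmp.var)

lemma Cmp.range {k : Γ → ℕ} (hk : Cmp c k) : Cmp c fun γ => List.range (k γ) := by
  have h : Tm c fun γ => (List.range (k γ)).reverse := by
    refine (Tm.foldl (step := fun _ (p : ℕ × List ℕ) (_ : Val) => (p.1 + 1, p.1 :: p.2)) hk.unary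
      (Cmp.const (0, [])).tm (Tm.id.snd.fst.fst.succ.pair
        (Tm.id.snd.fst.fst.cons Tm.id.snd.fst.snd))).snd.congr fun γ _ => ?_
    rw [foldl_replicate _ (fun p : ℕ × List ℕ => (p.1 + 1, p.1 :: p.2))]
    have : ∀ n, (fun p : ℕ × List ℕ => (p.1 + 1, p.1 :: p.2))^[n] (0, []) =
        (n, (List.range n).reverse) := by
      intro n
      induction n with
      | zero => rfl
      | succ n ih => rw [Function.iterate_succ_apply', ih, List.range_succ]; simp
    rw [this]
  have hs : PB c fun γ => (enc (List.range (k γ))).size :=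
    ((hk.pb.mul (((PB.const c 2).mul hk.pb).add (PB.const c 2))).add (PB.const c 1)).mono
      fun γ _ => by
        refine (size_enc_list_le _ (2 * k γ + 1) fun x hx => ?_).trans (by simp)
        rw [size_enc_nat]
        have := List.mem_range.1 hx
        omega
  exact (Cmp.reverse ⟨h, hs.mono fun _ _ => (size_reverse _).le⟩).congr fun γ _ => by simp

lemma Cmp.drop {l : Γ → List α} {k : Γ → ℕ} (hl : Cmp c l) (hk : Cmp c k) :
    Cmp c fun γ => (l γ).drop (k γ) := by
  have h : ∀ (m : List α) n, List.tail^[n] m = m.drop n := by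
    intro m n
    induction n with
    | zero => rfl
    | succ n ih => rw [Function.iterate_succ_apply', ih, List.tail_drop]
  refine (Cmp.iterate (step := fun _ m => m.tail) (fun γ => (enc (l γ)).size) hk hl.tm
    Cmp.var.tail.tm hl.sz fun γ j _ _ => ?_).congr fun γ _ => h _ _
  induction j with
  | zero => exact le_rfl
  | succ j ih =>
    rw [Function.iterate_succ_apply']
    exact (size_tail _).trans (ih (by omega))

lemma Cmp.getD {l : Γ → List ℕ} {k : Γ → ℕ} (hl : Cmp c l) (hk : Cmp c k) :
    Cmp c fun γ => (l γ).getD (k γ) 0 :=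
  (hl.drop hk).headD.congr fun γ _ => by
    rw [List.getD_eq_getElem?_getD, List.headD_eq_head?_getD, List.head?_drop]

lemma Cmp.dropLast {l : Γ → List α} (hl : Cmp c l) : Cmp c fun γ => (l γ).dropLast :=
  hl.reverse.tail.reverse.congr fun γ _ => by rw [List.tail_reverse, List.reverse_reverse]

lemma Cmp.getLastD {l : Γ → List ℕ} (hl : Cmp c l) : Cmp c fun γ => (l γ).getLastD 0 :=
  hl.reverse.headD.congr fun γ _ => by
    rw [List.headD_eq_head?_getD, List.head?_reverse, List.getLastD_eq_getLast?]

end Fold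

/-! ### Functions on written structures -/

/-- A written fact: the number of a relation symbol, and a tuple. -/
abbrev RawFact := ℕ × List ℕ

/-- A written structure with centres: size, centres, facts. -/
abbrev Raw := ℕ × List ℕ × List RawFact

/-- All lists of length `k` over `{0, …, s - 1}`. -/
def tuples (s k : ℕ) : List (List ℕ) :=
  (fun T => T.flatMap fun t => (List.range s).map fun i => i :: t)^[k] [([] : List _)]

/-- All sublists, in reverse order. -/
def sublistsRev {α : Type*} (l : List α) : List (List α) :=
  l.foldl (fun acc x => acc ++ acc.map fun m => x :: m) [([] : List _)]

/-- All facts over `{0, …, s - 1}`; the relation symbols are given by number and arity. -/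
def allFacts : List (ℕ × ℕ) → ℕ → List RawFact
  | [], _ => []
  | r :: ar, s => ((tuples s r.2).map fun t => (r.1, t)) ++ allFacts ar s

/-- One step of the breadth first search. -/
def ballStep (s : ℕ) (F : List RawFact) (cs B : List ℕ) : List ℕ :=
  (List.range s).filter fun x => (decide (x ∈ cs) || decide (x ∈ B)) ||
    B.any fun y => F.any fun f => decide (x ∈ f.2) && decide (y ∈ f.2)

/-- The ball of radius `e` around `cs` in the structure of size `s` with facts `F`. -/
def ballList (e s : ℕ) (F : List RawFact) (cs : List ℕ) : List ℕ :=
  (ballStep s F cs)^[e] []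

/-- Whether the map `h` is an isomorphism between the structures induced on `b` and `b'`. -/
def isoMap (b : List ℕ) (F : List RawFact) (cs b' : List ℕ) (F' : List RawFact) (cs' h : List ℕ) :
    Bool :=
  (decide (cs.map (fun j => h.getD j 0) = cs') && decide (b.length = b'.length)) &&
  (((b.map fun j => h.getD j 0).all (fun x => decide (x ∈ b')) &&
    b'.all fun x => decide (x ∈ b.map fun j => h.getD j 0)) &&
  ((F.map fun f => (f.1, f.2.map fun j => h.getD j 0)).all (fun x => decide (x ∈ F')) &&
    F'.all fun x => decide (x ∈ F.map fun f => (f.1, f.2.map fun j => h.getD j 0))))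

/-- The facts inside `b`. -/
def inducedFacts (b : List ℕ) (F : List RawFact) : List RawFact :=
  F.filter fun f => f.2.all fun x => decide (x ∈ b)

/-- Whether the spheres of radius `e` around `S.2.1` in `S` and around `T.2.1` in `T` are
isomorphic. -/
def isoCheck (e : ℕ) (S T : Raw) : Bool :=
  (tuples T.1 S.1).any fun h =>
    isoMap (ballList e S.1 S.2.2 S.2.1) (inducedFacts (ballList e S.1 S.2.2 S.2.1) S.2.2) S.2.1
      (ballList e T.1 T.2.2 T.2.1) (inducedFacts (ballList e T.1 T.2.2 T.2.1) T.2.2) T.2.1 h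

/-- All written structures with `k` centres and of size at most `N`. -/
def raws (ar : List (ℕ × ℕ)) (k N : ℕ) : List Raw :=
  (List.range N).flatMap fun s => (tuples (s + 1) k).flatMap fun cs =>
    (sublistsRev (allFacts ar (s + 1))).map fun F => (s + 1, cs, F)

/-- Whether the ball of radius `e` around the centres is everything. -/
def coversAll (e : ℕ) (S : Raw) : Bool :=
  (List.range S.1).all fun x => decide (x ∈ ballList e S.1 S.2.2 S.2.1)

/-- The last element of a list that has a property. -/
def findD {α : Type*} (P : α → Bool) (d : α) (l : List α) : α :=
  l.foldl (fun acc x => if P x = true then x else acc) d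

lemma findD_mem {α : Type*} (P : α → Bool) (d : α) (l : List α) : findD P d l = d ∨ findD P d l ∈ l :=
  foldl_invariant l _ (fun x => x = d ∨ x ∈ l) (.inl rfl) fun acc ha x hx => by
    by_cases h : P x = true
    · simp [h, hx]
    · simpa [h] using ha

lemma findD_spec {α : Type*} (P : α → Bool) (d : α) (l : List α) (h : ∃ x ∈ l, P x = true) :
    findD P d l ∈ l ∧ P (findD P d l) = true := by
  induction l using List.reverseRecOn with
  | nil => simp at h
  | append_singleton l x ih =>
    have e : findD P d (l ++ [x]) = if P x = true then x else findD P d l := by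
      rw [findD, List.foldl_append]; rfl
    rw [e]
    by_cases hx : P x = true
    · simp [hx]
    · obtain ⟨y, hy, hP⟩ := h
      rcases List.mem_append.1 hy with hy | hy
      · obtain ⟨h1, h2⟩ := ih ⟨y, hy, hP⟩
        simp [hx, h1, h2]
      · rw [List.mem_singleton.1 hy] at hP
        exact absurd hP hx

/-! ### Their computation -/

section Computation
variable {Γ : Type*} {α : Type*} {β : Type*} {δ : Type*}
variable [Enc Γ] [Enc α] [Enc β] [Enc δ] {c : Ctx Γ}

lemma mem_tuples {s k : ℕ} {l : List ℕ} : l ∈ tuples s k ↔ l.length = k ∧ ∀ x ∈ l, x < s := by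
  induction k generalizing l with
  | zero => cases l <;> simp [tuples]
  | succ k ih =>
    rw [tuples, Function.iterate_succ_apply', ← tuples, List.mem_flatMap]
    simp only [List.mem_map, List.mem_range, ih]
    constructor
    · rintro ⟨t, ⟨h1, h2⟩, i, hi, rfl⟩
      exact ⟨by simp [h1], by simpa using ⟨hi, h2⟩⟩
    · rintro ⟨h1, h2⟩
      cases l with
      | nil => simp at h1
      | cons i t =>
        exact ⟨t, ⟨by simpa using h1, fun x hx => h2 x (by simp [hx])⟩, i, h2 i (by simp), rfl⟩

lemma length_tuples (s k : ℕ) : (tuples s k).length = s ^ k := by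
  induction k with
  | zero => rfl
  | succ k ih =>
    rw [tuples, Function.iterate_succ_apply', ← tuples, List.length_flatMap]
    simp [ih, pow_succ]

lemma size_enc_list_nat {l : List ℕ} {s : ℕ} (h : ∀ x ∈ l, x < s) :
    (enc l).size ≤ l.length * (2 * s + 1) + 1 := by
  refine (size_enc_list_le l (2 * s) fun x hx => ?_)
  rw [size_enc_nat]
  have := h x hx
  omega

lemma size_tuples (s k : ℕ) :
    (enc (tuples s k)).size ≤ s ^ k * (k * (2 * s + 1) + 1 + 1) + 1 := by
  rw [← length_tuples]
  refine size_enc_list_le _ _ fun l hl => ?_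
  obtain ⟨h1, h2⟩ := mem_tuples.1 hl
  exact h1 ▸ size_enc_list_nat h2

lemma Cmp.tuples_step {s : Γ → ℕ} {T : Γ → List (List ℕ)} (hs : Cmp c s) (hT : Cmp c T) :
    Cmp c fun γ => (T γ).flatMap fun t => (List.range (s γ)).map fun i => i :: t :=
  Cmp.flatMap (g := fun γ t => (List.range (s γ)).map fun i => i :: t) hT
    (Cmp.map (g := fun p i => i :: p.2) hs.range.weaken (Cmp.var.cons Cmp.var.weaken))

lemma Cmp.tuples {s k : Γ → ℕ} (hs : Cmp c s) (hk : Cmp c k) (hb : PB c fun γ => s γ ^ k γ) :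
    Cmp c fun γ => tuples (s γ) (k γ) := by
  refine Cmp.iterate (ini := fun _ => [([] : List _)])
    (step := fun γ T => T.flatMap fun t => (List.range (s γ)).map fun i => i :: t)
    (fun γ => (s γ ^ k γ + 1) * (k γ * (2 * s γ + 1) + 1 + 1) + 1) hk (Cmp.const _).tm
    (Cmp.tuples_step hs.weaken Cmp.var).tm ?_ fun γ j _ hj => ?_
  · have h2 := ((PB.const c 2).mul hs.pb).add (PB.const c 1)
    exact ((hb.add (PB.const c 1)).mul (((hk.pb.mul h2).add (PB.const c 1)).add
      (PB.const c 1))).add (PB.const c 1)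
  · refine (size_tuples _ j).trans ?_
    -- The summand 1 is for `s = 0`, where `0 ^ 0 = 1` may exceed `0 ^ k`.
    have h1 : s γ ^ j ≤ s γ ^ k γ + 1 := by
      rcases Nat.eq_zero_or_pos (s γ) with h | h
      · rw [h]
        rcases Nat.eq_zero_or_pos j with h' | h'
        · simp [h']
        · simp [Nat.zero_pow h']
      · exact (Nat.pow_le_pow_right h hj).trans (Nat.le_succ _)
    gcongr

lemma Cmp.tuples_const {s : Γ → ℕ} (hs : Cmp c s) (k : ℕ) : Cmp c fun γ => HanfNF.tuples (s γ) k :=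
  hs.tuples (Cmp.const k) (hs.pb.pow k)

lemma Cmp.allFacts (ar : List (ℕ × ℕ)) {s : Γ → ℕ} (hs : Cmp c s) :
    Cmp c fun γ => allFacts ar (s γ) := by
  induction ar with
  | nil => exact Cmp.const _
  | cons r ar ih =>
    exact (Cmp.map (g := fun _ t => (r.1, t)) (hs.tuples_const r.2)
      ((Cmp.const r.1).pair Cmp.var)).append ih

lemma size_sublist {l m : List α} (h : l.Sublist m) : (enc l).size ≤ (enc m).size := by
  induction h with
  | slnil => exact le_rfl
  | cons x _ ih => rw [enc_cons]; simp only [Val.size]; omega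
  | cons_cons x _ ih => rw [enc_cons, enc_cons]; simp only [Val.size]; omega

lemma sublistsRev_append_singleton {α : Type*} (l : List α) (x : α) :
    sublistsRev (l ++ [x]) = sublistsRev l ++ (sublistsRev l).map fun m => x :: m := by
  simp [sublistsRev]

/-- Elements are put in front while the list is read from the left, so the sublists come out
backwards. -/
lemma mem_sublistsRev {α : Type*} {l m : List α} :
    m ∈ sublistsRev l ↔ m.reverse.Sublist l := by
  induction l using List.reverseRecOn generalizing m with
  | nil => simp [sublistsRev]
  | append_singleton l x ih =>
    rw [sublistsRev_append_singleton, List.mem_append, ih, List.mem_map]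
    rw [List.sublist_append_iff]
    constructor
    · rintro (h | ⟨m', hm', rfl⟩)
      · exact ⟨m.reverse, [], by simp, h, by simp⟩
      · exact ⟨m'.reverse, [x], by simp, ih.1 hm', by simp⟩
    · rintro ⟨l₁, l₂, h1, h2, h3⟩
      rcases List.sublist_singleton.1 h3 with rfl | rfl
      · left; rw [h1]; simpa using h2
      · right
        exact ⟨l₁.reverse, ih.2 (by simpa using h2), by
          rw [← List.reverse_inj]; simp [h1]⟩

lemma length_sublistsRev {α : Type*} (l : List α) : (sublistsRev l).length = 2 ^ l.length := by
  induction l using List.reverseRecOn with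
  | nil => rfl
  | append_singleton l x ih =>
    rw [sublistsRev_append_singleton]
    simp only [List.length_append, List.length_map, ih, List.length_cons, List.length_nil, pow_succ]
    ring

lemma size_sublistsRev (l : List α) :
    (enc (sublistsRev l)).size ≤ 2 ^ l.length * ((enc l).size + 1) + 1 := by
  rw [← length_sublistsRev]
  refine size_enc_list_le _ _ fun m hm => ?_
  rw [← size_reverse]
  exact size_sublist (mem_sublistsRev.1 hm)

lemma Cmp.sublistsRev {l : Γ → List α} (hl : Cmp c l) (hb : PB c fun γ => 2 ^ (l γ).length) :
    Cmp c fun γ => sublistsRev (l γ) := by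
  refine Cmp.foldl_prefix (ini := fun _ => [([] : List _)])
    (step := fun _ acc x => acc ++ acc.map fun m => x :: m)
    (fun γ => 2 ^ (l γ).length * ((enc (l γ)).size + 1) + 1) hl (Cmp.const _).tm ?_ ?_ ?_
  · exact (Cmp.append Cmp.var.fst (Cmp.map (g := fun (p : Γ × (List (List α) × α)) m => p.2.2 :: m)
      Cmp.var.fst (Cmp.var.snd.weaken.cons Cmp.var))).tm
  · exact (hb.mul (hl.sz.add (PB.const c 1))).add (PB.const c 1)
  · intro γ m _ hm
    refine (size_sublistsRev m).trans ?_
    have h1 := size_sublist hm.sublist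
    have h2 := Nat.pow_le_pow_right (n := 2) (by omega) hm.length_le
    gcongr

lemma Cmp.ballStep {s : Γ → ℕ} {F : Γ → List RawFact} {cs B : Γ → List ℕ}
    (hs : Cmp c s) (hF : Cmp c F) (hcs : Cmp c cs) (hB : Cmp c B) :
    Cmp c fun γ => ballStep (s γ) (F γ) (cs γ) (B γ) :=
  Cmp.filter (g := fun γ x => (decide (x ∈ cs γ) || decide (x ∈ B γ)) ||
      (B γ).any fun y => (F γ).any fun f => decide (x ∈ f.2) && decide (y ∈ f.2)) hs.range
    (((hcs.weaken.mem Cmp.var).or (hB.weaken.mem Cmp.var)).or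
      (Cmp.any (g := fun p y => (F p.1).any fun f => decide (p.2 ∈ f.2) && decide (y ∈ f.2))
        hB.weaken
        (Cmp.any (g := fun p f => decide (p.1.2 ∈ f.2) && decide (p.2 ∈ f.2)) hF.weaken.weaken
          ((Cmp.var.snd.mem Cmp.var.weaken.weaken).and (Cmp.var.snd.mem Cmp.var.weaken)))))

lemma size_ballList (e s : ℕ) (F : List RawFact) (cs : List ℕ) :
    (enc (ballList e s F cs)).size ≤ (enc (List.range s)).size := by
  cases e with
  | zero => exact Val.size_pos _
  | succ e =>
    rw [ballList, Function.iterate_succ_apply', HanfNF.ballStep]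
    exact size_sublist List.filter_sublist

lemma Cmp.ballList {e s : Γ → ℕ} {F : Γ → List RawFact} {cs : Γ → List ℕ}
    (he : Cmp c e) (hs : Cmp c s) (hF : Cmp c F) (hcs : Cmp c cs) :
    Cmp c fun γ => ballList (e γ) (s γ) (F γ) (cs γ) :=
  Cmp.iterate (ini := fun _ => []) (step := fun γ B => HanfNF.ballStep (s γ) (F γ) (cs γ) B)
    (fun γ => (enc (List.range (s γ))).size) he (Cmp.const _).tm
    (Cmp.ballStep hs.weaken hF.weaken hcs.weaken Cmp.var).tm hs.range.sz
    fun _ _ _ _ => size_ballList _ _ _ _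

lemma Cmp.rename {l h : Γ → List ℕ} (hl : Cmp c l) (hh : Cmp c h) :
    Cmp c fun γ => (l γ).map fun j => (h γ).getD j 0 :=
  Cmp.map (g := fun γ j => (h γ).getD j 0) hl (hh.weaken.getD Cmp.var)

lemma Cmp.isoMap {b cs b' cs' h : Γ → List ℕ} {F F' : Γ → List RawFact} (hb : Cmp c b)
    (hF : Cmp c F) (hcs : Cmp c cs) (hb' : Cmp c b') (hF' : Cmp c F') (hcs' : Cmp c cs')
    (hh : Cmp c h) :
    Cmp c fun γ => isoMap (b γ) (F γ) (cs γ) (b' γ) (F' γ) (cs' γ) (h γ) := by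
  have hm := hb.rename hh
  have hf : Cmp c fun γ => (F γ).map fun f => (f.1, f.2.map fun j => (h γ).getD j 0) :=
    Cmp.map (g := fun γ f => (f.1, f.2.map fun j => (h γ).getD j 0)) hF
      (Cmp.var.fst.pair (Cmp.var.snd.rename hh.weaken))
  exact (((hcs.rename hh).eq hcs'.tm).and (hb.length.eq hb'.length.tm)).and
    (((hm.subset hb').and (hb'.subset hm)).and ((hf.subset hF').and (hF'.subset hf)))

lemma Cmp.inducedFacts {b : Γ → List ℕ} {F : Γ → List RawFact} (hb : Cmp c b) (hF : Cmp c F) :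
    Cmp c fun γ => inducedFacts (b γ) (F γ) :=
  Cmp.filter (g := fun _ (f : RawFact) => f.2.all fun x => decide (x ∈ b _)) hF
    (Cmp.var.snd.subset hb.weaken)

/-- The search is by brute force over all maps from the universe of `S` to that of `T`; `hp` bounds
their number. -/
lemma Cmp.isoCheck {e : Γ → ℕ} {S T : Γ → Raw} (he : Cmp c e) (hS : Cmp c S) (hT : Cmp c T)
    (hp : PB c fun γ => (T γ).1 ^ (S γ).1) : Cmp c fun γ => isoCheck (e γ) (S γ) (T γ) := by
  have h1 := Cmp.ballList he hS.fst hS.snd.snd hS.snd.fst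
  have h2 := Cmp.ballList he hT.fst hT.snd.snd hT.snd.fst
  exact Cmp.any (g := fun γ h =>
      HanfNF.isoMap (HanfNF.ballList (e γ) (S γ).1 (S γ).2.2 (S γ).2.1)
      (HanfNF.inducedFacts (HanfNF.ballList (e γ) (S γ).1 (S γ).2.2 (S γ).2.1) (S γ).2.2) (S γ).2.1
      (HanfNF.ballList (e γ) (T γ).1 (T γ).2.2 (T γ).2.1)
      (HanfNF.inducedFacts (HanfNF.ballList (e γ) (T γ).1 (T γ).2.2 (T γ).2.1) (T γ).2.2)
      (T γ).2.1 h)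
    (Cmp.tuples hT.fst hS.fst hp)
    (Cmp.isoMap h1.weaken (h1.inducedFacts hS.snd.snd).weaken hS.snd.fst.weaken h2.weaken
      (h2.inducedFacts hT.snd.snd).weaken hT.snd.fst.weaken Cmp.var)

lemma length_allFacts_mono (ar : List (ℕ × ℕ)) {s t : ℕ} (h : s ≤ t) :
    (allFacts ar s).length ≤ (allFacts ar t).length := by
  induction ar with
  | nil => exact le_rfl
  | cons r ar ih =>
    simp only [HanfNF.allFacts, List.length_append, List.length_map, length_tuples]
    have := Nat.pow_le_pow_left h r.2
    omega

lemma Cmp.raws (ar : List (ℕ × ℕ)) {k N : Γ → ℕ} (hk : Cmp c k) (hN : Cmp c N)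
    (h1 : PB c fun γ => N γ ^ k γ) (h2 : PB c fun γ => 2 ^ (HanfNF.allFacts ar (N γ)).length) :
    Cmp c fun γ => raws ar (k γ) (N γ) := by
  refine Cmp.flatMap (g := fun γ s => (HanfNF.tuples (s + 1) (k γ)).flatMap fun cs =>
    (HanfNF.sublistsRev (HanfNF.allFacts ar (s + 1))).map fun F => (s + 1, cs, F)) hN.range ?_
  have hs : Cmp (c.ext fun γ s => s ∈ List.range (N γ)) fun p => p.2 + 1 := Cmp.var.succ
  have hlt : ∀ p, (c.ext fun γ s => s ∈ List.range (N γ)).ok p → p.2 + 1 ≤ N p.1 :=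
    fun p hp => List.mem_range.1 hp.2
  refine Cmp.flatMap (g := fun p cs =>
    (HanfNF.sublistsRev (HanfNF.allFacts ar (p.2 + 1))).map fun F => (p.2 + 1, cs, F))
    (Cmp.tuples hs hk.weaken (h1.weaken.mono fun p hp => Nat.pow_le_pow_left (hlt p hp) _)) ?_
  exact Cmp.map (g := fun (p : (Γ × ℕ) × List ℕ) F => (p.1.2 + 1, p.2, F))
    (l := fun p => HanfNF.sublistsRev (HanfNF.allFacts ar (p.1.2 + 1)))
    (Cmp.sublistsRev (Cmp.allFacts ar hs) (h2.weaken.mono fun p hp =>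
      Nat.pow_le_pow_right (by omega) (length_allFacts_mono ar (hlt p hp)))).weaken
    (hs.weaken.weaken.pair (Cmp.var.weaken.pair Cmp.var))

lemma Cmp.coversAll {e : Γ → ℕ} {S : Γ → Raw} (he : Cmp c e) (hS : Cmp c S) :
    Cmp c fun γ => coversAll (e γ) (S γ) :=
  hS.fst.range.subset (Cmp.ballList he hS.fst hS.snd.snd hS.snd.fst)

lemma Cmp.findD {P : Γ → α → Bool} {d : Γ → α} {l : Γ → List α} (hl : Cmp c l) (hd : Cmp c d)
    (hP : Cmp (c.ext fun γ x => x ∈ l γ) fun p => P p.1 p.2) :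
    Cmp c fun γ => findD (P γ) (d γ) (l γ) := by
  refine ⟨Tm.foldl (step := fun γ acc x => if P γ x = true then x else acc) hl hd.tm
    (Tm.ite (b := fun p : Γ × (α × α) => P p.1 p.2.2) (f := fun p => p.2.2) (g := fun p => p.2.1)
      hP.weaken_step.tm Tm.id.snd.snd Tm.id.snd.fst), (hl.sz.add hd.sz).mono fun γ _ => ?_⟩
  rcases findD_mem (P γ) (d γ) (l γ) with h | h
  · rw [h]; omega
  · have := size_enc_mem h
    omega

end Computation

/-! ### Balls and partial isomorphisms -/

section Balls
variable (L : FirstOrder.Language.{u, v}) {A : Type*} [L.Structure A]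

lemma gaifman_adj_dist {a b : A} (h : (gaifman L A).Adj a b) : dist L a b ≤ 1 := by
  have := SimpleGraph.Walk.edist_le (SimpleGraph.Walk.cons h .nil)
  simpa [dist] using this

lemma dist_triangle (a b c : A) : dist L a c ≤ dist L a b + dist L b c :=
  SimpleGraph.edist_triangle

lemma dist_comm (a b : A) : dist L a b = dist L b a := SimpleGraph.edist_comm

/-- The last edge of a shortest walk is split off. The clause `x = a` is needed for `d = 0`, since
no distance is below `0`. -/
lemma dist_lt_succ {a x : A} {d : ℕ} : dist L a x < (d + 1 : ℕ) ↔
    x = a ∨ dist L a x < d ∨ ∃ y, dist L a y < d ∧ (gaifman L A).Adj y x := by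
  have key : ∀ y : A, ∀ k : ℕ, dist L a y < (k + 1 : ℕ) ↔ dist L a y ≤ k := by
    intro y k
    rw [Nat.cast_add, Nat.cast_one]
    exact ENat.lt_add_one_iff (ENat.natCast_ne_top k)
  constructor
  · intro h
    obtain ⟨p, hp⟩ := SimpleGraph.exists_walk_of_edist_ne_top (h.trans_le le_top).ne
    by_cases hn : p.Nil
    · exact .inl hn.eq.symm
    · refine .inr (.inr ⟨p.penultimate, ?_, p.adj_penultimate hn⟩)
      have h1 : dist L a p.penultimate ≤ (p.dropLast.length : ℕ∞) :=
        SimpleGraph.Walk.edist_le _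
      have h2 : p.dropLast.length + 1 = p.length := by
        exact SimpleGraph.Walk.length_dropLast_add_one hn
      refine h1.trans_lt ?_
      have h3 : (p.length : ℕ∞) < (d + 1 : ℕ) := by rw [hp]; exact h
      have h4 := Nat.cast_lt.1 h3
      exact_mod_cast (by omega : p.dropLast.length < d)
  · rintro (rfl | h | ⟨y, h, hy⟩)
    · rw [key, dist, SimpleGraph.edist_self]; exact zero_le
    · exact h.trans (by exact_mod_cast Nat.lt_succ_self d)
    · rw [key]
      cases d with
      | zero => simp at h
      | succ d =>
        rw [key] at h
        exact (dist_triangle L a y x).trans (by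
          rw [Nat.cast_add, Nat.cast_one]
          exact add_le_add h (gaifman_adj_dist L hy))

variable {k : ℕ} (a : Fin k → A)

lemma ball_zero : ball L 0 a = ∅ := by
  ext x; simp [ball]

lemma mem_ball_succ {d : ℕ} {x : A} : x ∈ ball L (d + 1) a ↔
    x ∈ Set.range a ∨ x ∈ ball L d a ∨ ∃ y ∈ ball L d a, (gaifman L A).Adj y x := by
  simp only [ball, Set.mem_ofPred_eq, dist_lt_succ, Set.mem_range]
  constructor
  · rintro ⟨i, rfl | h | ⟨y, h, hy⟩⟩
    · exact .inl ⟨i, rfl⟩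
    · exact .inr (.inl ⟨i, h⟩)
    · exact .inr (.inr ⟨y, ⟨i, h⟩, hy⟩)
  · rintro (⟨i, rfl⟩ | ⟨i, h⟩ | ⟨y, ⟨i, h⟩, hy⟩)
    · exact ⟨i, .inl rfl⟩
    · exact ⟨i, .inr (.inl h)⟩
    · exact ⟨i, .inr (.inr ⟨y, h, hy⟩)⟩

variable {a} in
-- Elements of the smaller ball are themselves centres or neighbours of a still smaller ball, so the
-- middle alternative of `mem_ball_succ` can be dropped. The recursion for the sizes of balls relies
-- on this.
lemma range_or_adj_of_mem_ball_succ {d : ℕ} {x : A} (h : x ∈ ball L (d + 1) a) :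
    x ∈ Set.range a ∨ ∃ y ∈ ball L d a, (gaifman L A).Adj y x := by
  induction d with
  | zero => simpa [mem_ball_succ, ball_zero] using h
  | succ d ih =>
    rcases (mem_ball_succ L a).1 h with h | h | h
    · exact .inl h
    · exact (ih h).imp_right fun ⟨y, hy, h⟩ => ⟨y, (mem_ball_succ L a).2 (.inr (.inl hy)), h⟩
    · exact .inr h

lemma ball_mono {d e : ℕ} (h : d ≤ e) : ball L d a ⊆ ball L e a := by
  rintro x ⟨i, hi⟩
  exact ⟨i, hi.trans_le (by exact_mod_cast h)⟩

variable {a} in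
-- Balls are defined by a strict inequality: integer distances below `s` and below `r` add up to at
-- most `s + r - 2`. This gains the 1 on the right of `h`, and it lets centres count as elements of
-- the ball of radius `s = 1`.
lemma ball_subset_ball {l : ℕ} {b : Fin l → A} {r s R : ℕ} (hb : ∀ i, b i ∈ ball L s a)
    (h : s + r ≤ R + 1) : ball L r b ⊆ ball L R a := by
  rintro x ⟨i, hi⟩
  obtain ⟨j, hj⟩ := hb i
  refine ⟨j, ?_⟩
  have h1 := dist_triangle L (a j) (b i) x
  lift dist L (a j) (b i) to ℕ using (hj.trans_le le_top).ne with m hm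
  lift dist L (b i) x to ℕ using (hi.trans_le le_top).ne with n hn
  have hj := Nat.cast_lt.1 hj
  have hi := Nat.cast_lt.1 hi
  refine h1.trans_lt ?_
  exact_mod_cast (by omega : m + n < R)

variable {L a} in
lemma mem_ball_succ_of_fact {d l : ℕ} {R : L.Relations l} {t : Fin l → A}
    (hR : Language.Structure.RelMap R t) {i j : Fin l} (hi : t i ∈ ball L d a) :
    t j ∈ ball L (d + 1) a := by
  rw [mem_ball_succ]
  by_cases h : t i = t j
  · exact .inr (.inl (h ▸ hi))
  · exact .inr (.inr ⟨t i, hi, h, l, R, t, hR, ⟨i, rfl⟩, ⟨j, rfl⟩⟩)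

end Balls

/-! ### Partial isomorphisms and isomorphic spheres -/

section PIso
variable {L : FirstOrder.Language.{u, v}} {A B C : Type*} [L.Structure A] [L.Structure B]
  [L.Structure C]

variable (L) in
/-- `h` is an isomorphism from the structure induced on `X` to the structure induced on `Y`. -/
structure PIso (h : A → B) (X : Set A) (Y : Set B) : Prop where
  bij : Set.BijOn h X Y
  rel : ∀ ⦃l : ℕ⦄ (R : L.Relations l) (t : Fin l → A), (∀ i, t i ∈ X) →
    (Language.Structure.RelMap R t ↔ Language.Structure.RelMap R fun i => h (t i))

lemma PIso.mono {h : A → B} {X X' : Set A} {Y Y' : Set B} (H : PIso L h X Y) (hX : X' ⊆ X)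
    (hY : h '' X' = Y') : PIso L h X' Y' :=
  ⟨hY ▸ (H.bij.injOn.mono hX).bijOn_image, fun _ R t ht => H.rel R t fun i => hX (ht i)⟩

lemma PIso.trans {h : A → B} {g : B → C} {X : Set A} {Y : Set B} {Z : Set C} (H : PIso L h X Y)
    (G : PIso L g Y Z) : PIso L (fun x => g (h x)) X Z :=
  ⟨G.bij.comp H.bij, fun _ R t ht => (H.rel R t ht).trans
    (G.rel R _ fun i => H.bij.mapsTo (ht i))⟩

lemma PIso.symm [Nonempty A] {h : A → B} {X : Set A} {Y : Set B} (H : PIso L h X Y) :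
    PIso L (Function.invFunOn h X) Y X := by
  have hinv := H.bij.invOn_invFunOn
  refine ⟨hinv.symm.bijOn H.bij.surjOn.mapsTo_invFunOn H.bij.mapsTo, fun l R t ht => ?_⟩
  rw [H.rel R _ fun i => H.bij.surjOn.mapsTo_invFunOn (ht i)]
  have : (fun i => h (Function.invFunOn h X (t i))) = t := funext fun i => hinv.2 (ht i)
  rw [this]

/-- Distances are taken in the whole structures, not in the induced ones on `X` and `Y`. Still, the
fact that joins a layer of the ball to the next lies entirely in the next ball, hence in `X` or in
`Y`. So balls grow in the same way on both sides. -/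
lemma PIso.image_ball {h : A → B} {X : Set A} {Y : Set B} (H : PIso L h X Y) {k r : ℕ}
    {a : Fin k → A} (ha : ball L r a ⊆ X) (hb : ball L r (fun i => h (a i)) ⊆ Y) :
    h '' ball L r a = ball L r fun i => h (a i) := by
  have key : ∀ j ≤ r, h '' ball L j a = ball L j fun i => h (a i) := by
    intro j
    induction j with
    | zero => intro _; simp [ball_zero]
    | succ j ih =>
      intro hj
      have ih := ih (by omega)
      have hX := (ball_mono L a hj).trans ha
      have hY := (ball_mono L _ hj).trans hb
      apply Set.Subset.antisymm
      · rintro _ ⟨x, hx, rfl⟩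
        rcases (mem_ball_succ L a).1 hx with ⟨i, rfl⟩ | hx' | ⟨y, hy, hne, l, R, t, hR, ⟨p, rfl⟩, q, rfl⟩
        · exact (mem_ball_succ L _).2 (.inl ⟨i, rfl⟩)
        · exact ball_mono L _ (Nat.le_succ j) (ih ▸ Set.mem_image_of_mem h hx')
        · have hR' := (H.rel R t fun i => hX (mem_ball_succ_of_fact hR hy)).1 hR
          exact mem_ball_succ_of_fact hR' (i := p) (ih ▸ Set.mem_image_of_mem h hy)
      · intro z hz
        rcases (mem_ball_succ L _).1 hz with ⟨i, rfl⟩ | hz' | ⟨w, hw, hne, l, R, t, hR, ⟨p, rfl⟩, q, rfl⟩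
        · exact ⟨a i, (mem_ball_succ L a).2 (.inl ⟨i, rfl⟩), rfl⟩
        · rw [← ih] at hz'
          exact Set.image_mono (ball_mono L a (Nat.le_succ j)) hz'
        -- One entry in the ball of radius `j` forces all entries into the ball of radius `j + 1`,
        -- so the whole tuple can be pulled back along `h`.
        · have hY' : ∀ i, t i ∈ Y := fun i => hY (mem_ball_succ_of_fact hR hw)
          choose s hs hst using fun i => H.bij.surjOn (hY' i)
          have hR' : Language.Structure.RelMap R s := (H.rel R s hs).2 (by
            rw [show (fun i => h (s i)) = t from funext hst]; exact hR)
          rw [← ih] at hw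
          obtain ⟨y, hy, hyp⟩ := hw
          have : y = s p := H.bij.injOn (hX (ball_mono L a (Nat.le_succ j) hy)) (hs p)
            (by rw [hyp, hst])
          exact ⟨s q, mem_ball_succ_of_fact hR' (i := p) (this ▸ hy), hst q⟩
  exact key r le_rfl

variable (L) in
/-- `h` witnesses that the spheres of radius `r` around `a` and `b` are isomorphic. -/
def SphereMap {k : ℕ} (r : ℕ) (h : A → B) (a : Fin k → A) (b : Fin k → B) : Prop :=
  PIso L h (ball L r a) (ball L r b) ∧ ∀ i, h (a i) = b i

variable (L) in
/-- The spheres of radius `r` around `a` and `b` are isomorphic. -/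
def SphereIso {k : ℕ} (r : ℕ) (a : Fin k → A) (b : Fin k → B) : Prop :=
  ∃ h : A → B, SphereMap L r h a b

variable {k l r : ℕ} {a : Fin k → A} {b : Fin k → B} {c : Fin k → C}

lemma SphereIso.trans (H : SphereIso L r a b) (G : SphereIso L r b c) : SphereIso L r a c := by
  obtain ⟨h, H, H'⟩ := H
  obtain ⟨g, G, G'⟩ := G
  exact ⟨_, H.trans G, fun i => by rw [H', G']⟩

lemma SphereIso.symm [Nonempty A] (hr : 0 < r) (H : SphereIso L r a b) : SphereIso L r b a := by
  obtain ⟨h, H, H'⟩ := H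
  refine ⟨_, H.symm, fun i => ?_⟩
  rw [← H']
  exact H.bij.invOn_invFunOn.1 (mem_ball_center L hr a i)

/-- Under `hs` the `r`-balls around elements of the `s`-ball stay inside the `R`-balls, on both
sides, so `PIso.image_ball` applies to them. -/
lemma SphereMap.sub {R s : ℕ} {h : A → B} (H : SphereMap L R h a b) {a' : Fin l → A}
    (ha : ∀ i, a' i ∈ ball L s a) (hs : s + r ≤ R + 1) (hr : 0 < r) :
    SphereMap L r h a' (fun i => h (a' i)) := by
  have hb : b = fun i => h (a i) := funext fun i => (H.2 i).symm
  have e := H.1.image_ball (r := s) (a := a) (ball_mono L a (by omega))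
    (hb ▸ ball_mono L b (by omega))
  have h1 := ball_subset_ball L ha hs
  have h2 : ball L r (fun i => h (a' i)) ⊆ ball L R b := by
    refine ball_subset_ball L (s := s) (fun i => ?_) hs
    rw [hb, ← e]
    exact Set.mem_image_of_mem h (ha i)
  exact ⟨H.1.mono h1 (H.1.image_ball h1 h2), fun _ => rfl⟩

lemma SphereMap.sub_iso {R s : ℕ} {h : A → B} (H : SphereMap L R h a b) {a' : Fin l → A}
    {b' : Fin l → B} (ha : ∀ i, a' i ∈ ball L s a) (hb : ∀ i, h (a' i) = b' i)
    (hs : s + r ≤ R + 1) (hr : 0 < r) : SphereIso L r a' b' := by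
  rw [← show (fun i => h (a' i)) = b' from funext hb]
  exact ⟨h, H.sub ha hs hr⟩

/-- Restriction to some of the centres. -/
lemma SphereIso.reindex (hr : 0 < r) (H : SphereIso L r a b) (f : Fin l → Fin k) :
    SphereIso L r (fun i => a (f i)) (fun i => b (f i)) := by
  obtain ⟨h, H⟩ := H
  exact H.sub_iso (s := 1) (fun i => mem_ball_center L one_pos a _) (fun i => H.2 _) (by omega) hr

/-- An isomorphism between the induced substructure and `τ` becomes a total function that matters
only on the ball. Outside it takes the value `τ.center 0`, and by `τ.covers` its target set is
everything. -/
lemma realisedBy_iff [L.IsRelational] {τ : Sphere L (k + 1)} {a : Fin (k + 1) → A} :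
    τ.RealisedBy a ↔ SphereIso L τ.radius a τ.center := by
  classical
  constructor
  · rintro ⟨e, he⟩
    refine ⟨fun x => if hx : x ∈ ball L τ.radius a then e ⟨x, hx⟩ else τ.center 0,
      ⟨⟨?_, ?_, ?_⟩, ?_⟩, fun i => ?_⟩
    · intro x _
      rw [τ.covers]; trivial
    · intro x hx y hy hxy
      simp only [hx, hy, dif_pos] at hxy
      exact congrArg Subtype.val (e.injective hxy)
    · intro y _
      obtain ⟨⟨x, hx⟩, rfl⟩ := e.surjective y
      exact ⟨x, hx, dif_pos (show x ∈ ball L τ.radius a from hx)⟩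
    · intro l R t ht
      have h1 := e.map_rel R fun i => (⟨t i, ht i⟩ : sphereAround L τ.radius a)
      have h2 : (fun i => if hx : t i ∈ ball L τ.radius a then e ⟨t i, hx⟩ else τ.center 0) =
          fun i => e ⟨t i, ht i⟩ := funext fun i => dif_pos (ht i)
      rw [h2]
      exact h1.symm
    · exact (dif_pos (mem_ball_center L τ.radius_pos a i)).trans (he i)
  · rintro ⟨h, ⟨hb, hr⟩, hc⟩
    have hbij : Function.Bijective fun x : sphereAround L τ.radius a => h x.1 := by
      refine ⟨fun x y hxy => Subtype.ext (hb.injOn x.2 y.2 hxy), fun y => ?_⟩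
      obtain ⟨x, hx, rfl⟩ := hb.surjOn (τ.covers ▸ Set.mem_univ y)
      exact ⟨⟨x, hx⟩, rfl⟩
    refine ⟨⟨Equiv.ofBijective _ hbij, fun f => isEmptyElim f, fun {l} R t => ?_⟩, hc⟩
    exact (hr R (fun i => (t i).1) fun i => (t i).2).symm

end PIso

/-! ### Unions of far apart balls -/

section Far
variable {L : FirstOrder.Language.{u, v}} {A B C : Type*} [L.Structure A] [L.Structure B]
  [L.Structure C] {k e : ℕ}

variable (L) in
/-- In the structure induced on the union of the balls of radius `e` around `a` and `y`, these
balls are disjoint and not connected. -/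
def Far (e : ℕ) (a : Fin k → A) (y : A) : Prop :=
  Disjoint (ball L e a) (ball L e ![y]) ∧
    ∀ ⦃l : ℕ⦄ (R : L.Relations l) (t : Fin l → A), Language.Structure.RelMap R t →
      (∀ i, t i ∈ ball L e a ∪ ball L e ![y]) →
      (∀ i, t i ∈ ball L e a) ∨ ∀ i, t i ∈ ball L e ![y]

variable {a : Fin k → A} {b : Fin k → B} {y : A} {z : B}

lemma ball_snoc : ball L e (Fin.snoc a y : Fin (k + 1) → A) = ball L e a ∪ ball L e ![y] := by
  ext x
  constructor
  · rintro ⟨i, hi⟩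
    induction i using Fin.lastCases with
    | last => exact .inr ⟨0, by simpa using hi⟩
    | cast i => exact .inl ⟨i, by simpa using hi⟩
  · rintro (⟨i, hi⟩ | ⟨i, hi⟩)
    · exact ⟨i.castSucc, by simpa using hi⟩
    · exact ⟨Fin.last k, by simpa using hi⟩

lemma SphereIso.left (he : 0 < e)
    (H : SphereIso L e (Fin.snoc a y : Fin (k + 1) → A) (Fin.snoc b z : Fin (k + 1) → B)) :
    SphereIso L e a b := by
  simpa using H.reindex he (fun i : Fin k => i.castSucc)

lemma SphereIso.right (he : 0 < e)
    (H : SphereIso L e (Fin.snoc a y : Fin (k + 1) → A) (Fin.snoc b z : Fin (k + 1) → B)) :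
    SphereIso L e ![y] ![z] := by
  have := H.reindex he (fun _ : Fin 1 => Fin.last k)
  simp only [Fin.snoc_last] at this
  convert this using 1 <;> (ext i; simp)

/-- Isomorphisms of far apart balls can be glued. -/
lemma SphereIso.glue (H : SphereIso L e a b) (G : SphereIso L e ![y] ![z]) (he : 0 < e)
    (hy : Far L e a y) (hz : Far L e b z) :
    SphereIso L e (Fin.snoc a y : Fin (k + 1) → A) (Fin.snoc b z : Fin (k + 1) → B) := by
  classical
  obtain ⟨h, ⟨hb, hr⟩, hc⟩ := H
  obtain ⟨g, ⟨gb, gr⟩, gc⟩ := G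
  -- Disjointness makes the two halves compatible. Since no fact crosses, on either side, each fact
  -- is handled by one of the two given maps.
  let f : A → B := fun x => if x ∈ ball L e a then h x else g x
  have f1 : ∀ x ∈ ball L e a, f x = h x := fun x hx => if_pos hx
  have f2 : ∀ x ∈ ball L e ![y], f x = g x := fun x hx =>
    if_neg fun hx' => Set.disjoint_left.1 hy.1 hx' hx
  have hb' : Set.BijOn f (ball L e a) (ball L e b) := hb.congr fun x hx => (f1 x hx).symm
  have gb' : Set.BijOn f (ball L e ![y]) (ball L e ![z]) := gb.congr fun x hx => (f2 x hx).symm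
  refine ⟨f, ⟨?_, ?_⟩, ?_⟩
  · rw [ball_snoc, ball_snoc]
    refine hb'.union gb' ?_
    rintro x (hx | hx) x' (hx' | hx') hxx
    · exact hb'.injOn hx hx' hxx
    · exact absurd (hxx ▸ gb'.mapsTo hx') (Set.disjoint_left.1 hz.1 (hb'.mapsTo hx))
    · exact absurd (hxx ▸ gb'.mapsTo hx) (Set.disjoint_left.1 hz.1 (hb'.mapsTo hx'))
    · exact gb'.injOn hx hx' hxx
  · rw [ball_snoc]
    intro l R t ht
    have k1 : (∀ i, t i ∈ ball L e a) → (Language.Structure.RelMap R t ↔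
        Language.Structure.RelMap R fun i => f (t i)) := fun h' => by
      rw [hr R t h', show (fun i => f (t i)) = fun i => h (t i) from funext fun i => f1 _ (h' i)]
    have k2 : (∀ i, t i ∈ ball L e ![y]) → (Language.Structure.RelMap R t ↔
        Language.Structure.RelMap R fun i => f (t i)) := fun h' => by
      rw [gr R t h', show (fun i => f (t i)) = fun i => g (t i) from funext fun i => f2 _ (h' i)]
    have hft : ∀ i, f (t i) ∈ ball L e b ∪ ball L e ![z] := fun i =>
      (ht i).elim (fun h => .inl (hb'.mapsTo h)) fun h => .inr (gb'.mapsTo h)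
    constructor
    · intro hR
      rcases hy.2 R t hR ht with h' | h'
      · exact (k1 h').1 hR
      · exact (k2 h').1 hR
    · intro hR
      rcases hz.2 R _ hR hft with h' | h'
      · refine (k1 fun i => (ht i).elim (fun h => h) fun h => ?_).2 hR
        exact absurd (gb'.mapsTo h) (Set.disjoint_left.1 hz.1 (h' i))
      · refine (k2 fun i => (ht i).elim (fun h => ?_) fun h => h).2 hR
        exact absurd (h' i) (Set.disjoint_left.1 hz.1 (hb'.mapsTo h))
  · intro i
    induction i using Fin.lastCases with
    | last =>
      have h0 : y ∈ ball L e ![y] := mem_ball_center L he ![y] 0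
      simpa using (f2 y h0).trans (gc 0)
    | cast i => simpa using (f1 _ (mem_ball_center L he a i)).trans (hc i)

/-- Being far apart is a property of the isomorphism type. -/
lemma Far.of_iso (he : 0 < e)
    (H : SphereIso L e (Fin.snoc a y : Fin (k + 1) → A) (Fin.snoc b z : Fin (k + 1) → B))
    (hz : Far L e b z) : Far L e a y := by
  obtain ⟨h, H⟩ := H
  have h1 := H.sub (r := e) (s := 1) (a' := a) (fun i => by
    simpa using mem_ball_center L one_pos (Fin.snoc a y : Fin (k + 1) → A) i.castSucc) (by omega) he
  have h2 := H.sub (r := e) (s := 1) (a' := ![y]) (fun i => by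
    have := mem_ball_center L one_pos (Fin.snoc a y : Fin (k + 1) → A) (Fin.last k)
    simpa using this) (by omega) he
  have e1 : (fun i => h (a i)) = b := funext fun i => by simpa using H.2 i.castSucc
  have e2 : (fun i => h (![y] i)) = ![z] := funext fun i => by
    have := H.2 (Fin.last k)
    simpa using this
  rw [e1] at h1
  rw [e2] at h2
  have hX : ∀ x, x ∈ ball L e (Fin.snoc a y : Fin (k + 1) → A) ↔ x ∈ ball L e a ∪ ball L e ![y] := by
    intro x; rw [ball_snoc]
  constructor
  · rw [Set.disjoint_left]
    intro x hx hx'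
    exact Set.disjoint_left.1 hz.1 (h1.1.bij.mapsTo hx) (h2.1.bij.mapsTo hx')
  · intro l R t hR ht
    have hR' := (H.1.rel R t fun i => (hX _).2 (ht i)).1 hR
    rcases hz.2 R _ hR' (fun i => (ht i).elim (fun h => .inl (h1.1.bij.mapsTo h))
      fun h => .inr (h2.1.bij.mapsTo h)) with h' | h'
    · refine .inl fun i => (ht i).elim (fun h => h) fun h => ?_
      exact absurd (h2.1.bij.mapsTo h) (Set.disjoint_left.1 hz.1 (h' i))
    · refine .inr fun i => (ht i).elim (fun h => ?_) fun h => h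
      exact absurd (h' i) (Set.disjoint_left.1 hz.1 (h1.1.bij.mapsTo h))

/-- Elements at distance at least `2e` are far apart. -/
lemma far_of_notMem_ball (h : y ∉ ball L (2 * e) a) : Far L e a y := by
  -- The radii `(e, e)` give disjointness. The radii `(e + 1, e)` exclude a fact that meets both
  -- balls, because all entries of a fact that meets the first ball are in the ball of radius `e +
  -- 1`.
  have key : ∀ d d' : ℕ, d + d' ≤ 2 * e + 1 → ∀ x ∈ ball L d a, x ∉ ball L d' ![y] := by
    rintro d d' hd x hx ⟨i, hi⟩
    refine h (ball_subset_ball L (b := ![x]) (s := d) (r := d') (by simpa using hx) hd ⟨0, ?_⟩)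
    rw [dist_comm]
    simpa using hi
  constructor
  · rw [Set.disjoint_left]
    intro x
    exact key e e (by omega) x
  · intro l R t hR ht
    by_cases h0 : ∃ i, t i ∈ ball L e a
    · obtain ⟨i, hi⟩ := h0
      refine .inl fun j => (ht j).elim (fun h => h) fun hj => ?_
      exact absurd hj (key (e + 1) e (by omega) _ (mem_ball_succ_of_fact hR hi))
    · refine .inr fun j => (ht j).resolve_left fun hj => h0 ⟨j, hj⟩

/-- In a sphere that consists of the two balls, every fact falls under the second clause of `Far`.
The property then says that the ball of `y` avoids the other ball together with its neighbours,
which can be tested with two calls of `ballList`. -/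
lemma far_iff_of_univ (he : 0 < e) (hu : ball L e a ∪ ball L e ![y] = Set.univ) :
    Far L e a y ↔ ∀ x ∈ ball L e ![y], x ∉ ball L (e + 1) a := by
  constructor
  · rintro ⟨h1, h2⟩ x hx hx'
    rcases (mem_ball_succ L a).1 hx' with ⟨i, rfl⟩ | h | ⟨z, hz, -, l, R, t, hR, ⟨p, rfl⟩, q, rfl⟩
    · exact Set.disjoint_left.1 h1 (mem_ball_center L he a i) hx
    · exact Set.disjoint_left.1 h1 h hx
    · rcases h2 R t hR (fun i => hu ▸ Set.mem_univ _) with h | h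
      · exact Set.disjoint_left.1 h1 (h q) hx
      · exact Set.disjoint_left.1 h1 hz (h p)
  · intro h
    refine ⟨Set.disjoint_left.2 fun x hx hx' => h x hx' (ball_mono L a (Nat.le_succ e) hx),
      fun l R t hR ht => ?_⟩
    by_cases h0 : ∃ i, t i ∈ ball L e a
    · obtain ⟨i, hi⟩ := h0
      exact .inl fun j => (ht j).resolve_right fun hj => h _ hj (mem_ball_succ_of_fact hR hi)
    · exact .inr fun j => (ht j).resolve_left fun hj => h0 ⟨j, hj⟩

end Far

/-! ### Counting the realisations of a sphere -/

section Count
variable {L : FirstOrder.Language.{u, v}} {A B S : Type*} [L.Structure A] [L.Structure B]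
  [L.Structure S] {n e R : ℕ} {x : Fin n → A} {b : A} {h : A → B} {tc : Fin (n + 1) → B}
  {sc : Fin (n + 1) → S} {z : S}

lemma snoc_forall {α : Type*} {k : ℕ} {a : Fin k → α} {y : α} {P : α → Prop} :
    (∀ i, P ((Fin.snoc a y : Fin (k + 1) → α) i)) ↔ (∀ i, P (a i)) ∧ P y := by
  rw [Fin.forall_fin_succ']
  simp

/-- The inner `Fin.snoc` is the map of indices that omits the last but one centre, that is, the
variable to be eliminated. -/
lemma snoc_skip {α : Type*} {k : ℕ} (a : Fin (k + 1) → α) (y : α) :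
    (fun i => (Fin.snoc a y : Fin (k + 2) → α)
      ((Fin.snoc (fun i : Fin k => i.castSucc.castSucc) (Fin.last (k + 1)) :
        Fin (k + 1) → Fin (k + 2)) i)) = Fin.snoc (Fin.init a) y := by
  funext i
  induction i using Fin.lastCases with
  | last => simp
  | cast i => simp [Fin.init]

/-- A sphere that is large enough determines the spheres around the elements close to its
centres. -/
lemma SphereMap.near (H : SphereMap L R h (Fin.snoc x b : Fin (n + 1) → A) tc) (he : 0 < e)
    (hR : 3 * e ≤ R) {y : A} (hy : y ∈ ball L (2 * e) (Fin.snoc x b : Fin (n + 1) → A)) :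
    SphereIso L e (Fin.snoc (Fin.snoc x b : Fin (n + 1) → A) y : Fin (n + 2) → A)
      (Fin.snoc tc (h y) : Fin (n + 2) → B) ∧
    SphereIso L e (Fin.snoc x y : Fin (n + 1) → A)
      (Fin.snoc (Fin.init tc) (h y) : Fin (n + 1) → B) := by
  have hc : ∀ i, (Fin.snoc x b : Fin (n + 1) → A) i ∈
      ball L (2 * e) (Fin.snoc x b : Fin (n + 1) → A) := mem_ball_center L (by omega) _
  constructor
  -- This is the origin of the factor 3 in the new radius: the balls of radius `e` around elements
  -- of the ball of radius `2e` must stay inside the ball of radius `R`.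
  · refine H.sub_iso (s := 2 * e) (snoc_forall.2 ⟨hc, hy⟩) (fun i => ?_) (by omega) he
    induction i using Fin.lastCases with
    | last => simp
    | cast i => rw [Fin.snoc_castSucc, Fin.snoc_castSucc]; exact H.2 i
  · refine H.sub_iso (s := 2 * e) (snoc_forall.2 ⟨fun i => ?_, hy⟩) (fun i => ?_) (by omega) he
    · simpa using hc i.castSucc
    · induction i using Fin.lastCases with
      | last => simp
      | cast i => rw [Fin.snoc_castSucc, Fin.snoc_castSucc]; simpa [Fin.init] using H.2 i.castSucc

lemma SphereIso.congr_left {k : ℕ} {a : Fin k → A} {b : Fin k → B} {c : Fin k → S} (he : 0 < e)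
    [Nonempty A] (H : SphereIso L e a b) : SphereIso L e a c ↔ SphereIso L e b c :=
  ⟨fun G => (H.symm he).trans G, fun G => H.trans G⟩

lemma SphereMap.base (H : SphereMap L R h (Fin.snoc x b : Fin (n + 1) → A) tc) (he : 0 < e)
    (hR : 3 * e ≤ R) : SphereIso L e (Fin.snoc x b : Fin (n + 1) → A) tc :=
  H.sub_iso (s := 1) (mem_ball_center L one_pos _) H.2 (by omega) he

lemma SphereMap.encard_inter (H : SphereMap L R h (Fin.snoc x b : Fin (n + 1) → A) tc) (he : 0 < e)
    (hR : 3 * e ≤ R) {P : A → Prop} {Q : B → Prop}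
    (hPQ : ∀ y ∈ ball L (2 * e) (Fin.snoc x b : Fin (n + 1) → A), P y ↔ Q (h y)) :
    {y | y ∈ ball L (2 * e) (Fin.snoc x b : Fin (n + 1) → A) ∧ P y}.encard =
      {y | y ∈ ball L (2 * e) tc ∧ Q y}.encard := by
  have hb : Set.BijOn h (ball L (2 * e) (Fin.snoc x b : Fin (n + 1) → A)) (ball L (2 * e) tc) := by
    have := (H.sub (r := 2 * e) (s := 1) (mem_ball_center L one_pos _) (by omega) (by omega)).1.bij
    rwa [show (fun i => h ((Fin.snoc x b : Fin (n + 1) → A) i)) = tc from funext H.2] at this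
  rw [← Set.InjOn.encard_image (f := h) fun y hy y' hy' => hb.injOn hy.1 hy'.1]
  congr 1
  ext y
  constructor
  · rintro ⟨y, ⟨h1, h2⟩, rfl⟩
    exact ⟨hb.mapsTo h1, (hPQ y h1).1 h2⟩
  · rintro ⟨h1, h2⟩
    obtain ⟨y, hy, rfl⟩ := hb.surjOn h1
    exact ⟨y, ⟨hy, (hPQ y hy).2 h2⟩, rfl⟩

/-- The elements that realise a connected sphere are close to the centres. -/
lemma SphereMap.encard_of_not_far (H : SphereMap L R h (Fin.snoc x b : Fin (n + 1) → A) tc)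
    (he : 0 < e) (hR : 3 * e ≤ R) (hfar : ¬ (Far L e sc z ∧ SphereIso L e tc sc)) :
    {y | SphereIso L e (Fin.snoc (Fin.snoc x b : Fin (n + 1) → A) y : Fin (n + 2) → A)
      (Fin.snoc sc z : Fin (n + 2) → S)}.encard =
    {y | y ∈ ball L (2 * e) tc ∧ SphereIso L e (Fin.snoc tc y : Fin (n + 2) → B)
      (Fin.snoc sc z : Fin (n + 2) → S)}.encard := by
  have : Nonempty A := ⟨b⟩
  rw [← H.encard_inter he hR fun y hy => (H.near he hR hy).1.congr_left he]
  congr 1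
  ext y
  refine ⟨fun hy => ⟨?_, hy⟩, fun hy => hy.2⟩
  -- A realisation outside the ball of radius `2e` is far from the centres. This and the isomorphism
  -- type of the centres would pass to `sc` and `z`, against `hfar`.
  by_contra hn
  refine hfar ⟨?_, (H.base he hR).congr_left he |>.1 (SphereIso.left he hy)⟩
  exact Far.of_iso he (hy.symm he) (far_of_notMem_ball hn)

/-- The elements that realise a sphere in which the last centre is far from the others. -/
lemma SphereMap.encard_of_far (H : SphereMap L R h (Fin.snoc x b : Fin (n + 1) → A) tc)
    (he : 0 < e) (hR : 3 * e ≤ R) (hfar : Far L e sc z) (hbase : SphereIso L e tc sc) :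
    {y | SphereIso L e (Fin.snoc x y : Fin (n + 1) → A)
      (Fin.snoc (Fin.init sc) z : Fin (n + 1) → S)}.encard =
    {y | SphereIso L e (Fin.snoc (Fin.snoc x b : Fin (n + 1) → A) y : Fin (n + 2) → A)
      (Fin.snoc sc z : Fin (n + 2) → S)}.encard +
    {y | y ∈ ball L (2 * e) tc ∧ (SphereIso L e (Fin.snoc (Fin.init tc) y : Fin (n + 1) → B)
      (Fin.snoc (Fin.init sc) z : Fin (n + 1) → S) ∧
      ¬ SphereIso L e (Fin.snoc tc y : Fin (n + 2) → B)
        (Fin.snoc sc z : Fin (n + 2) → S))}.encard := by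
  have : Nonempty A := ⟨b⟩
  rw [← H.encard_inter he hR (P := fun y => SphereIso L e (Fin.snoc x y : Fin (n + 1) → A)
      (Fin.snoc (Fin.init sc) z : Fin (n + 1) → S) ∧ ¬ SphereIso L e
        (Fin.snoc (Fin.snoc x b : Fin (n + 1) → A) y : Fin (n + 2) → A)
      (Fin.snoc sc z : Fin (n + 2) → S)) fun y hy => and_congr ((H.near he hR hy).2.congr_left he)
        (not_congr ((H.near he hR hy).1.congr_left he)), ← Set.encard_union_eq]
  · congr 1
    ext y
    constructor
    · intro hy
      by_cases hF : SphereIso L e (Fin.snoc (Fin.snoc x b : Fin (n + 1) → A) y : Fin (n + 2) → A)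
          (Fin.snoc sc z : Fin (n + 2) → S)
      · exact .inl hF
      · refine .inr ⟨?_, hy, hF⟩
        -- Outside the ball of radius `2e` the sphere around `(x, b)` and the one around `y` can be
        -- glued, and `y` would realise the full sphere.
        by_contra hn
        exact hF (((H.base he hR).trans hbase).glue (hy.right he) he (far_of_notMem_ball hn) hfar)
    · rintro (hy | hy)
      · have := hy.reindex he (Fin.snoc (fun i : Fin n => i.castSucc.castSucc) (Fin.last (n + 1)) :
          Fin (n + 1) → Fin (n + 2))
        rwa [snoc_skip, snoc_skip, Fin.init_snoc] at this
      · exact hy.2.1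
  · rw [Set.disjoint_left]
    exact fun y hy hy' => hy'.2.2 hy

end Count

/-! ### Sizes of balls -/

section Degree
variable {L : FirstOrder.Language.{u, v}} {A : Type*} [L.Structure A] {f : ℕ}

/-- For `f ≥ 2` the recursion `s ↦ 1 + f s` for the sizes preserves the stronger bound `s + 1 ≤ 2 f
^ r`. For `f = 1` this fails, but there an element and its only neighbour already form a whole
component. -/
lemma exists_finset_ball (hA : DegreeLE L A f) (hf : 1 ≤ f) (a : A) (r : ℕ) :
    ∃ s : Finset A, ball L r ![a] ⊆ s ∧ s.card ≤ 2 * f ^ r := by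
  classical
  have h0 : ∀ y : A, ∃ s : Finset A, {x : A | dist L y x = 1} = s ∧ s.card ≤ f := by
    intro y
    obtain ⟨h1, m, hm, hmf⟩ := Set.encard_le_coe_iff.1 (hA y)
    refine ⟨h1.toFinset, by simp, ?_⟩
    rw [h1.encard_eq_coe_toFinset_card] at hm
    have := Nat.cast_injective hm
    omega
  choose nb hnb hcard using h0
  have hmem : ∀ x y : A, (gaifman L A).Adj y x → x ∈ nb y := by
    intro x y h
    have : x ∈ {x : A | dist L y x = 1} := SimpleGraph.edist_eq_one_iff_adj.2 h
    rw [hnb] at this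
    exact this
  rcases hf.eq_or_lt with rfl | hf
  · refine ⟨insert a (nb a), ?_, by
      have := Finset.card_insert_le a (nb a)
      have := hcard a
      simp; omega⟩
    induction r with
    | zero => simp [ball_zero]
    | succ r ih =>
      intro x hx
      rcases (mem_ball_succ L _).1 hx with ⟨i, rfl⟩ | hx | ⟨y, hy, hyx⟩
      · simp
      · exact ih hx
      · have hya := ih hy
        simp only [Finset.coe_insert, Set.mem_insert_iff, Finset.mem_coe] at hya ⊢
        rcases hya with rfl | hya
        · exact .inr (hmem _ _ hyx)
        · left
          have h1 : dist L a y = 1 := by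
            have : y ∈ (nb a : Set A) := hya
            rwa [← hnb] at this
          have h2 : a ∈ nb y := hmem _ _ (SimpleGraph.edist_eq_one_iff_adj.1 (by
            rw [SimpleGraph.edist_comm]; exact h1))
          exact Finset.card_le_one.1 (hcard y) _ (hmem _ _ hyx) _ h2
  · suffices h : ∃ s : Finset A, ball L r ![a] ⊆ s ∧ s.card + 1 ≤ 2 * f ^ r by
      obtain ⟨s, h1, h2⟩ := h
      exact ⟨s, h1, by omega⟩
    induction r with
    | zero => exact ⟨∅, by simp [ball_zero], by simp⟩
    | succ r ih =>
      obtain ⟨s, h1, h2⟩ := ih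
      refine ⟨insert a (s.biUnion nb), fun x hx => ?_, ?_⟩
      · rcases range_or_adj_of_mem_ball_succ L hx with ⟨i, rfl⟩ | ⟨y, hy, hyx⟩
        · simp
        · simp only [Finset.coe_insert, Finset.coe_biUnion, Set.mem_insert_iff, Set.mem_iUnion]
          exact .inr ⟨y, h1 hy, hmem _ _ hyx⟩
      · have h3 := Finset.card_insert_le a (s.biUnion nb)
        have h4 := Finset.card_biUnion_le_card_mul s nb f fun y _ => hcard y
        have h5 := Nat.mul_le_mul_right f h2
        rw [Nat.add_mul, Nat.mul_assoc, ← pow_succ] at h5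
        omega

lemma encard_ball_le (hA : DegreeLE L A f) (hf : 1 ≤ f) {k : ℕ} (a : Fin k → A) (r : ℕ) :
    (ball L r a).encard ≤ (k * (2 * f ^ r) : ℕ) := by
  induction k with
  | zero =>
    have : ball L r a = ∅ := by ext x; simp [ball]
    simp [this]
  | succ k ih =>
    rw [← Fin.snoc_init_self a, ball_snoc]
    obtain ⟨s, h1, h2⟩ := exists_finset_ball hA hf (a (Fin.last k)) r
    refine (Set.encard_union_le _ _).trans ?_
    rw [Nat.add_mul, Nat.cast_add, Nat.one_mul]
    refine add_le_add (ih _) ((Set.encard_le_encard h1).trans ?_)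
    rw [Set.encard_coe_eq_coe_finsetCard]
    exact_mod_cast h2

end Degree

/-! ### Written structures and finite structures -/

section Raw
variable {L : FirstOrder.Language.{u, v}} [Finite (Σ l, L.Relations l)]

/-- The number of a relation symbol. -/
noncomputable def relIdx (R : Σ l, L.Relations l) : ℕ := Finite.equivFin (Σ l, L.Relations l) R

lemma relIdx_injective : Function.Injective (relIdx (L := L)) := fun _ _ h =>
  (Finite.equivFin _).injective (Fin.ext h)

/-- A fact with numbers instead of relation symbols. -/
noncomputable def rawFact {s : ℕ} (F : Σ R : (Σ l, L.Relations l), Fin R.1 → Fin s) : RawFact :=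
  (relIdx F.1, List.ofFn fun i => (F.2 i).val)

lemma rawFact_eq {s l l' : ℕ} {R : L.Relations l} {R' : L.Relations l'} {t : Fin l → Fin s}
    {t' : Fin l' → ℕ} (h : rawFact ⟨⟨l, R⟩, t⟩ = (relIdx ⟨l', R'⟩, List.ofFn t')) :
    ∃ e : l' = l, e ▸ R' = R ∧ ∀ i, (t i).val = t' (Fin.cast e.symm i) := by
  obtain ⟨h1, h2⟩ := Prod.ext_iff.1 h
  have h3 := relIdx_injective h1
  obtain rfl : l = l' := congrArg Sigma.fst h3
  obtain rfl : R = R' := eq_of_heq (Sigma.mk.inj h3).2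
  exact ⟨rfl, rfl, fun i => congrFun (List.ofFn_injective h2) i⟩

lemma rawFact_injective {s : ℕ} : Function.Injective (rawFact (L := L) (s := s)) := by
  rintro ⟨⟨l, R⟩, t⟩ ⟨⟨l', R'⟩, t'⟩ h
  obtain ⟨rfl, rfl, h⟩ := rawFact_eq (t' := fun i => (t' i).val) h
  obtain rfl : t = t' := funext fun i => Fin.ext (h i)
  rfl

variable (L) in
/-- The relation symbols, as numbers and arities. -/
noncomputable def arities : List (ℕ × ℕ) :=
  List.ofFn fun i : Fin (Nat.card (Σ l, L.Relations l)) =>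
    (i.val, ((Finite.equivFin (Σ l, L.Relations l)).symm i).1)

lemma mem_arities {r : ℕ × ℕ} : r ∈ arities L ↔ ∃ R : Σ l, L.Relations l, (relIdx R, R.1) = r := by
  rw [arities, List.mem_ofFn]
  constructor
  · rintro ⟨i, rfl⟩
    exact ⟨(Finite.equivFin _).symm i, by simp [relIdx]⟩
  · rintro ⟨R, rfl⟩
    exact ⟨Finite.equivFin _ R, by simp [relIdx]⟩

lemma mem_allFacts_list {ar : List (ℕ × ℕ)} {s : ℕ} {x : RawFact} :
    x ∈ allFacts ar s ↔ ∃ r ∈ ar, x.1 = r.1 ∧ x.2.length = r.2 ∧ ∀ y ∈ x.2, y < s := by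
  induction ar with
  | nil => simp [allFacts]
  | cons r ar ih =>
    rw [allFacts, List.mem_append, ih, List.mem_map]
    simp only [List.mem_cons, exists_eq_or_imp, mem_tuples]
    refine or_congr_left ⟨?_, fun h => ⟨x.2, h.2, Prod.ext h.1.symm rfl⟩⟩
    rintro ⟨t, h, rfl⟩
    exact ⟨rfl, h⟩

lemma exists_ofFn {s k : ℕ} {l : List ℕ} (h1 : l.length = k) (h2 : ∀ y ∈ l, y < s) :
    ∃ t : Fin k → Fin s, (List.ofFn fun i => (t i).val) = l := by
  subst h1
  exact ⟨fun i => ⟨l.get i, h2 _ (l.get_mem i)⟩, List.ofFn_get l⟩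

lemma mem_allFacts {s : ℕ} {x : RawFact} : x ∈ allFacts (arities L) s ↔
    ∃ F : Σ R : (Σ l, L.Relations l), Fin R.1 → Fin s, rawFact F = x := by
  rw [mem_allFacts_list]
  constructor
  · rintro ⟨r, hr, h1, h2, h3⟩
    obtain ⟨R, rfl⟩ := mem_arities.1 hr
    obtain ⟨t, ht⟩ := exists_ofFn h2 h3
    exact ⟨⟨R, t⟩, Prod.ext h1.symm ht⟩
  · rintro ⟨⟨R, t⟩, rfl⟩
    refine ⟨_, mem_arities.2 ⟨R, rfl⟩, rfl, by simp [rawFact], fun y hy => ?_⟩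
    obtain ⟨i, rfl⟩ := List.mem_ofFn.1 hy
    exact (t i).2

/-- The written facts of a finite structure. -/
noncomputable def FinStr.rawFacts (S : FinStr L) : List RawFact := S.facts.map rawFact

/-- The number of an element. -/
def FinStr.val (S : FinStr L) (x : S.Carrier) : ℕ := Fin.val (n := S.size) x

lemma FinStr.val_injective (S : FinStr L) : Function.Injective S.val := Fin.val_injective

lemma FinStr.val_lt (S : FinStr L) (x : S.Carrier) : S.val x < S.size := Fin.is_lt (n := S.size) x

lemma FinStr.exists_val (S : FinStr L) {i : ℕ} (h : i < S.size) : ∃ x, S.val x = i :=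
  ⟨(⟨i, h⟩ : Fin S.size), rfl⟩

/-- A finite structure with centres, written with numbers. -/
noncomputable def FinStr.raw (S : FinStr L) {k : ℕ} (a : Fin k → S.Carrier) : Raw :=
  (S.size, List.ofFn fun i => S.val (a i), S.rawFacts)

/-- `r` is a description of `S` with centres `a`, up to the order and repetitions of facts. -/
structure Rep (r : Raw) (S : FinStr L) {k : ℕ} (a : Fin k → S.Carrier) : Prop where
  size : r.1 = S.size
  center : r.2.1 = List.ofFn fun i => S.val (a i)
  facts : ∀ x, x ∈ r.2.2 ↔ x ∈ S.rawFacts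

lemma FinStr.rep_raw (S : FinStr L) {k : ℕ} (a : Fin k → S.Carrier) : Rep (S.raw a) S a :=
  ⟨rfl, rfl, fun _ => Iff.rfl⟩

variable [L.IsRelational]

lemma FinStr.relMap_iff (S : FinStr L) {l : ℕ} (R : L.Relations l) (t : Fin l → S.Carrier) :
    Language.Structure.RelMap R t ↔ (relIdx ⟨l, R⟩, List.ofFn fun i => S.val (t i)) ∈ S.rawFacts := by
  have h : (relIdx ⟨l, R⟩, List.ofFn fun i => S.val (t i)) = rawFact (L := L) ⟨⟨l, R⟩, t⟩ := rfl
  rw [h, FinStr.rawFacts, List.mem_map_of_injective rawFact_injective]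
  exact Iff.rfl

lemma FinStr.exists_of_mem (S : FinStr L) {x : RawFact} (h : x ∈ S.rawFacts) :
    ∃ (l : ℕ) (R : L.Relations l) (t : Fin l → S.Carrier),
      x = (relIdx ⟨l, R⟩, List.ofFn fun i => S.val (t i)) ∧ Language.Structure.RelMap R t := by
  obtain ⟨⟨⟨l, R⟩, t⟩, hF, rfl⟩ := List.mem_map.1 h
  exact ⟨l, R, t, rfl, hF⟩

variable {r r' : Raw} {S S' : FinStr L} {k : ℕ} {a : Fin k → S.Carrier} {a' : Fin k → S'.Carrier}

lemma Rep.mem_ballList (h : Rep r S a) {e : ℕ} {x : S.Carrier} :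
    S.val x ∈ ballList e r.1 r.2.2 r.2.1 ↔ x ∈ ball L e a := by
  induction e generalizing x with
  | zero => simp [ballList, ball_zero]
  | succ e ih =>
    rw [ballList, Function.iterate_succ_apply', ← ballList, mem_ball_succ, ballStep, List.mem_filter]
    have h1 : S.val x ∈ r.2.1 ↔ x ∈ Set.range a := by
      rw [h.center, List.mem_ofFn]
      exact ⟨fun ⟨i, hi⟩ => ⟨i, S.val_injective hi⟩, fun ⟨i, hi⟩ => ⟨i, congrArg _ hi⟩⟩
    have hlt : S.val x < r.1 := h.size ▸ S.val_lt x
    simp only [Bool.or_eq_true, decide_eq_true_eq, ih, h1, List.any_eq_true, Bool.and_eq_true,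
      List.mem_range, hlt, true_and, or_assoc]
    -- `ballStep` does not check that adjacent elements are distinct. They are, once `x` is known to
    -- be outside the smaller ball.
    refine or_congr_right (or_congr_right' fun hx => ?_)
    constructor
    · rintro ⟨y, hy, f, hf, hxf, hyf⟩
      obtain ⟨l, R, t, rfl, hR⟩ := S.exists_of_mem ((h.facts f).1 hf)
      obtain ⟨i, hi⟩ := List.mem_ofFn.1 hxf
      obtain ⟨j, rfl⟩ := List.mem_ofFn.1 hyf
      obtain rfl := S.val_injective hi
      have hj := ih.1 hy
      exact ⟨t j, hj, fun he => hx (he ▸ hj), l, R, t, hR, ⟨j, rfl⟩, i, rfl⟩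
    · rintro ⟨y, hy, -, l, R, t, hR, ⟨j, rfl⟩, i, rfl⟩
      exact ⟨_, ih.2 hy, _, (h.facts _).2 ((S.relMap_iff R t).1 hR),
        List.mem_ofFn.2 ⟨i, rfl⟩, List.mem_ofFn.2 ⟨j, rfl⟩⟩

lemma ballList_lt {e s : ℕ} {F : List RawFact} {cs : List ℕ} {x : ℕ}
    (h : x ∈ ballList e s F cs) : x < s := by
  cases e with
  | zero => simp [ballList] at h
  | succ e =>
    rw [ballList, Function.iterate_succ_apply', ballStep] at h
    exact List.mem_range.1 (List.mem_filter.1 h).1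

lemma nodup_ballList {e s : ℕ} {F : List RawFact} {cs : List ℕ} : (ballList e s F cs).Nodup := by
  cases e with
  | zero => simp [ballList]
  | succ e =>
    rw [ballList, Function.iterate_succ_apply', ballStep]
    exact List.nodup_range.filter _

lemma Rep.mem_ballList_iff (h : Rep r S a) {e x : ℕ} :
    x ∈ ballList e r.1 r.2.2 r.2.1 ↔ ∃ y ∈ ball L e a, S.val y = x := by
  constructor
  · intro hx
    obtain ⟨y, rfl⟩ := S.exists_val (h.size ▸ ballList_lt hx)
    exact ⟨y, h.mem_ballList.1 hx, rfl⟩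
  · rintro ⟨y, hy, rfl⟩
    exact h.mem_ballList.2 hy

lemma Rep.coversAll_iff (h : Rep r S a) {e : ℕ} : coversAll e r = true ↔ ball L e a = Set.univ := by
  rw [coversAll, List.all_eq_true, Set.eq_univ_iff_forall]
  simp only [List.mem_range, decide_eq_true_eq]
  constructor
  · exact fun H x => h.mem_ballList.1 (H _ (h.size ▸ S.val_lt x))
  · intro H x hx
    obtain ⟨y, rfl⟩ := S.exists_val (h.size ▸ hx)
    exact h.mem_ballList.2 (H y)

lemma Rep.mem_inducedFacts (h : Rep r S a) {e : ℕ} {x : RawFact} :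
    x ∈ inducedFacts (ballList e r.1 r.2.2 r.2.1) r.2.2 ↔
    ∃ (l : ℕ) (R : L.Relations l) (t : Fin l → S.Carrier), (∀ i, t i ∈ ball L e a) ∧
      Language.Structure.RelMap R t ∧ x = (relIdx ⟨l, R⟩, List.ofFn fun i => S.val (t i)) := by
  rw [inducedFacts, List.mem_filter, h.facts]
  constructor
  · rintro ⟨h1, h2⟩
    obtain ⟨l, R, t, rfl, hR⟩ := S.exists_of_mem h1
    refine ⟨l, R, t, fun i => ?_, hR, rfl⟩
    rw [List.all_eq_true] at h2
    exact h.mem_ballList.1 (by simpa using h2 _ (List.mem_ofFn.2 ⟨i, rfl⟩))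
  · rintro ⟨l, R, t, ht, hR, rfl⟩
    refine ⟨(S.relMap_iff R t).1 hR, ?_⟩
    rw [List.all_eq_true]
    intro y hy
    obtain ⟨i, rfl⟩ := List.mem_ofFn.1 hy
    simpa using h.mem_ballList.2 (ht i)

lemma Rep.length_ballList (h : Rep r S a) {e : ℕ} :
    ((ballList e r.1 r.2.2 r.2.1).length : ℕ∞) = (ball L e a).encard := by
  rw [← S.val_injective.injOn.encard_image (s := ball L e a)]
  have : S.val '' ball L e a = (ballList e r.1 r.2.2 r.2.1).toFinset := by
    ext x
    simp only [Set.mem_image, List.coe_toFinset]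
    exact h.mem_ballList_iff.symm
  rw [this, Set.encard_coe_eq_coe_finsetCard, List.toFinset_card_of_nodup nodup_ballList]

/-- The map of lists of numbers that belongs to a map of structures. -/
lemma exists_map_list (g : S.Carrier → S'.Carrier) (hs : r.1 = S.size) (hs' : r'.1 = S'.size) :
    ∃ h ∈ tuples r'.1 r.1, ∀ x, h.getD (S.val x) 0 = S'.val (g x) := by
  refine ⟨List.ofFn (n := S.size) fun i => S'.val (g i), mem_tuples.2 ⟨by simp [hs], ?_⟩, ?_⟩
  · intro y hy
    obtain ⟨i, rfl⟩ := List.mem_ofFn.1 hy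
    exact hs' ▸ S'.val_lt _
  · intro x
    rw [List.getD_eq_getElem _ _ (by rw [List.length_ofFn]; exact S.val_lt x), List.getElem_ofFn]
    rfl

lemma exists_map_of_list {h : List ℕ} (hh : h ∈ tuples r'.1 r.1) (hs : r.1 = S.size)
    (hs' : r'.1 = S'.size) :
    ∃ g : S.Carrier → S'.Carrier, ∀ x, h.getD (S.val x) 0 = S'.val (g x) := by
  obtain ⟨h1, h2⟩ := mem_tuples.1 hh
  have : ∀ x : S.Carrier, ∃ y, h.getD (S.val x) 0 = S'.val y := fun x => by
    obtain ⟨y, hy⟩ := S'.exists_val (i := h.getD (S.val x) 0) (by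
      rw [← hs', List.getD_eq_getElem _ _ (by rw [h1, hs]; exact S.val_lt x)]
      exact h2 _ (List.getElem_mem _))
    exact ⟨y, hy.symm⟩
  exact Classical.axiomOfChoice this

lemma isoMap_iff (h : Rep r S a) (h' : Rep r' S' a') (e : ℕ) {l : List ℕ}
    {g : S.Carrier → S'.Carrier} (hg : ∀ x, l.getD (S.val x) 0 = S'.val (g x)) :
    isoMap (ballList e r.1 r.2.2 r.2.1) (inducedFacts (ballList e r.1 r.2.2 r.2.1) r.2.2) r.2.1
      (ballList e r'.1 r'.2.2 r'.2.1) (inducedFacts (ballList e r'.1 r'.2.2 r'.2.1) r'.2.2) r'.2.1 l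
      = true ↔ SphereMap L e g a a' := by
  have hmap : ∀ (m : ℕ) (t : Fin m → S.Carrier),
      ((List.ofFn fun i => S.val (t i)).map fun j => l.getD j 0) =
        List.ofFn fun i => S'.val (g (t i)) := fun m t => by
    rw [List.map_ofFn]; exact congrArg _ (funext fun i => hg _)
  have hfact : ∀ x, x ∈ (inducedFacts (ballList e r.1 r.2.2 r.2.1) r.2.2).map
      (fun f => (f.1, f.2.map fun j => l.getD j 0)) ↔
      ∃ (m : ℕ) (R : L.Relations m) (t : Fin m → S.Carrier), (∀ i, t i ∈ ball L e a) ∧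
        Language.Structure.RelMap R t ∧ x = (relIdx ⟨m, R⟩, List.ofFn fun i => S'.val (g (t i))) := by
    intro x
    rw [List.mem_map]
    constructor
    · rintro ⟨f, hf, rfl⟩
      obtain ⟨m, R, t, ht, hR, rfl⟩ := h.mem_inducedFacts.1 hf
      exact ⟨m, R, t, ht, hR, by rw [hmap]⟩
    · rintro ⟨m, R, t, ht, hR, rfl⟩
      exact ⟨_, h.mem_inducedFacts.2 ⟨m, R, t, ht, hR, rfl⟩, by rw [hmap]⟩
  have hball : ∀ x, x ∈ (ballList e r.1 r.2.2 r.2.1).map (fun j => l.getD j 0) ↔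
      ∃ y ∈ ball L e a, S'.val (g y) = x := by
    intro x
    rw [List.mem_map]
    constructor
    · rintro ⟨j, hj, rfl⟩
      obtain ⟨y, hy, rfl⟩ := h.mem_ballList_iff.1 hj
      exact ⟨y, hy, (hg y).symm⟩
    · rintro ⟨y, hy, rfl⟩
      exact ⟨_, h.mem_ballList.2 hy, hg y⟩
  rw [isoMap]
  simp only [Bool.and_eq_true, decide_eq_true_eq, List.all_eq_true]
  have hc : (r.2.1.map fun j => l.getD j 0) = r'.2.1 ↔ ∀ i, g (a i) = a' i := by
    rw [h.center, h'.center, hmap]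
    constructor
    · exact fun H i => S'.val_injective (congrFun (List.ofFn_injective H) i)
    · exact fun H => congrArg _ (funext fun i => congrArg _ (H i))
  rw [hc]
  have hfin : (ball L e a).Finite :=
    Set.finite_of_encard_eq_coe h.length_ballList.symm
  constructor
  · rintro ⟨⟨hc, hlen⟩, ⟨hb1, hb2⟩, hf1, hf2⟩
    have him : g '' ball L e a = ball L e a' := by
      ext y
      constructor
      · rintro ⟨x, hx, rfl⟩
        exact h'.mem_ballList.1 (hb1 _ ((hball _).2 ⟨x, hx, rfl⟩))
      · intro hy
        obtain ⟨x, hx, he⟩ := (hball _).1 (hb2 _ (h'.mem_ballList.2 hy))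
        exact ⟨x, hx, S'.val_injective he⟩
    -- The test compares lengths only. A map from a finite set onto one with equally many elements
    -- is injective.
    have hinj : Set.InjOn g (ball L e a) := by
      apply hfin.injOn_of_encard_image_eq
      rw [him, ← h.length_ballList, ← h'.length_ballList, hlen]
    refine ⟨⟨him ▸ hinj.bijOn_image, fun m R t ht => ?_⟩, hc⟩
    constructor
    · intro hR
      obtain ⟨m', R', t', ht', hR', he⟩ := h'.mem_inducedFacts.1 (hf1 _ ((hfact _).2 ⟨m, R, t, ht, hR, rfl⟩))
      rw [S'.relMap_iff, he, ← S'.relMap_iff]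
      exact hR'
    · intro hR
      obtain ⟨m', R', t', ht', hR', he⟩ := (hfact _).1 (hf2 _ (h'.mem_inducedFacts.2
        ⟨m, R, fun i => g (t i), fun i => him ▸ Set.mem_image_of_mem g (ht i), hR, rfl⟩))
      have h3 := relIdx_injective (Prod.ext_iff.1 he).1
      obtain rfl : m = m' := congrArg Sigma.fst h3
      obtain rfl : R = R' := eq_of_heq (Sigma.mk.inj h3).2
      obtain rfl : t = t' := funext fun i => hinj (ht i) (ht' i) (S'.val_injective
        (congrFun (List.ofFn_injective (Prod.ext_iff.1 he).2) i))
      exact hR'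
  · rintro ⟨⟨hb, hr⟩, hc⟩
    refine ⟨⟨hc, ?_⟩, ⟨?_, ?_⟩, ?_, ?_⟩
    · have := hb.injOn.encard_image
      rw [hb.image_eq, ← h.length_ballList, ← h'.length_ballList] at this
      exact (Nat.cast_injective this).symm
    · intro x hx
      obtain ⟨y, hy, rfl⟩ := (hball _).1 hx
      exact h'.mem_ballList.2 (hb.mapsTo hy)
    · intro x hx
      obtain ⟨y, hy, rfl⟩ := h'.mem_ballList_iff.1 hx
      obtain ⟨z, hz, rfl⟩ := hb.surjOn hy
      exact (hball _).2 ⟨z, hz, rfl⟩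
    · intro x hx
      obtain ⟨m, R, t, ht, hR, rfl⟩ := (hfact _).1 hx
      exact h'.mem_inducedFacts.2 ⟨m, R, _, fun i => hb.mapsTo (ht i), (hr R t ht).1 hR, rfl⟩
    · intro x hx
      obtain ⟨m, R, t, ht, hR, rfl⟩ := h'.mem_inducedFacts.1 hx
      choose s hs hst using fun i => hb.surjOn (ht i)
      obtain rfl : (fun i => g (s i)) = t := funext hst
      exact (hfact _).2 ⟨m, R, s, hs, (hr R s hs).2 hR, rfl⟩

lemma isoCheck_iff (h : Rep r S a) (h' : Rep r' S' a') (e : ℕ) :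
    isoCheck e r r' = true ↔ SphereIso L e a a' := by
  rw [isoCheck, List.any_eq_true]
  constructor
  · rintro ⟨l, hl, H⟩
    obtain ⟨g, hg⟩ := exists_map_of_list hl h.size h'.size
    exact ⟨g, (isoMap_iff h h' e hg).1 H⟩
  · rintro ⟨g, H⟩
    obtain ⟨l, hl, hg⟩ := exists_map_list g h.size h'.size
    exact ⟨l, hl, (isoMap_iff h h' e hg).2 H⟩

/-! ### The list of all written structures -/

lemma exists_of_mem_raws {N : ℕ} (h : r ∈ raws (arities L) k N) :
    ∃ (S : FinStr L) (a : Fin k → S.Carrier), S.raw a = r ∧ S.size ≤ N := by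
  simp only [raws, List.mem_flatMap, List.mem_map, List.mem_range, mem_tuples, mem_sublistsRev] at h
  obtain ⟨s, hs, cs, ⟨h1, h2⟩, F, hF, rfl⟩ := h
  obtain ⟨t, rfl⟩ := exists_ofFn h1 h2
  have hF' : ∀ x ∈ F, ∃ G : Σ R : (Σ l, L.Relations l), Fin R.1 → Fin (s + 1), rawFact G = x :=
    fun x hx => mem_allFacts.1 (hF.subset (List.mem_reverse.2 hx))
  obtain ⟨G, rfl⟩ : ∃ G, List.map (rawFact (L := L) (s := s + 1)) G = F := by
    have : F ∈ Set.range (List.map (rawFact (L := L) (s := s + 1))) := by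
      rw [Set.range_list_map]
      exact hF'
    exact this
  exact ⟨⟨s + 1, G⟩, t, rfl, hs⟩

/-- The elements of the ball are numbered by `g`, and the facts among them are selected from the
list of all possible facts. There is at least one centre, so the ball is non-empty, as the entries
of `raws` are. -/
lemma exists_mem_raws {A : Type*} [L.Structure A] {d N : ℕ} (a : Fin (k + 1) → A) (hd : 0 < d)
    (hN : (ball L d a).encard ≤ (N : ℕ∞)) :
    ∃ (S : FinStr L) (b : Fin (k + 1) → S.Carrier), S.raw b ∈ raws (arities L) (k + 1) N ∧
      SphereIso L d a b ∧ ball L d b = Set.univ := by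
  classical
  have hfin : (ball L d a).Finite := Set.finite_of_encard_le_coe hN
  obtain ⟨s, hs⟩ : ∃ s, (ball L d a).ncard = s + 1 :=
    Nat.exists_eq_succ_of_ne_zero (by
      rw [Ne, Set.ncard_eq_zero hfin]
      exact Set.Nonempty.ne_empty ⟨_, mem_ball_center L hd a 0⟩)
  have hsN : s + 1 ≤ N := by
    rw [← hs]
    have := hfin.cast_ncard_eq
    rw [← this] at hN
    exact_mod_cast hN
  obtain ⟨g, hg⟩ : ∃ g : A → ℕ, Set.BijOn g (ball L d a) {i | i < s + 1} := by
    have : (ball L d a).encard = ({i | i < s + 1} : Set ℕ).encard := by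
      have he : {i | i < s + 1} = (Finset.range (s + 1) : Set ℕ) := by ext; simp
      rw [← hfin.cast_ncard_eq, hs, he, Set.encard_coe_eq_coe_finsetCard, Finset.card_range]
    exact hfin.exists_bijOn_of_encard_eq this
  let P : RawFact → Prop := fun x => ∃ (l : ℕ) (R : L.Relations l) (t : Fin l → A),
    (∀ i, t i ∈ ball L d a) ∧ Language.Structure.RelMap R t ∧
      x = (relIdx ⟨l, R⟩, List.ofFn fun i => g (t i))
  -- Reversed, because `sublistsRev` lists the sublists backwards.
  let F := ((allFacts (arities L) (s + 1)).filter fun x => decide (P x)).reverse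
  have hmem : ((s + 1, List.ofFn (fun i => g (a i)), F) : Raw) ∈ raws (arities L) (k + 1) N := by
    simp only [raws, List.mem_flatMap, List.mem_map, List.mem_range]
    refine ⟨s, hsN, _, mem_tuples.2 ⟨List.length_ofFn, fun y hy => ?_⟩, F, mem_sublistsRev.2 ?_, rfl⟩
    · obtain ⟨i, rfl⟩ := List.mem_ofFn.1 hy
      exact hg.mapsTo (mem_ball_center L hd a i)
    · rw [List.reverse_reverse]
      exact List.filter_sublist
  obtain ⟨S, b, hSb, -⟩ := exists_of_mem_raws hmem
  rw [← hSb] at hmem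
  have e1 : S.size = s + 1 := congrArg Prod.fst hSb
  have e2 : ∀ i, S.val (b i) = g (a i) := fun i =>
    congrFun (List.ofFn_injective (congrArg (fun r => r.2.1) hSb)) i
  have e3 : S.rawFacts = F := congrArg (fun r => r.2.2) hSb
  obtain ⟨h, hh⟩ : ∃ h : A → S.Carrier, ∀ x ∈ ball L d a, S.val (h x) = g x := by
    have : ∀ x, ∃ y : S.Carrier, x ∈ ball L d a → S.val y = g x := fun x => by
      by_cases hx : x ∈ ball L d a
      · obtain ⟨y, hy⟩ := S.exists_val (i := g x) (by rw [e1]; exact hg.mapsTo hx)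
        exact ⟨y, fun _ => hy⟩
      · exact ⟨b 0, fun h => absurd h hx⟩
    exact Classical.axiomOfChoice this
  have hP : PIso L h (ball L d a) Set.univ := by
    refine ⟨⟨fun _ _ => trivial, fun x hx y hy hxy => ?_, fun y _ => ?_⟩, fun l R t ht => ?_⟩
    · exact hg.injOn hx hy (by rw [← hh x hx, ← hh y hy, hxy])
    · obtain ⟨x, hx, he⟩ := hg.surjOn (show S.val y ∈ {i | i < s + 1} from e1 ▸ S.val_lt y)
      exact ⟨x, hx, S.val_injective (by rw [hh x hx, he])⟩
    · have hval : (List.ofFn fun i => S.val (h (t i))) = List.ofFn fun i => g (t i) :=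
        congrArg _ (funext fun i => hh _ (ht i))
      rw [S.relMap_iff, e3, hval, List.mem_reverse, List.mem_filter, decide_eq_true_eq]
      constructor
      · intro hR
        refine ⟨mem_allFacts.2 ⟨⟨⟨l, R⟩, fun i => ⟨g (t i), hg.mapsTo (ht i)⟩⟩, rfl⟩,
          l, R, t, ht, hR, rfl⟩
      · rintro ⟨-, m, R', t', ht', hR', he⟩
        have h3 := relIdx_injective (Prod.ext_iff.1 he).1
        obtain rfl : l = m := congrArg Sigma.fst h3
        obtain rfl : R = R' := eq_of_heq (Sigma.mk.inj h3).2
        obtain rfl : t = t' := funext fun i => hg.injOn (ht i) (ht' i)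
          (congrFun (List.ofFn_injective (Prod.ext_iff.1 he).2) i)
        exact hR'
  have hb : (fun i => h (a i)) = b := funext fun i => S.val_injective (by
    rw [hh _ (mem_ball_center L hd a i), e2])
  -- The copy consists of the image of the ball of `a`, which is the ball of `b`; so the copy is a
  -- sphere.
  have him := hP.image_ball (r := d) (a := a) subset_rfl (Set.subset_univ _)
  rw [hP.bij.image_eq, hb] at him
  exact ⟨S, b, hmem, ⟨h, him ▸ hP, congrFun hb⟩, him.symm⟩

end Raw

/-! ### The decisions about a pair of spheres -/

/-- Replaces the centres. -/
def withC (r : Raw) (cs : List ℕ) : Raw := (r.1, cs, r.2.2)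

/-- Omits the last but one centre. -/
def skipCentre (r : Raw) : Raw := withC r (r.2.1.dropLast.dropLast ++ [r.2.1.getLastD 0])

/-- Whether `y`, together with the centres of `τ`, realises `σ`. -/
def realises (e : ℕ) (τ σ : Raw) (y : ℕ) : Bool := isoCheck e σ (withC τ (τ.2.1 ++ [y]))

/-- Whether `y`, together with all centres of `τ` but the last, realises `σ` without the last
but one centre. -/
def realisesSkip (e : ℕ) (τ σ : Raw) (y : ℕ) : Bool :=
  isoCheck e (skipCentre σ) (withC τ (τ.2.1.dropLast ++ [y]))

/-- The elements of `τ` that are close to the centres. -/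
def nearList (e : ℕ) (τ : Raw) : List ℕ := ballList (e + e) τ.1 τ.2.2 τ.2.1

/-- Whether the last centre of `σ` is far from the others, which look like those of `τ`. -/
def isFar (e : ℕ) (τ σ : Raw) : Bool :=
  (ballList e σ.1 σ.2.2 [σ.2.1.getLastD 0]).all
    (fun x => !decide (x ∈ ballList (e + 1) σ.1 σ.2.2 σ.2.1.dropLast)) &&
  isoCheck e (withC σ σ.2.1.dropLast) τ

/-- The number of realisations of `σ` close to the centres of `τ`. -/
def countNear (e : ℕ) (τ σ : Raw) : ℕ := ((nearList e τ).filter fun y => realises e τ σ y).length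

/-- The number of elements that realise `σ` only when the last but one centre is omitted. -/
def shift (e : ℕ) (τ σ : Raw) : ℕ :=
  ((nearList e τ).filter fun y => realisesSkip e τ σ y && !realises e τ σ y).length

/-- The sphere around the centres of `σ` without the last but one. -/
def reduct (ar : List (ℕ × ℕ)) (k N e : ℕ) (τ σ : Raw) : Raw :=
  findD (fun r => isoCheck e (skipCentre σ) r && coversAll e r) τ (raws ar k N)

/-! ### Cost of the decisions about two spheres -/

section Computation
variable {Γ : Type*} [Enc Γ] {c : Ctx Γ} {e : Γ → ℕ} {τ σ : Γ → Raw}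

lemma Cmp.withC {r : Γ → Raw} {cs : Γ → List ℕ} (hr : Cmp c r) (hc : Cmp c cs) :
    Cmp c fun γ => withC (r γ) (cs γ) := hr.fst.pair (hc.pair hr.snd.snd)

lemma Cmp.skipCentre (hσ : Cmp c σ) : Cmp c fun γ => skipCentre (σ γ) :=
  hσ.withC (hσ.snd.fst.dropLast.dropLast.append (hσ.snd.fst.getLastD.cons (Cmp.const [])))

lemma Cmp.realises {y : Γ → ℕ} (he : Cmp c e) (hτ : Cmp c τ) (hσ : Cmp c σ) (hy : Cmp c y)
    (hp : PB c fun γ => (τ γ).1 ^ (σ γ).1) : Cmp c fun γ => realises (e γ) (τ γ) (σ γ) (y γ) :=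
  Cmp.isoCheck he hσ (hτ.withC (hτ.snd.fst.append (hy.cons (Cmp.const [])))) hp

lemma Cmp.realisesSkip {y : Γ → ℕ} (he : Cmp c e) (hτ : Cmp c τ) (hσ : Cmp c σ) (hy : Cmp c y)
    (hp : PB c fun γ => (τ γ).1 ^ (σ γ).1) :
    Cmp c fun γ => realisesSkip (e γ) (τ γ) (σ γ) (y γ) :=
  Cmp.isoCheck he hσ.skipCentre
    (hτ.withC (hτ.snd.fst.dropLast.append (hy.cons (Cmp.const [])))) hp

lemma Cmp.nearList (he : Cmp c e) (hτ : Cmp c τ) : Cmp c fun γ => nearList (e γ) (τ γ) :=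
  Cmp.ballList (he.add he) hτ.fst hτ.snd.snd hτ.snd.fst

lemma Cmp.isFar (he : Cmp c e) (hτ : Cmp c τ) (hσ : Cmp c σ)
    (hp : PB c fun γ => (τ γ).1 ^ (σ γ).1) : Cmp c fun γ => isFar (e γ) (τ γ) (σ γ) :=
  (Cmp.all (g := fun γ x => !decide (x ∈
      HanfNF.ballList (e γ + 1) (σ γ).1 (σ γ).2.2 (σ γ).2.1.dropLast))
    (Cmp.ballList he hσ.fst hσ.snd.snd (hσ.snd.fst.getLastD.cons (Cmp.const [])))
    ((Cmp.ballList he.succ hσ.fst hσ.snd.snd hσ.snd.fst.dropLast).weaken.mem Cmp.var).not).and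
    (Cmp.isoCheck he (hσ.withC hσ.snd.fst.dropLast) hτ hp)

lemma Cmp.countNear (he : Cmp c e) (hτ : Cmp c τ) (hσ : Cmp c σ)
    (hp : PB c fun γ => (τ γ).1 ^ (σ γ).1) : Cmp c fun γ => countNear (e γ) (τ γ) (σ γ) :=
  (Cmp.filter (g := fun γ y => HanfNF.realises (e γ) (τ γ) (σ γ) y) (he.nearList hτ)
    (Cmp.realises he.weaken hτ.weaken hσ.weaken Cmp.var hp.weaken)).length

lemma Cmp.shift (he : Cmp c e) (hτ : Cmp c τ) (hσ : Cmp c σ)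
    (hp : PB c fun γ => (τ γ).1 ^ (σ γ).1) : Cmp c fun γ => shift (e γ) (τ γ) (σ γ) :=
  (Cmp.filter (g := fun γ y => HanfNF.realisesSkip (e γ) (τ γ) (σ γ) y &&
      !HanfNF.realises (e γ) (τ γ) (σ γ) y) (he.nearList hτ)
    ((Cmp.realisesSkip he.weaken hτ.weaken hσ.weaken Cmp.var hp.weaken).and
      (Cmp.realises he.weaken hτ.weaken hσ.weaken Cmp.var hp.weaken).not)).length

lemma size_le_of_mem_raws {ar : List (ℕ × ℕ)} {k N : ℕ} {r : Raw} (h : r ∈ raws ar k N) :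
    r.1 ≤ N := by
  simp only [raws, List.mem_flatMap, List.mem_map, List.mem_range] at h
  obtain ⟨s, hs, cs, -, F, -, rfl⟩ := h
  exact hs

lemma Cmp.reduct (ar : List (ℕ × ℕ)) {k N : Γ → ℕ} (hk : Cmp c k) (hN : Cmp c N) (he : Cmp c e)
    (hτ : Cmp c τ) (hσ : Cmp c σ) (hp : PB c fun γ => N γ ^ (σ γ).1)
    (h1 : PB c fun γ => N γ ^ k γ) (h2 : PB c fun γ => 2 ^ (HanfNF.allFacts ar (N γ)).length) :
    Cmp c fun γ => reduct ar (k γ) (N γ) (e γ) (τ γ) (σ γ) :=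
  Cmp.findD (P := fun γ r => HanfNF.isoCheck (e γ) (HanfNF.skipCentre (σ γ)) r &&
      HanfNF.coversAll (e γ) r)
    (Cmp.raws ar hk hN h1 h2) hτ
    ((Cmp.isoCheck he.weaken hσ.skipCentre.weaken Cmp.var (hp.weaken.mono fun _ h =>
        Nat.pow_le_pow_left (size_le_of_mem_raws h.2) _)).and
      (Cmp.coversAll he.weaken Cmp.var))

end Computation

/-! ### Their meaning -/

section Meaning
variable {L : FirstOrder.Language.{u, v}} [Finite (Σ l, L.Relations l)] [L.IsRelational]
variable {S T : FinStr L} {r τ σ : Raw} {k n : ℕ} {a : Fin k → S.Carrier}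

lemma Rep.withC (h : Rep r S a) {l : ℕ} (b : Fin l → S.Carrier) {cs : List ℕ}
    (hc : cs = List.ofFn fun i => S.val (b i)) : Rep (withC r cs) S b :=
  ⟨h.size, hc, h.facts⟩

lemma ofFn_snoc {α β : Type*} (f : α → β) (a : Fin k → α) (y : α) :
    (List.ofFn fun i => f ((Fin.snoc a y : Fin (k + 1) → α) i)) =
      (List.ofFn fun i => f (a i)) ++ [f y] := by
  rw [List.ofFn_succ_last]
  simp

lemma getLastD_append (l : List ℕ) (x : ℕ) : (l ++ [x]).getLastD 0 = x := by
  rw [List.getLastD_eq_getLast?, List.getLast?_concat]; rfl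

lemma dropLast_ofFn {α β : Type*} (f : α → β) (a : Fin (k + 1) → α) :
    (List.ofFn fun i => f (a i)).dropLast = List.ofFn fun i => f ((Fin.init a : Fin k → α) i) := by
  conv_lhs => rw [← Fin.snoc_init_self a, ofFn_snoc]
  simp

/-- A walk can be shortened to a path, whose length is less than the number of elements, so balls
stop growing at the radius `S.size`. This permits the truncation of radii at `N`. -/
lemma ball_eq_of_size_le {d d' : ℕ} (a : Fin k → S.Carrier) (hd : S.size ≤ d) (hd' : S.size ≤ d') :
    ball L d a = ball L d' a := by
  have key : ∀ {d d' : ℕ}, S.size ≤ d' → ball L d a ⊆ ball L d' a := by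
    rintro d d' hd' x ⟨i, hi⟩
    refine ⟨i, ?_⟩
    obtain ⟨p, hp⟩ := SimpleGraph.exists_walk_of_edist_ne_top (hi.trans_le le_top).ne
    classical
    have : Finite S.Carrier := inferInstanceAs (Finite (Fin S.size))
    have : Fintype S.Carrier := Fintype.ofFinite _
    have h1 : p.bypass.length < Fintype.card S.Carrier := p.bypass_isPath.length_lt
    have h2 : Fintype.card S.Carrier = S.size := by
      rw [← Nat.card_eq_fintype_card]
      exact Nat.card_fin S.size
    refine (SimpleGraph.Walk.edist_le p.bypass).trans_lt ?_
    exact_mod_cast (by omega : p.bypass.length < d')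
  exact (key hd').antisymm (key hd)

variable {e N : ℕ}

lemma ball_min (hS : S.size ≤ N) (a : Fin k → S.Carrier) : ball L (min e N) a = ball L e a := by
  rcases le_total e N with h | h
  · rw [min_eq_left h]
  · exact ball_eq_of_size_le a (by omega) (by omega)

lemma ball_min_add_one (hS : S.size ≤ N) (a : Fin k → S.Carrier) :
    ball L (min e N + 1) a = ball L (e + 1) a := by
  rcases le_total e N with h | h
  · rw [min_eq_left h]
  · exact ball_eq_of_size_le a (by omega) (by omega)

lemma ball_min_add_min (hS : S.size ≤ N) (a : Fin k → S.Carrier) :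
    ball L (min e N + min e N) a = ball L (2 * e) a := by
  rcases le_total e N with h | h
  · rw [min_eq_left h, two_mul]
  · exact ball_eq_of_size_le a (by omega) (by omega)

/-- The machine works with `min e N`, since `e` itself may be too large for the measure; the meaning
is that of the radius `e`. -/
lemma isoCheck_min {r' : Raw} {b : Fin k → T.Carrier} (h : Rep r S a) (h' : Rep r' T b)
    (hS : S.size ≤ N) (hT : T.size ≤ N) :
    isoCheck (min e N) r r' = true ↔ SphereIso L e a b := by
  rw [isoCheck_iff h h', SphereIso, SphereIso]
  simp only [SphereMap, ball_min hS, ball_min hT]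

lemma Rep.length_filter (h : Rep r S a) (p : ℕ → Bool) :
    (((ballList e r.1 r.2.2 r.2.1).filter p).length : ℕ∞) =
      {y | y ∈ ball L e a ∧ p (S.val y) = true}.encard := by
  rw [← S.val_injective.injOn.encard_image]
  have : S.val '' {y | y ∈ ball L e a ∧ p (S.val y) = true} =
      ((ballList e r.1 r.2.2 r.2.1).filter p).toFinset := by
    ext x
    simp only [Set.mem_image, List.coe_toFinset, List.mem_filter]
    constructor
    · rintro ⟨y, ⟨h1, h2⟩, rfl⟩
      exact ⟨h.mem_ballList.2 h1, h2⟩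
    · rintro ⟨h1, h2⟩
      obtain ⟨y, hy, rfl⟩ := h.mem_ballList_iff.1 h1
      exact ⟨y, ⟨hy, h2⟩, rfl⟩
  rw [this, Set.encard_coe_eq_coe_finsetCard,
    List.toFinset_card_of_nodup (nodup_ballList.filter _)]

variable {tc : Fin (n + 1) → T.Carrier} {sc : Fin (n + 1) → S.Carrier} {z : S.Carrier}

lemma Rep.skipCentre (hσ : Rep σ S (Fin.snoc sc z : Fin (n + 2) → S.Carrier)) :
    Rep (skipCentre σ) S (Fin.snoc (Fin.init sc) z : Fin (n + 1) → S.Carrier) := by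
  refine hσ.withC _ ?_
  rw [hσ.center, ofFn_snoc, ofFn_snoc, List.dropLast_concat, dropLast_ofFn, getLastD_append]

lemma realises_iff (hτ : Rep τ T tc) (hσ : Rep σ S (Fin.snoc sc z : Fin (n + 2) → S.Carrier))
    (hS : S.size ≤ N) (hT : T.size ≤ N) (he : 0 < e) (y : T.Carrier) :
    realises (min e N) τ σ (T.val y) = true ↔
      SphereIso L e (Fin.snoc tc y : Fin (n + 2) → T.Carrier)
        (Fin.snoc sc z : Fin (n + 2) → S.Carrier) := by
  have : Nonempty S.Carrier := ⟨z⟩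
  have : Nonempty T.Carrier := ⟨y⟩
  rw [realises, isoCheck_min hσ (hτ.withC (Fin.snoc tc y : Fin (n + 2) → T.Carrier)
    (by rw [hτ.center, ofFn_snoc])) hS hT]
  exact ⟨fun h => h.symm he, fun h => h.symm he⟩

lemma realisesSkip_iff (hτ : Rep τ T tc) (hσ : Rep σ S (Fin.snoc sc z : Fin (n + 2) → S.Carrier))
    (hS : S.size ≤ N) (hT : T.size ≤ N) (he : 0 < e) (y : T.Carrier) :
    realisesSkip (min e N) τ σ (T.val y) = true ↔
      SphereIso L e (Fin.snoc (Fin.init tc) y : Fin (n + 1) → T.Carrier)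
        (Fin.snoc (Fin.init sc) z : Fin (n + 1) → S.Carrier) := by
  have : Nonempty S.Carrier := ⟨z⟩
  have : Nonempty T.Carrier := ⟨y⟩
  rw [realisesSkip, isoCheck_min hσ.skipCentre
    (hτ.withC (Fin.snoc (Fin.init tc) y : Fin (n + 1) → T.Carrier)
    (by rw [hτ.center, ofFn_snoc, dropLast_ofFn])) hS hT]
  exact ⟨fun h => h.symm he, fun h => h.symm he⟩

lemma isFar_iff (hτ : Rep τ T tc) (hσ : Rep σ S (Fin.snoc sc z : Fin (n + 2) → S.Carrier))
    (hS : S.size ≤ N) (hT : T.size ≤ N) (he : 0 < e)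
    (hu : ball L e (Fin.snoc sc z : Fin (n + 2) → S.Carrier) = Set.univ) :
    isFar (min e N) τ σ = true ↔ Far L e sc z ∧ SphereIso L e tc sc := by
  have : Nonempty S.Carrier := ⟨z⟩
  have : Nonempty T.Carrier := ⟨tc 0⟩
  have h1 : Rep (withC σ σ.2.1.dropLast) S sc := hσ.withC _ (by
    rw [hσ.center, ofFn_snoc, List.dropLast_concat])
  have h2 : Rep (withC σ [σ.2.1.getLastD 0]) S ![z] := hσ.withC _ (by
    rw [hσ.center, ofFn_snoc, getLastD_append]; rfl)
  rw [isFar, Bool.and_eq_true, isoCheck_min h1 hτ hS hT, List.all_eq_true,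
    far_iff_of_univ he (by rw [← ball_snoc, hu])]
  refine and_congr ?_ ⟨fun h => h.symm he, fun h => h.symm he⟩
  rw [← ball_min hS, ← ball_min_add_one hS]
  constructor
  · intro H x hx hx'
    have := H _ (h2.mem_ballList.2 hx)
    simp only [Bool.not_eq_true', decide_eq_false_iff_not] at this
    exact this (h1.mem_ballList.2 hx')
  · intro H x hx
    obtain ⟨y, hy, rfl⟩ := h2.mem_ballList_iff.1 hx
    simp only [Bool.not_eq_true', decide_eq_false_iff_not]
    exact fun hy' => H y hy (h1.mem_ballList.1 hy')

lemma countNear_eq (hτ : Rep τ T tc) (hσ : Rep σ S (Fin.snoc sc z : Fin (n + 2) → S.Carrier))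
    (hS : S.size ≤ N) (hT : T.size ≤ N) (he : 0 < e) :
    (countNear (min e N) τ σ : ℕ∞) = {y | y ∈ ball L (2 * e) tc ∧
      SphereIso L e (Fin.snoc tc y : Fin (n + 2) → T.Carrier)
        (Fin.snoc sc z : Fin (n + 2) → S.Carrier)}.encard := by
  rw [countNear, nearList, hτ.length_filter]
  simp only [ball_min_add_min hT, realises_iff hτ hσ hS hT he]

lemma shift_eq (hτ : Rep τ T tc) (hσ : Rep σ S (Fin.snoc sc z : Fin (n + 2) → S.Carrier))
    (hS : S.size ≤ N) (hT : T.size ≤ N) (he : 0 < e) :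
    (shift (min e N) τ σ : ℕ∞) = {y | y ∈ ball L (2 * e) tc ∧
      (SphereIso L e (Fin.snoc (Fin.init tc) y : Fin (n + 1) → T.Carrier)
        (Fin.snoc (Fin.init sc) z : Fin (n + 1) → S.Carrier) ∧
      ¬ SphereIso L e (Fin.snoc tc y : Fin (n + 2) → T.Carrier)
        (Fin.snoc sc z : Fin (n + 2) → S.Carrier))}.encard := by
  rw [shift, nearList, hτ.length_filter]
  simp only [ball_min_add_min hT, Bool.and_eq_true, Bool.not_eq_true',
    realisesSkip_iff hτ hσ hS hT he, ← realises_iff hτ hσ hS hT he, Bool.not_eq_true]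

/-- The sphere of `S` around the remaining centres has at most `N` elements, so a copy of it occurs
in the list that is searched, and the default value `τ` of the search plays no role. -/
lemma exists_reduct (hσ : Rep σ S (Fin.snoc sc z : Fin (n + 2) → S.Carrier))
    (hS : S.size ≤ N) (he : 0 < e) :
    ∃ ρ : Sphere L (n + 1), ρ.radius = e ∧
      ρ.base.raw ρ.center = reduct (arities L) (n + 1) N (min e N) τ σ ∧
      SphereIso L e (Fin.snoc (Fin.init sc) z : Fin (n + 1) → S.Carrier) ρ.center := by
  have hfin : ∀ X : Set S.Carrier, X.encard ≤ (N : ℕ∞) := fun X => by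
    have : (Set.univ : Set S.Carrier).encard = S.size := by
      rw [Set.encard_univ]
      exact (ENat.card_eq_coe_natCard (Fin S.size)).trans (by simp)
    exact (Set.encard_le_encard (Set.subset_univ X)).trans (this ▸ by exact_mod_cast hS)
  obtain ⟨R, b, hR, hiso, hcov⟩ := exists_mem_raws (N := N)
    (Fin.snoc (Fin.init sc) z : Fin (n + 1) → S.Carrier) he
    (hfin (ball L e (Fin.snoc (Fin.init sc) z : Fin (n + 1) → S.Carrier)))
  obtain ⟨h1, h2⟩ := findD_spec
    (fun r => isoCheck (min e N) (skipCentre σ) r && coversAll (min e N) r) τ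
    (raws (arities L) (n + 1) N) ⟨_, hR, by
      have hRN := size_le_of_mem_raws hR
      rw [Bool.and_eq_true, isoCheck_min hσ.skipCentre (R.rep_raw b) hS hRN,
        (R.rep_raw b).coversAll_iff, ball_min hRN]
      exact ⟨hiso, hcov⟩⟩
  obtain ⟨Q, q, hq, hQN⟩ := exists_of_mem_raws h1
  rw [← hq, Bool.and_eq_true, isoCheck_min hσ.skipCentre (Q.rep_raw q) hS hQN,
        (Q.rep_raw q).coversAll_iff, ball_min hQN] at h2
  exact ⟨⟨Q, q, e, he, h2.2⟩, rfl, hq, h2.1⟩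

end Meaning

/-! ### Traversal of formulas -/

/-- The current item of the work list: a subformula to be visited, or a connective whose
arguments have been computed. -/
def itemProg : Prog := .seq (.seq .tl .hd) .hd

/-- The rest of the work list. -/
def restProg : Prog := .seq (.seq .tl .hd) .tl

/-- The stack of values. -/
def valsProg : Prog := .seq .tl .tl

/-- One step of the traversal of a formula, on a state that consists of an environment, a work
list and a stack of values. The programs are used for truth values, Hanf formulas, negations and
binary connectives. -/
def traverseBody (V A Kn Kb : Prog) : Prog :=
  .ite (.seq itemProg .hd)
    (.cons .hd (.cons restProg
      (.ite (.seq itemProg (.seq .hd (.seq .tl (.seq .tl .tl))))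
        (.cons (.seq (.cons (.seq itemProg .hd)
          (.cons (.seq valsProg (.seq .tl .hd)) (.seq valsProg .hd))) Kb)
          (.seq valsProg (.seq .tl .tl)))
        (.cons (.seq (.cons (.seq itemProg .hd) (.seq valsProg .hd)) Kn) (.seq valsProg .tl)))))
    (.ite (.seq itemProg (.seq .tl (.seq .hd (.seq .tl .tl))))
      (.cons .hd (.cons
        (.ite (.seq itemProg (.seq .tl (.seq .hd (.seq .tl (.seq .tl .tl)))))
          (.cons (.cons .nil (.seq itemProg (.seq .tl (.seq .tl .hd))))
            (.cons (.cons .nil (.seq itemProg (.seq .tl (.seq .tl .tl))))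
              (.cons (.cons (.seq itemProg (.seq .tl .hd)) .nil) restProg)))
          (.cons (.cons .nil (.seq itemProg (.seq .tl .tl)))
            (.cons (.cons (.seq itemProg (.seq .tl .hd)) .nil) restProg)))
        valsProg))
      (.cons .hd (.cons restProg (.cons
        (.ite (.seq itemProg (.seq .tl (.seq .hd .tl)))
          (.seq (.cons .hd (.seq itemProg (.seq .tl .tl))) A)
          (.seq (.seq itemProg .tl) V))
        valsProg))))

/-- The traversal of a formula. -/
def traverse (V A Kn Kb : Prog) : Prog :=
  .seq (.cons .hd (.cons (.cons (.cons .nil .tl) .nil) .nil))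
    (.seq (.loop (.seq .tl .hd) (traverseBody V A Kn Kb)) (.seq .tl (.seq .tl .hd)))

section Body
variable (V A Kn Kb : Prog) (env work vals : Val)

lemma eval_item (i : Val) : itemProg.Eval (.node env (.node (.node i work) vals)) i 5 :=
  .seq (.seq (.tl_node _ _) (.hd_node _ _)) (.hd_node _ _)

lemma eval_rest (i : Val) : restProg.Eval (.node env (.node (.node i work) vals)) work 5 :=
  .seq (.seq (.tl_node _ _) (.hd_node _ _)) (.tl_node _ _)

lemma eval_vals : valsProg.Eval (.node env (.node work vals)) vals 3 :=
  .seq (.tl_node _ _) (.tl_node _ _)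

variable {V A Kn Kb}

/-- An item to be visited starts with `nil`, a pending connective with its non-zero tag. The tag of
a visited formula is classified by testing its repeated tails: at least 3 for connectives, at least
4 for binary ones, and otherwise at least 2 for Hanf formulas. -/
lemma body_leaf {φ y : Val} {t tag : ℕ} (htag : tag < 2) (h : V.Eval (.node (.ofNat tag) φ) y t) :
    ∃ s ≤ t + 150, (traverseBody V A Kn Kb).Eval
      (.node env (.node (.node (.node .nil (.node (.ofNat tag) φ)) work) vals))
      (.node env (.node work (.node y vals))) s := by
  have h1 : ∃ u, (Prog.seq Prog.tl Prog.tl).Eval (.ofNat tag) .nil u ∧ u ≤ 10 := by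
    interval_cases tag
    · exact ⟨_, .seq .tl_nil .tl_nil, by omega⟩
    · exact ⟨_, .seq (.tl_node _ _) .tl_nil, by omega⟩
  have h2 : Prog.tl.Eval (.ofNat tag) .nil 1 := by
    interval_cases tag
    · exact .tl_nil
    · exact .tl_node _ _
  obtain ⟨u, h1, hu⟩ := h1
  refine ⟨_, ?_, .ite_false (.seq (eval_item _ _ _ _) (.hd_node _ _))
    (.ite_false (.seq (eval_item _ _ _ _) (.seq (.tl_node _ _) (.seq (.hd_node _ _) h1)))
      (.cons (.hd_node _ _) (.cons (eval_rest _ _ _ _) (.cons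
        (.ite_false (.seq (eval_item _ _ _ _) (.seq (.tl_node _ _) (.seq (.hd_node _ _) h2)))
          (.seq (.seq (eval_item _ _ _ _) (.tl_node _ _)) h)) (eval_vals _ _ _)))))⟩
  omega

lemma body_atom {φ y : Val} {t : ℕ} (h : A.Eval (.node env φ) y t) :
    ∃ s ≤ t + 150, (traverseBody V A Kn Kb).Eval
      (.node env (.node (.node (.node .nil (.node (.ofNat 2) φ)) work) vals))
      (.node env (.node work (.node y vals))) s := by
  refine ⟨_, ?_, .ite_false (.seq (eval_item _ _ _ _) (.hd_node _ _))
    (.ite_false (.seq (eval_item _ _ _ _) (.seq (.tl_node _ _) (.seq (.hd_node _ _)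
      (.seq (.tl_node _ _) (.tl_node _ _)))))
      (.cons (.hd_node _ _) (.cons (eval_rest _ _ _ _) (.cons
        (.ite_true (.seq (eval_item _ _ _ _) (.seq (.tl_node _ _)
          (.seq (.hd_node _ _) (.tl_node _ _))))
          (.seq (.cons (.hd_node _ _) (.seq (eval_item _ _ _ _)
            (.seq (.tl_node _ _) (.tl_node _ _)))) h)) (eval_vals _ _ _)))))⟩
  omega

lemma body_neg (φ : Val) :
    ∃ s ≤ 150, (traverseBody V A Kn Kb).Eval
      (.node env (.node (.node (.node .nil (.node (.ofNat 3) φ)) work) vals))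
      (.node env (.node (.node (.node .nil φ) (.node (.node (.ofNat 3) .nil) work)) vals)) s := by
  refine ⟨_, ?_, .ite_false (.seq (eval_item _ _ _ _) (.hd_node _ _))
    (.ite_true (.seq (eval_item _ _ _ _) (.seq (.tl_node _ _) (.seq (.hd_node _ _)
      (.seq (.tl_node _ _) (.tl_node _ _)))))
      (.cons (.hd_node _ _) (.cons
        (.ite_false (.seq (eval_item _ _ _ _) (.seq (.tl_node _ _) (.seq (.hd_node _ _)
          (.seq (.tl_node _ _) (.seq (.tl_node _ _) (.tl_node _ _))))))
        (.cons (.cons (.nil _) (.seq (eval_item _ _ _ _) (.seq (.tl_node _ _) (.tl_node _ _))))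
          (.cons (.cons (.seq (eval_item _ _ _ _) (.seq (.tl_node _ _) (.hd_node _ _))) (.nil _))
            (eval_rest _ _ _ _)))) (eval_vals _ _ _))))⟩
  omega

lemma body_binary (φ ψ : Val) (tag : ℕ) :
    ∃ s ≤ 150, (traverseBody V A Kn Kb).Eval
      (.node env (.node (.node (.node .nil (.node (.ofNat (tag + 4)) (.node φ ψ))) work) vals))
      (.node env (.node (.node (.node .nil φ) (.node (.node .nil ψ)
        (.node (.node (.ofNat (tag + 4)) .nil) work))) vals)) s := by
  refine ⟨_, ?_, .ite_false (.seq (eval_item _ _ _ _) (.hd_node _ _))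
    (.ite_true (.seq (eval_item _ _ _ _) (.seq (.tl_node _ _) (.seq (.hd_node _ _)
      (.seq (.tl_node _ _) (.tl_node _ _)))))
      (.cons (.hd_node _ _) (.cons
        (.ite_true (.seq (eval_item _ _ _ _) (.seq (.tl_node _ _) (.seq (.hd_node _ _)
          (.seq (.tl_node _ _) (.seq (.tl_node _ _) (.tl_node _ _))))))
        (.cons (.cons (.nil _) (.seq (eval_item _ _ _ _) (.seq (.tl_node _ _)
            (.seq (.tl_node _ _) (.hd_node _ _)))))
          (.cons (.cons (.nil _) (.seq (eval_item _ _ _ _) (.seq (.tl_node _ _)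
            (.seq (.tl_node _ _) (.tl_node _ _)))))
          (.cons (.cons (.seq (eval_item _ _ _ _) (.seq (.tl_node _ _) (.hd_node _ _))) (.nil _))
            (eval_rest _ _ _ _))))) (eval_vals _ _ _))))⟩
  omega

lemma body_neg_done {x y : Val} {t : ℕ} (h : Kn.Eval (.node (.ofNat 3) x) y t) :
    ∃ s ≤ t + 150, (traverseBody V A Kn Kb).Eval
      (.node env (.node (.node (.node (.ofNat 3) .nil) work) (.node x vals)))
      (.node env (.node work (.node y vals))) s := by
  refine ⟨_, ?_, .ite_true (.seq (eval_item _ _ _ _) (.hd_node _ _))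
    (.cons (.hd_node _ _) (.cons (eval_rest _ _ _ _)
      (.ite_false (.seq (eval_item _ _ _ _) (.seq (.hd_node _ _) (.seq (.tl_node _ _)
        (.seq (.tl_node _ _) (.tl_node _ _)))))
        (.cons (.seq (.cons (.seq (eval_item _ _ _ _) (.hd_node _ _))
          (.seq (eval_vals _ _ _) (.hd_node _ _))) h) (.seq (eval_vals _ _ _) (.tl_node _ _))))))⟩
  omega

/-- The value of the second argument was pushed last and is on top of the stack. -/
lemma body_binary_done {x x' y : Val} {t tag : ℕ}
    (h : Kb.Eval (.node (.ofNat (tag + 4)) (.node x x')) y t) :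
    ∃ s ≤ t + 150, (traverseBody V A Kn Kb).Eval
      (.node env (.node (.node (.node (.ofNat (tag + 4)) .nil) work) (.node x' (.node x vals))))
      (.node env (.node work (.node y vals))) s := by
  refine ⟨_, ?_, .ite_true (.seq (eval_item _ _ _ _) (.hd_node _ _))
    (.cons (.hd_node _ _) (.cons (eval_rest _ _ _ _)
      (.ite_true (.seq (eval_item _ _ _ _) (.seq (.hd_node _ _) (.seq (.tl_node _ _)
        (.seq (.tl_node _ _) (.tl_node _ _)))))
        (.cons (.seq (.cons (.seq (eval_item _ _ _ _) (.hd_node _ _))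
          (.cons (.seq (eval_vals _ _ _) (.seq (.tl_node _ _) (.hd_node _ _)))
            (.seq (eval_vals _ _ _) (.hd_node _ _)))) h)
          (.seq (eval_vals _ _ _) (.seq (.tl_node _ _) (.tl_node _ _)))))))⟩
  omega

end Body

section Traverse
variable {L : FirstOrder.Language.{u, v}} [L.IsRelational] [Finite (Σ l, L.Relations l)] {n : ℕ}
variable {V A Kn Kb : Prog} {env : Val} {val : HNF L n → Val} {tm : HNF L n → ℕ}

/-- The traversal computes a function on formulas that is defined by recursion. -/
lemma eval_traverse
    (hv : ∃ t ≤ tm .verum, V.Eval (HNF.verum : HNF L n).encode (val .verum) t)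
    (hf : ∃ t ≤ tm .falsum, V.Eval (HNF.falsum : HNF L n).encode (val .falsum) t)
    (ha : ∀ m τ, ∃ t ≤ tm (.hanf m τ),
      A.Eval (.node env (.node (.ofNat m) τ.encode)) (val (.hanf m τ)) t)
    (hn : ∀ φ, ∃ t, tm φ + t ≤ tm (.neg φ) ∧ Kn.Eval (.node (.ofNat 3) (val φ)) (val (.neg φ)) t)
    (hc : ∀ φ ψ, ∃ t, tm φ + tm ψ + t ≤ tm (.conj φ ψ) ∧
      Kb.Eval (.node (.ofNat 4) (.node (val φ) (val ψ))) (val (.conj φ ψ)) t)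
    (hd : ∀ φ ψ, ∃ t, tm φ + tm ψ + t ≤ tm (.disj φ ψ) ∧
      Kb.Eval (.node (.ofNat 5) (.node (val φ) (val ψ))) (val (.disj φ ψ)) t)
    (φ : HNF L n) : ∃ t ≤ tm φ + 400 * φ.length,
      (traverse V A Kn Kb).Eval (.node env φ.encode) (val φ) t := by
  -- In continuation form: a run that starts with the value of `φ` on the stack extends to a run
  -- that still has `φ` on the work list. The induction then needs to know nothing about the rest of
  -- the work list.
  have key : ∀ (φ : HNF L n) (work vals y : Val) (t : ℕ),
      (Prog.loop (.seq .tl .hd) (traverseBody V A Kn Kb)).Eval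
        (.node env (.node work (.node (val φ) vals))) y t →
      ∃ s ≤ t + tm φ + 350 * φ.length,
        (Prog.loop (.seq .tl .hd) (traverseBody V A Kn Kb)).Eval
        (.node env (.node (.node (.node .nil φ.encode) work) vals)) y s := by
    intro φ
    induction φ with
    | verum =>
      intro work vals y t h
      obtain ⟨t', ht', h'⟩ := hv
      obtain ⟨s, hs, e⟩ := body_leaf (A := A) (Kn := Kn) (Kb := Kb) env work vals (by omega) h'
      exact ⟨_, by simp only [HNF.length]; omega,
        .loop_step (.seq (.tl_node _ _) (.hd_node _ _)) e h⟩
    | falsum =>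
      intro work vals y t h
      obtain ⟨t', ht', h'⟩ := hf
      obtain ⟨s, hs, e⟩ := body_leaf (A := A) (Kn := Kn) (Kb := Kb) env work vals (by omega) h'
      exact ⟨_, by simp only [HNF.length]; omega,
        .loop_step (.seq (.tl_node _ _) (.hd_node _ _)) e h⟩
    | hanf m τ =>
      intro work vals y t h
      obtain ⟨t', ht', h'⟩ := ha m τ
      obtain ⟨s, hs, e⟩ := body_atom (V := V) (Kn := Kn) (Kb := Kb) env work vals h'
      exact ⟨_, by simp only [HNF.length]; omega,
        .loop_step (.seq (.tl_node _ _) (.hd_node _ _)) e h⟩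
    | neg φ ih =>
      intro work vals y t h
      obtain ⟨t', ht', h'⟩ := hn φ
      obtain ⟨s, hs, e⟩ := body_neg_done (V := V) (A := A) (Kb := Kb) env work vals h'
      obtain ⟨s₁, hs₁, e₁⟩ := ih (.node (.node (.ofNat 3) .nil) work) vals y _
        (.loop_step (.seq (.tl_node _ _) (.hd_node _ _)) e h)
      obtain ⟨s₂, hs₂, e₂⟩ := body_neg (V := V) (A := A) (Kn := Kn) (Kb := Kb) env work vals φ.encode
      exact ⟨_, by simp only [HNF.length]; omega,
        .loop_step (.seq (.tl_node _ _) (.hd_node _ _)) e₂ e₁⟩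
    | conj φ ψ ih₁ ih₂ =>
      intro work vals y t h
      obtain ⟨t', ht', h'⟩ := hc φ ψ
      obtain ⟨s, hs, e⟩ := body_binary_done (V := V) (A := A) (Kn := Kn) env work vals (tag := 0) h'
      obtain ⟨s₂, hs₂, e₂⟩ := ih₂ (.node (.node (.ofNat 4) .nil) work) (.node (val φ) vals) y _
        (.loop_step (.seq (.tl_node _ _) (.hd_node _ _)) e h)
      obtain ⟨s₁, hs₁, e₁⟩ := ih₁ _ _ y _ e₂
      obtain ⟨s₃, hs₃, e₃⟩ := body_binary (V := V) (A := A) (Kn := Kn) (Kb := Kb) env work vals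
        φ.encode ψ.encode 0
      exact ⟨_, by simp only [HNF.length]; omega,
        .loop_step (.seq (.tl_node _ _) (.hd_node _ _)) e₃ e₁⟩
    | disj φ ψ ih₁ ih₂ =>
      intro work vals y t h
      obtain ⟨t', ht', h'⟩ := hd φ ψ
      obtain ⟨s, hs, e⟩ := body_binary_done (V := V) (A := A) (Kn := Kn) env work vals (tag := 1) h'
      obtain ⟨s₂, hs₂, e₂⟩ := ih₂ (.node (.node (.ofNat 5) .nil) work) (.node (val φ) vals) y _
        (.loop_step (.seq (.tl_node _ _) (.hd_node _ _)) e h)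
      obtain ⟨s₁, hs₁, e₁⟩ := ih₁ _ _ y _ e₂
      obtain ⟨s₃, hs₃, e₃⟩ := body_binary (V := V) (A := A) (Kn := Kn) (Kb := Kb) env work vals
        φ.encode ψ.encode 1
      exact ⟨_, by simp only [HNF.length]; omega,
        .loop_step (.seq (.tl_node _ _) (.hd_node _ _)) e₃ e₁⟩
  obtain ⟨s, hs, e⟩ := key φ .nil .nil _ _ (.loop_exit (.seq (.tl_node _ _) (.hd_node _ _)))
  have hl : 1 ≤ φ.length := by cases φ <;> simp [HNF.length]
  refine ⟨_, ?_, .seq (.cons (.hd_node _ _) (.cons (.cons (.cons (.nil _) (.tl_node _ _)) (.nil _))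
    (.nil _))) (.seq e (.seq (.tl_node _ _) (.seq (.tl_node _ _) (.hd_node _ _))))⟩
  omega

/-! ### The largest radius, in linear time -/

/-- The larger of two numbers. -/
def maxProg : Prog :=
  .seq (.cons .id .id) (.seq
    (.loop (.ite (.seq .hd .hd) (.seq .hd .tl) .nil)
      (.cons (.cons (.seq .hd (.seq .hd .tl)) (.seq .hd (.seq .tl .tl))) .tl))
    (.ite (.seq .hd .hd) (.seq .tl .hd) (.seq .tl .tl)))

/-- Both numbers are counted down until one vanishes, so the time is governed by the minimum. With a
bound by the maximum, finding the largest radius in a formula could take quadratic time. -/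
lemma eval_maxProg (a b : ℕ) : ∃ t ≤ 40 * min a b + 40,
    maxProg.Eval (.node (.ofNat a) (.ofNat b)) (.ofNat (max a b)) t := by
  have key : ∀ (a b : ℕ) (x : Val), ∃ t ≤ 40 * min a b + 20,
      (Prog.loop (.ite (.seq .hd .hd) (.seq .hd .tl) .nil)
        (.cons (.cons (.seq .hd (.seq .hd .tl)) (.seq .hd (.seq .tl .tl))) .tl)).Eval
      (.node (.node (.ofNat a) (.ofNat b)) x) (.node (.node (.ofNat (a - b)) (.ofNat (b - a))) x) t := by
    intro a
    induction a with
    | zero =>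
      intro b x
      rw [Nat.zero_sub, Nat.sub_zero]
      refine ⟨_, ?_, .loop_exit (.ite_false (.seq (.hd_node _ _) (.hd_node _ _)) (.nil _))⟩
      omega
    | succ a ih =>
      intro b x
      cases b with
      | zero =>
        rw [Nat.sub_zero, Nat.zero_sub]
        refine ⟨_, ?_, .loop_exit (.ite_true (.seq (.hd_node _ _) (.hd_node _ _))
          (.seq (.hd_node _ _) (.tl_node _ _)))⟩
        omega
      | succ b =>
        obtain ⟨t, ht, e⟩ := ih b x
        rw [Nat.succ_sub_succ, Nat.succ_sub_succ]
        exact ⟨_, by omega, .loop_step (.ite_true (.seq (.hd_node _ _) (.hd_node _ _))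
          (.seq (.hd_node _ _) (.tl_node _ _)))
          (.cons (.cons (.seq (.hd_node _ _) (.seq (.hd_node _ _) (.tl_node _ _)))
            (.seq (.hd_node _ _) (.seq (.tl_node _ _) (.tl_node _ _)))) (.tl_node _ _)) e⟩
  obtain ⟨t, ht, e⟩ := key a b (.node (.ofNat a) (.ofNat b))
  rcases le_or_gt a b with h | h
  · rw [max_eq_right h]
    rw [show a - b = 0 by omega] at e
    exact ⟨_, by omega, .seq (.cons (.id _) (.id _)) (.seq e
      (.ite_false (.seq (.hd_node _ _) (.hd_node _ _)) (.seq (.tl_node _ _) (.tl_node _ _))))⟩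
  · rw [max_eq_left h.le]
    obtain ⟨c, hc⟩ : ∃ c, a - b = c + 1 := ⟨a - b - 1, by omega⟩
    rw [hc] at e
    exact ⟨_, by omega, .seq (.cons (.id _) (.id _)) (.seq e
      (.ite_true (.seq (.hd_node _ _) (.hd_node _ _)) (.seq (.tl_node _ _) (.hd_node _ _))))⟩

/-- The program that finds the largest radius. -/
def radiusProg : Prog := traverse .nil (.seq .tl (.seq .tl .hd)) .tl (.seq .tl maxProg)

omit [Finite (Σ l, L.Relations l)] in
lemma maxRadius_le_length (φ : HNF L n) : φ.maxRadius ≤ φ.length := by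
  induction φ with
  | hanf m τ => simp only [HNF.maxRadius, HNF.length, Sphere.length]; omega
  | _ => simp only [HNF.maxRadius, HNF.length]; omega

omit [Finite (Σ l, L.Relations l)] in
lemma one_le_length (φ : HNF L n) : 1 ≤ φ.length := by cases φ <;> simp [HNF.length]

lemma eval_radiusProg (env : Val) (φ : HNF L n) : ∃ t ≤ 600 * φ.length,
    radiusProg.Eval (.node env φ.encode) (.ofNat φ.maxRadius) t := by
  have := eval_traverse (env := env) (V := .nil) (A := .seq .tl (.seq .tl .hd)) (Kn := .tl)
    (Kb := .seq .tl maxProg) (val := fun φ : HNF L n => .ofNat φ.maxRadius)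
    -- An amortised bound: `min a b = a + b - max a b`, so a comparison is paid for by the drop in
    -- the sum of the radii that are kept. Subtraction does no harm, because the radius is at most
    -- the length.
    (tm := fun φ => 100 * φ.length - 40 * φ.maxRadius)
    ⟨_, by simp [HNF.length, HNF.maxRadius], .nil _⟩
    ⟨_, by simp [HNF.length, HNF.maxRadius], .nil _⟩
    (fun m τ => ⟨_, by
      simp only [HNF.length, HNF.maxRadius, Sphere.length]
      omega, .seq (.tl_node _ _) (.seq (.tl_node _ _) (.hd_node _ _))⟩)
    (fun φ => ⟨_, by
      have := maxRadius_le_length φ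
      simp only [HNF.length, HNF.maxRadius]
      omega, .tl_node _ _⟩)
    (fun φ ψ => by
      obtain ⟨t, ht, e⟩ := eval_maxProg φ.maxRadius ψ.maxRadius
      refine ⟨_, ?_, .seq (.tl_node _ _) e⟩
      have := maxRadius_le_length φ
      have := maxRadius_le_length ψ
      simp only [HNF.length, HNF.maxRadius]
      omega)
    (fun φ ψ => by
      obtain ⟨t, ht, e⟩ := eval_maxProg φ.maxRadius ψ.maxRadius
      refine ⟨_, ?_, .seq (.tl_node _ _) e⟩
      have := maxRadius_le_length φ
      have := maxRadius_le_length ψ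
      simp only [HNF.length, HNF.maxRadius]
      omega) φ
  obtain ⟨t, ht, e⟩ := this
  exact ⟨t, by omega, e⟩

end Traverse

/-! ### The measure -/

/-- The exponent in the measure. -/
def measExp (ar : List (ℕ × ℕ)) : ℕ := (ar.map fun r => r.2 + 1).sum + 2

/-- The measure of a number of elements. -/
def meas (ar : List (ℕ × ℕ)) (N : ℕ) : ℕ := 2 ^ (N + 2) ^ measExp ar

lemma length_allFacts_le (ar : List (ℕ × ℕ)) (N : ℕ) :
    (allFacts ar N).length ≤ (N + 2) ^ (ar.map fun r => r.2 + 1).sum := by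
  induction ar with
  | nil => simp [allFacts]
  | cons r ar ih =>
    simp only [allFacts, List.length_append, List.length_map, length_tuples, List.map_cons,
      List.sum_cons]
    rw [show r.2 + 1 + (ar.map fun r => r.2 + 1).sum = r.2 + (ar.map fun r => r.2 + 1).sum + 1 by ring,
      pow_succ]
    have h1 : N ^ r.2 ≤ (N + 2) ^ (r.2 + (ar.map fun r => r.2 + 1).sum) :=
      (Nat.pow_le_pow_left (by omega) _).trans (Nat.pow_le_pow_right (by omega) (by omega))
    have h2 : (N + 2) ^ (ar.map fun r => r.2 + 1).sum ≤
        (N + 2) ^ (r.2 + (ar.map fun r => r.2 + 1).sum) :=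
      Nat.pow_le_pow_right (by omega) (by omega)
    nlinarith [Nat.zero_le ((N + 2) ^ (r.2 + (ar.map fun r => r.2 + 1).sum) * N)]

lemma two_pow_length_allFacts_le (ar : List (ℕ × ℕ)) (N : ℕ) :
    2 ^ (allFacts ar N).length ≤ meas ar N :=
  Nat.pow_le_pow_right (by omega) ((length_allFacts_le ar N).trans
    (Nat.pow_le_pow_right (by omega) (Nat.le_add_right _ _)))

lemma sq_le_measExp (ar : List (ℕ × ℕ)) (N : ℕ) : (N + 2) ^ 2 ≤ (N + 2) ^ measExp ar :=
  Nat.pow_le_pow_right (by omega) (Nat.le_add_left _ _)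

lemma pow_le_meas (ar : List (ℕ × ℕ)) {N j : ℕ} (h : j ≤ N) : N ^ j ≤ meas ar N := by
  calc N ^ j ≤ (2 ^ N) ^ j := Nat.pow_le_pow_left Nat.lt_two_pow_self.le j
    _ = 2 ^ (N * j) := (pow_mul _ _ _).symm
    _ ≤ meas ar N := Nat.pow_le_pow_right (by omega) (le_trans (by nlinarith) (sq_le_measExp ar N))

lemma le_meas (ar : List (ℕ × ℕ)) (N : ℕ) : N ≤ meas ar N :=
  Nat.lt_two_pow_self.le.trans
    (Nat.pow_le_pow_right (by omega) (le_trans (by nlinarith) (sq_le_measExp ar N)))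

/-! ### Codes of spheres, and the cost of treating a Hanf formula -/

section Codes
variable {L : FirstOrder.Language.{u, v}} [Finite (Σ l, L.Relations l)] [L.IsRelational] {n : ℕ}

/-- Radius, number of elements, centres and facts of a sphere. -/
abbrev SphereCode := ℕ × ℕ × List ℕ × List RawFact × Unit

/-- A sphere as written on the machine. -/
noncomputable def Sphere.code (σ : Sphere L n) : SphereCode :=
  (σ.radius, σ.base.size, List.ofFn fun i => σ.base.val (σ.center i), σ.base.rawFacts, ())

lemma enc_listOfFn {α : Type*} [Enc α] (f : Fin n → α) :
    enc (List.ofFn f) = Val.ofList (List.ofFn fun i => enc (f i)) := by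
  change Val.ofList _ = _
  rw [List.map_ofFn]; rfl

lemma enc_rawFacts (S : FinStr L) : enc S.rawFacts = Val.ofList (S.facts.map encodeFact) := by
  change Val.ofList _ = _
  rw [FinStr.rawFacts, List.map_map]
  congr 1
  refine List.map_congr_left fun F _ => ?_
  exact congrArg (Val.node _) (enc_listOfFn _)

lemma Sphere.enc_code (σ : Sphere L n) : enc σ.code = σ.encode := by
  change Val.node _ (Val.node _ (Val.node (enc (List.ofFn _)) (Val.node (enc σ.base.rawFacts) _))) = _
  rw [enc_listOfFn, enc_rawFacts]
  rfl

/-- The facts in `F` over `{0, …, s - 1}`, without repetitions. -/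
def normFacts (ar : List (ℕ × ℕ)) (s : ℕ) (F : List RawFact) : List RawFact :=
  (allFacts ar s).filter fun x => F.any fun y => decide (x = y)

/-- The facts of a sphere may be listed with any number of repetitions, so a small sphere can have a
long code. Selecting from the list of all facts gives a list bounded in terms of the number of
elements. -/
lemma mem_normFacts {S : FinStr L} {x : RawFact} :
    x ∈ normFacts (arities L) S.size S.rawFacts ↔ x ∈ S.rawFacts := by
  simp only [normFacts, List.mem_filter, List.any_eq_true, decide_eq_true_eq, exists_eq_right']
  refine and_iff_right_of_imp fun h => ?_
  obtain ⟨F, _, rfl⟩ := List.mem_map.1 h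
  exact mem_allFacts.2 ⟨F, rfl⟩

lemma size_rawFact_le {s : ℕ} (F : Σ R : (Σ l, L.Relations l), Fin R.1 → Fin s) :
    (enc (rawFact F)).size ≤ (enc (allFacts (arities L) s)).size :=
  size_enc_mem (mem_allFacts.2 ⟨F, rfl⟩)

/-- The arguments for the treatment of a Hanf formula: the number of variables, the bound for the
number of elements, the sphere of the parameters, the threshold, and the sphere in the formula. -/
abbrev AtomIn := (ℕ × ℕ × Raw) × (ℕ × SphereCode)

/-- A Hanf formula under the assumption that the parameters and the quantified element realise
`τ`, from the values of the small data. -/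
def atomCore (ar : List (ℕ × ℕ)) (n N m rad e m' : ℕ) (τ σ : Raw) : Val :=
  if isFar e τ σ = true then
    .node (.ofNat 2) (.node (.ofNat (m + shift e τ σ))
      (.node (.ofNat rad) (.node (.ofNat (reduct ar (n + 1) N e τ σ).1)
        (.node (enc (reduct ar (n + 1) N e τ σ).2.1)
          (.node (enc (reduct ar (n + 1) N e τ σ).2.2) .nil)))))
  else if decide (m' ≤ countNear e τ σ) = true then .node (.ofNat 0) .nil
  else .node (.ofNat 1) .nil

/-- A Hanf formula under the assumption that the parameters and the quantified element realise
`τ`. -/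
def atomVal (ar : List (ℕ × ℕ)) (γ : AtomIn) : Val :=
  if decide (min γ.2.2.2.1 (γ.1.2.1 + 1) ≤ γ.1.2.1) = true then
    atomCore ar γ.1.1 γ.1.2.1 γ.2.1 γ.2.2.1 (min γ.2.2.1 γ.1.2.1) (min γ.2.1 (γ.1.2.1 + 1)) γ.1.2.2
      (min γ.2.2.2.1 (γ.1.2.1 + 1), γ.2.2.2.2.1,
        normFacts ar (min γ.2.2.2.1 (γ.1.2.1 + 1)) γ.2.2.2.2.2.1)
  else if decide (γ.2.1 = 0) = true then .node (.ofNat 0) .nil else .node (.ofNat 1) .nil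

variable (L) in
/-- The context for the treatment of Hanf formulas. -/
noncomputable def atomCtx : Ctx AtomIn where
  ok γ := γ.1.1 + 2 ≤ γ.1.2.1 ∧ γ.1.2.2 ∈ raws (arities L) (γ.1.1 + 1) γ.1.2.1 ∧
    ∃ σ : Sphere L (γ.1.1 + 2), γ.2.2 = σ.code
  w γ := γ.2.1 + γ.2.2.1 + γ.2.2.2.1 + γ.2.2.2.2.2.1.length
  μ γ := meas (arities L) γ.1.2.1

lemma atomCtx_pb_bound {T : AtomIn → ℕ} (h : ∀ γ, (atomCtx L).ok γ → T γ ≤ meas (arities L) γ.1.2.1) :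
    PB (atomCtx L) T := (PB.mu (atomCtx L)).mono h

lemma Cmp.atomCtx_N : Cmp (atomCtx L).light fun γ => γ.1.2.1 :=
  ⟨Tm.id.fst.snd.fst, (atomCtx_pb_bound fun _ _ => le_meas _ _).light.size_nat⟩

lemma Cmp.atomCtx_n : Cmp (atomCtx L).light fun γ => γ.1.1 :=
  ⟨Tm.id.fst.fst, (atomCtx_pb_bound fun γ h =>
    (show γ.1.1 ≤ γ.1.2.1 by have := h.1; omega).trans (le_meas _ _)).light.size_nat⟩

lemma atomCtx_pow : PB (atomCtx L) fun γ => γ.1.2.1 ^ (γ.1.1 + 1) :=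
  atomCtx_pb_bound fun γ h => pow_le_meas _ (by have := h.1; omega)

lemma atomCtx_allFacts : PB (atomCtx L) fun γ => 2 ^ (allFacts (arities L) γ.1.2.1).length :=
  atomCtx_pb_bound fun _ _ => two_pow_length_allFacts_le _ _

/-- The sphere of the parameters is small because it is a member of the list of all written
structures, which has size polynomial in the measure. -/
lemma Cmp.atomCtx_tau : Cmp (atomCtx L).light fun γ => γ.1.2.2 :=
  ⟨Tm.id.fst.snd.snd, (Cmp.raws (arities L) Cmp.atomCtx_n.succ Cmp.atomCtx_N atomCtx_pow.light
    atomCtx_allFacts.light).sz.mono fun _ h => size_enc_mem h.2.1⟩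

/-- Truncation at `N + 1` instead of `N` keeps the comparison with `N` intact. The threshold is
truncated in the same way, and it is compared only with numbers of elements of the sphere of the
parameters, which are at most `N`. -/
lemma Cmp.atomCtx_size : Cmp (atomCtx L) fun γ => min γ.2.2.2.1 (γ.1.2.1 + 1) :=
  Cmp.min_big (Tm.id.snd.snd.snd.fst) Cmp.atomCtx_N.succ fun γ _ => by
    simp only [atomCtx]; omega

lemma Cmp.atomCtx_radius : Cmp (atomCtx L) fun γ => min γ.2.2.1 γ.1.2.1 :=
  Cmp.min_big (Tm.id.snd.snd.fst) Cmp.atomCtx_N fun γ _ => by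
    simp only [atomCtx]; omega

lemma Cmp.atomCtx_threshold : Cmp (atomCtx L) fun γ => min γ.2.1 (γ.1.2.1 + 1) :=
  Cmp.min_big (Tm.id.snd.fst) Cmp.atomCtx_N.succ fun γ _ => by
    simp only [atomCtx]; omega

variable (L) in
/-- The case of a small sphere. -/
noncomputable abbrev smallCtx : Ctx AtomIn :=
  (atomCtx L).restrict fun γ => decide (min γ.2.2.2.1 (γ.1.2.1 + 1) ≤ γ.1.2.1) = true

lemma smallCtx_size {γ : AtomIn} (h : (smallCtx L).ok γ) : γ.2.2.2.1 ≤ γ.1.2.1 := by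
  have := of_decide_eq_true h.2
  omega

lemma Cmp.smallCtx_center : Cmp (smallCtx L) fun γ => γ.2.2.2.2.1 := by
  refine ⟨Tm.id.snd.snd.snd.snd.fst, PB.mono (((PB.mul (Cmp.atomCtx_n.of_light.succ.succ.pb)
    (((PB.const _ 2).mul Cmp.atomCtx_N.of_light.pb).add (PB.const _ 1))).add
      (PB.const _ 1)).restrict) fun γ h => ?_⟩
  obtain ⟨σ, hσ⟩ := h.1.2.2
  have hs := smallCtx_size h
  rw [hσ] at hs ⊢
  have := size_enc_list_nat (l := σ.code.2.2.1) (s := γ.1.2.1) fun x hx => by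
    obtain ⟨i, rfl⟩ := List.mem_ofFn.1 hx
    exact (σ.base.val_lt _).trans_le hs
  simpa [Sphere.code] using this

/-- The outer loop goes over all possible facts, whose number is bounded in terms of the measure.
The inner one goes over the given list of facts, whose length is part of the weight. -/
lemma Cmp.smallCtx_facts : Cmp (smallCtx L) fun γ =>
    normFacts (arities L) (min γ.2.2.2.1 (γ.1.2.1 + 1)) γ.2.2.2.2.2.1 := by
  have hall : Cmp (smallCtx L) fun γ => HanfNF.allFacts (arities L) (min γ.2.2.2.1 (γ.1.2.1 + 1)) :=
    (Cmp.allFacts _ Cmp.atomCtx_size).restrict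
  refine Cmp.filter (g := fun γ x => γ.2.2.2.2.2.1.any fun y => decide (x = y)) hall ?_
  refine Cmp.any_big (g := fun (p : AtomIn × RawFact) y => decide (p.2 = y))
    (l := fun p => p.1.2.2.2.2.2.1)
    (fun p => (enc (HanfNF.allFacts (arities L) (min p.1.2.2.2.1 (p.1.1.2.1 + 1)))).size)
    (Tm.id.fst.snd.snd.snd.snd.snd.fst) (Cmp.eq (Cmp.weaken (Cmp.var (c := (smallCtx L).light)
      (P := fun γ x => x ∈ HanfNF.allFacts (arities L) (min γ.2.2.2.1 (γ.1.2.1 + 1))))) Cmp.var.tm) hall.sz.weaken ?_ ?_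
  · rintro ⟨γ, x⟩ ⟨h, -⟩ y hy
    obtain ⟨σ, hσ⟩ := h.1.2.2
    have hs : γ.2.2.2.1 ≤ γ.1.2.1 := smallCtx_size h
    dsimp only at hy ⊢
    rw [min_eq_left (by omega)]
    rw [hσ] at hy ⊢
    obtain ⟨F, _, rfl⟩ := List.mem_map.1 hy
    exact size_rawFact_le F
  · rintro ⟨γ, x⟩ ⟨h, -⟩
    simp only [Ctx.ext, Ctx.restrict, atomCtx]
    omega

lemma Cmp.smallCtx_sigma : Cmp (smallCtx L) fun γ =>
    ((min γ.2.2.2.1 (γ.1.2.1 + 1), γ.2.2.2.2.1,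
        normFacts (arities L) (min γ.2.2.2.1 (γ.1.2.1 + 1)) γ.2.2.2.2.2.1) : Raw) :=
  Cmp.atomCtx_size.restrict.pair (Cmp.smallCtx_center.pair Cmp.smallCtx_facts)

lemma smallCtx_pow : PB (smallCtx L) fun γ => γ.1.2.1 ^ min γ.2.2.2.1 (γ.1.2.1 + 1) :=
  (PB.mu (smallCtx L)).mono fun γ h => pow_le_meas _ (by
    have := smallCtx_size h
    omega)

lemma Cmp.smallCtx_shift : Cmp (smallCtx L) fun γ =>
    HanfNF.shift (min γ.2.2.1 γ.1.2.1) γ.1.2.2 (min γ.2.2.2.1 (γ.1.2.1 + 1), γ.2.2.2.2.1,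
        normFacts (arities L) (min γ.2.2.2.1 (γ.1.2.1 + 1)) γ.2.2.2.2.2.1) :=
  Cmp.shift Cmp.atomCtx_radius.restrict Cmp.atomCtx_tau.of_light.restrict Cmp.smallCtx_sigma
    (smallCtx_pow.mono fun _ h => Nat.pow_le_pow_left (size_le_of_mem_raws h.1.2.1) _)

lemma Cmp.smallCtx_reduct : Cmp (smallCtx L) fun γ =>
    HanfNF.reduct (arities L) (γ.1.1 + 1) γ.1.2.1 (min γ.2.2.1 γ.1.2.1) γ.1.2.2
      (min γ.2.2.2.1 (γ.1.2.1 + 1), γ.2.2.2.2.1,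
        normFacts (arities L) (min γ.2.2.2.1 (γ.1.2.1 + 1)) γ.2.2.2.2.2.1) :=
  Cmp.reduct _ Cmp.atomCtx_n.of_light.succ.restrict Cmp.atomCtx_N.of_light.restrict
    Cmp.atomCtx_radius.restrict Cmp.atomCtx_tau.of_light.restrict Cmp.smallCtx_sigma
    smallCtx_pow atomCtx_pow.restrict atomCtx_allFacts.restrict

/-- Hanf formulas are treated in linear time, up to a factor that depends on the measure only. -/
lemma Tm.atomVal : Tm (atomCtx L) (atomVal (arities L)) := by
  refine Tm.ite (Cmp.le Cmp.atomCtx_size Cmp.atomCtx_N.of_light).tm ?_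
    (Tm.ite (Cmp.null (Tm.id.snd.fst)).tm.restrict (Cmp.const _).tm (Cmp.const _).tm)
  have hp : PB (smallCtx L) fun γ => γ.1.2.2.1 ^ min γ.2.2.2.1 (γ.1.2.1 + 1) :=
    smallCtx_pow.mono fun _ h => Nat.pow_le_pow_left (size_le_of_mem_raws h.1.2.1) _
  have hr := Cmp.smallCtx_reduct (L := L)
  refine Tm.ite (Cmp.isFar Cmp.atomCtx_radius.restrict Cmp.atomCtx_tau.of_light.restrict
    Cmp.smallCtx_sigma hp).tm ?_ (Tm.ite ((Cmp.atomCtx_threshold.restrict).le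
      (Cmp.countNear Cmp.atomCtx_radius.restrict Cmp.atomCtx_tau.of_light.restrict
    Cmp.smallCtx_sigma hp)).tm.restrict (Cmp.const _).tm (Cmp.const _).tm)
  refine Tm.restrict ?_
  -- The threshold and the radius are the only large numbers in the output. The first serves as the
  -- untouched left summand, and the second is copied.
  have h1 : Tm (smallCtx L) fun γ => γ.2.1 + _ := Tm.add Tm.id.snd.fst Cmp.smallCtx_shift
  exact Tm.recode ((Cmp.const 2).tm.pair (h1.pair (Tm.pair (f := fun γ => γ.2.2.1) Tm.id.snd.snd.fst
    (hr.tm.fst.pair (hr.tm.snd.fst.pair (hr.tm.snd.snd.pair (Cmp.const ()).tm)))))) fun _ _ => rfl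

end Codes

/-! ### The treatment of a Hanf formula -/

section Atoms
variable {L : FirstOrder.Language.{u, v}} [L.IsRelational]

lemma exists_injective_iff {A : Type*} (m : ℕ) (P : A → Prop) :
    (∃ x : Fin m → A, Function.Injective x ∧ ∀ i, P (x i)) ↔ (m : ℕ∞) ≤ {y | P y}.encard := by
  constructor
  · rintro ⟨x, hx, h⟩
    have : (Set.range x).encard = m := by
      rw [← Set.image_univ, hx.encard_image, Set.encard_univ]; simp
    exact this ▸ Set.encard_le_encard (by rintro _ ⟨i, rfl⟩; exact h i)
  · intro h
    obtain ⟨t, ht, hm⟩ := Set.exists_subset_encard_eq h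
    have hfin : t.Finite := Set.finite_of_encard_eq_coe hm
    have : Fintype t := hfin.fintype
    have hc : Fintype.card t = m := by
      rw [Set.encard_eq_coe_toFinset_card, Set.toFinset_card] at hm
      exact_mod_cast hm
    let e : Fin m ≃ t := Fintype.equivOfCardEq (by simp [hc])
    exact ⟨fun i => e i, fun i j h => e.injective (Subtype.ext h), fun i => ht (e i).2⟩

lemma realize_hanf_iff {n m : ℕ} {σ : Sphere L (n + 1)} {A : Type w} [L.Structure A]
    {a : Fin n → A} : (HNF.hanf m σ).Realize a ↔
      (m : ℕ∞) ≤ {y | SphereIso L σ.radius (Fin.snoc a y : Fin (n + 1) → A) σ.center}.encard := by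
  rw [← exists_injective_iff]
  simp only [HNF.Realize, realisedBy_iff]

lemma encard_univ_carrier (S : FinStr L) : (Set.univ : Set S.Carrier).encard = S.size := by
  rw [Set.encard_univ]
  exact (ENat.card_eq_coe_natCard (Fin S.size)).trans (by simp)

lemma encard_le_size {S : FinStr L} (X : Set S.Carrier) : X.encard ≤ S.size :=
  encard_univ_carrier S ▸ Set.encard_le_encard (Set.subset_univ X)

variable [Finite (Σ l, L.Relations l)] {n : ℕ}

lemma length_sphere_le (σ : Sphere L n) :
    σ.length ≤ σ.radius + (enc (σ.base.raw σ.center)).size := by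
  have h1 : (σ.base.facts.map fun F => F.1.1 + 1).sum ≤ (enc σ.base.rawFacts).size := by
    rw [size_enc_list, FinStr.rawFacts, List.map_map]
    refine le_trans (List.sum_le_sum fun F _ => ?_) (Nat.le_succ _)
    have := length_le_size (rawFact F).2
    have h := size_snd (rawFact F)
    simp only [rawFact, List.length_ofFn, Function.comp] at this h ⊢
    omega
  have h2 := length_le_size (List.ofFn fun i => σ.base.val (σ.center i))
  rw [List.length_ofFn] at h2
  have h3 := size_enc_nat σ.base.size
  simp only [Sphere.length, FinStr.raw, enc_pair, Val.size]
  omega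

variable (L) in
/-- A bound for the length of what a Hanf formula is replaced by. -/
noncomputable def atomBound (γ : AtomIn) : ℕ :=
  (if decide (min γ.2.2.2.1 (γ.1.2.1 + 1) ≤ γ.1.2.1) = true then
    shift (min γ.2.2.1 γ.1.2.1) γ.1.2.2 (min γ.2.2.2.1 (γ.1.2.1 + 1), γ.2.2.2.2.1,
        normFacts (arities L) (min γ.2.2.2.1 (γ.1.2.1 + 1)) γ.2.2.2.2.2.1) +
      (enc (reduct (arities L) (γ.1.1 + 1) γ.1.2.1 (min γ.2.2.1 γ.1.2.1) γ.1.2.2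
      (min γ.2.2.2.1 (γ.1.2.1 + 1), γ.2.2.2.2.1,
        normFacts (arities L) (min γ.2.2.2.1 (γ.1.2.1 + 1)) γ.2.2.2.2.2.1))).size
  else 0) + 1

lemma PB.atomBound : PB (atomCtx L) (atomBound L) :=
  (PB.ite (b := fun γ : AtomIn => decide (min γ.2.2.2.1 (γ.1.2.1 + 1) ≤ γ.1.2.1))
    (Cmp.smallCtx_shift.pb.add Cmp.smallCtx_reduct.sz) (PB.const _ 0)).add (PB.const _ 1)

/-- A Hanf formula is equivalent to a Hanf formula about the parameters, as soon as the parameters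
and the value of the last variable realise a large sphere. -/
lemma exists_atom {N m : ℕ} {τ : Raw} (hτ : τ ∈ raws (arities L) (n + 1) N)
    (σ : Sphere L (n + 2)) :
    ∃ χ : HNF L n, χ.encode = atomVal (arities L) ((n, N, τ), (m, σ.code)) ∧
      χ.maxRadius ≤ σ.radius ∧
      χ.length ≤ (HNF.hanf m σ).length + atomBound L ((n, N, τ), (m, σ.code)) ∧
      ∀ (A : Type w) [L.Structure A] (a : Fin n → A) (b : A) (R : ℕ) (T : FinStr L)
        (tc : Fin (n + 1) → T.Carrier) (h : A → T.Carrier), Rep τ T tc →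
        (∀ y : A, (ball L σ.radius (Fin.snoc (Fin.snoc a b : Fin (n + 1) → A) y :
          Fin (n + 2) → A)).encard ≤ (N : ℕ∞)) →
        SphereMap L R h (Fin.snoc a b : Fin (n + 1) → A) tc → 3 * σ.radius ≤ R →
        ((HNF.hanf m σ).Realize (Fin.snoc a b : Fin (n + 1) → A) ↔ χ.Realize a) := by
  have he := σ.radius_pos
  have hTN : ∀ (T : FinStr L) (tc : Fin (n + 1) → T.Carrier), Rep τ T tc → T.size ≤ N :=
    fun T tc h => h.size ▸ size_le_of_mem_raws hτ
  have hNE : ∀ T : FinStr L, T.size ≤ N → ∀ X : Set T.Carrier, X.encard ≤ (N : ℕ∞) :=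
    fun T hT X => (encard_le_size X).trans (by exact_mod_cast hT)
  by_cases hs : σ.base.size ≤ N
  · obtain ⟨sc, z, hc⟩ : ∃ (sc : Fin (n + 1) → σ.base.Carrier) (z : σ.base.Carrier),
        σ.center = Fin.snoc sc z := ⟨Fin.init σ.center, σ.center (Fin.last _),
          (Fin.snoc_init_self _).symm⟩
    set r : Raw := (σ.base.size, (List.ofFn fun i => σ.base.val (σ.center i)),
      normFacts (arities L) σ.base.size σ.base.rawFacts) with hr
    have hσ : Rep r σ.base (Fin.snoc sc z : Fin (n + 2) → σ.base.Carrier) :=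
      ⟨rfl, by rw [← hc], fun x => mem_normFacts⟩
    have hmin : min σ.base.size (N + 1) = σ.base.size := min_eq_left (by omega)
    have hval : atomVal (arities L) ((n, N, τ), (m, σ.code)) =
        atomCore (arities L) n N m σ.radius (min σ.radius N) (min m (N + 1)) τ r := by
      simp only [atomVal, Sphere.code, hmin, hs, decide_true, if_true, hr]
    have hbound : atomBound L ((n, N, τ), (m, σ.code)) = shift (min σ.radius N) τ r +
        (enc (reduct (arities L) (n + 1) N (min σ.radius N) τ r)).size + 1 := by
      simp only [atomBound, Sphere.code, hmin, hs, decide_true, if_true, hr]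
    rw [hval, hbound]
    by_cases hfar : isFar (min σ.radius N) τ r = true
    · obtain ⟨ρ, hρ, hraw, hiso⟩ := exists_reduct (τ := τ) hσ hs he
      refine ⟨.hanf (m + shift (min σ.radius N) τ r) ρ, ?_, hρ.le, ?_, ?_⟩
      · rw [atomCore, if_pos hfar, HNF.encode, ← Sphere.enc_code, ← hraw, ← hρ]
        rfl
      · have := length_sphere_le ρ
        rw [hraw, hρ] at this
        simp only [HNF.length, Sphere.length]
        simp only [Sphere.length] at this
        omega
      · intro A _ a b R T tc h hT hball H hR
        have : Nonempty σ.base.Carrier := ⟨z⟩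
        have hfar' := (isFar_iff hT hσ hs (hTN T tc hT) he (by rw [← hc, σ.covers])).1 hfar
        rw [realize_hanf_iff, realize_hanf_iff, hc, hρ]
        have e1 : {y | SphereIso L σ.radius (Fin.snoc a y : Fin (n + 1) → A) ρ.center} =
            {y | SphereIso L σ.radius (Fin.snoc a y : Fin (n + 1) → A)
              (Fin.snoc (Fin.init sc) z : Fin (n + 1) → σ.base.Carrier)} := by
          ext y
          exact ⟨fun hy => hy.trans (hiso.symm he), fun hy => hy.trans hiso⟩
        rw [e1, H.encard_of_far he hR hfar'.1 hfar'.2, ← shift_eq hT hσ hs (hTN T tc hT) he,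
          Nat.cast_add]
        -- The shift is finite, so it cancels even if the set of realisations is infinite.
        exact (WithTop.add_le_add_iff_right (WithTop.natCast_ne_top _)).symm
    · have key : ∀ (A : Type w) [L.Structure A] (a : Fin n → A) (b : A) (R : ℕ) (T : FinStr L)
        (tc : Fin (n + 1) → T.Carrier) (h : A → T.Carrier), Rep τ T tc →
        SphereMap L R h (Fin.snoc a b : Fin (n + 1) → A) tc → 3 * σ.radius ≤ R →
        ((HNF.hanf m σ).Realize (Fin.snoc a b : Fin (n + 1) → A) ↔
          min m (N + 1) ≤ countNear (min σ.radius N) τ r) := by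
        intro A _ a b R T tc h hT H hR
        have hfar' := fun hf => hfar ((isFar_iff hT hσ hs (hTN T tc hT) he
          (by rw [← hc, σ.covers])).2 hf)
        rw [realize_hanf_iff, hc, H.encard_of_not_far he hR hfar',
          ← countNear_eq hT hσ hs (hTN T tc hT) he, Nat.cast_le]
        -- The count is at most `N`, hence it makes no difference whether it is compared with `m` or
        -- with `min m (N + 1)`.
        have : (countNear (min σ.radius N) τ r : ℕ∞) ≤ N := by
          rw [countNear_eq hT hσ hs (hTN T tc hT) he]
          exact hNE T (hTN T tc hT) _
        have := Nat.cast_le.1 this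
        omega
      by_cases hm : min m (N + 1) ≤ countNear (min σ.radius N) τ r
      · refine ⟨.verum, ?_, Nat.zero_le _, ?_, ?_⟩
        · rw [atomCore, if_neg hfar, if_pos (by simpa using hm)]; rfl
        · simp only [HNF.length]; omega
        · intro A _ a b R T tc h hT hball H hR
          rw [key A a b R T tc h hT H hR]
          exact iff_of_true hm trivial
      · refine ⟨.falsum, ?_, Nat.zero_le _, ?_, ?_⟩
        · rw [atomCore, if_neg hfar, if_neg (by simpa using hm)]; rfl
        · simp only [HNF.length]; omega
        · intro A _ a b R T tc h hT hball H hR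
          rw [key A a b R T tc h hT H hR]
          exact iff_of_false hm id
  · have hmin : ¬ min σ.base.size (N + 1) ≤ N := by omega
    have hval : atomVal (arities L) ((n, N, τ), (m, σ.code)) =
        if m = 0 then (HNF.verum : HNF L n).encode else (HNF.falsum : HNF L n).encode := by
      simp only [atomVal, Sphere.code, hmin, decide_false, Bool.false_eq_true, if_false,
        decide_eq_true_eq]
      rfl
    have key : ∀ (A : Type w) [L.Structure A] (a : Fin n → A) (b : A),
        (∀ y : A, (ball L σ.radius (Fin.snoc (Fin.snoc a b : Fin (n + 1) → A) y :
          Fin (n + 2) → A)).encard ≤ (N : ℕ∞)) →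
        ((HNF.hanf m σ).Realize (Fin.snoc a b : Fin (n + 1) → A) ↔ m = 0) := by
      intro A _ a b hball
      rw [realize_hanf_iff]
      -- A realisation would put the more than `N` elements of `σ` in bijection with a ball of at
      -- most `N` elements.
      have : {y | SphereIso L σ.radius (Fin.snoc (Fin.snoc a b : Fin (n + 1) → A) y :
          Fin (n + 2) → A) σ.center} = ∅ := by
        ext y
        simp only [Set.mem_ofPred_eq, Set.mem_empty_iff_false, iff_false]
        rintro ⟨h, h1, -⟩
        have h2 := hball y
        rw [← h1.bij.injOn.encard_image, h1.bij.image_eq, σ.covers, encard_univ_carrier] at h2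
        exact hs (by exact_mod_cast h2)
      rw [this]
      simp
    rw [hval]
    by_cases hm : m = 0
    · refine ⟨.verum, by rw [if_pos hm], Nat.zero_le _, by simp only [HNF.length]; omega, ?_⟩
      intro A _ a b R T tc h hT hball H hR
      rw [key A a b hball]
      exact iff_of_true hm trivial
    · refine ⟨.falsum, by rw [if_neg hm], Nat.zero_le _, by simp only [HNF.length]; omega, ?_⟩
      intro A _ a b R T tc h hT hball H hR
      rw [key A a b hball]
      exact iff_of_false hm id

end Atoms

/-! ### Replacement of Hanf formulas -/

section Bind
variable {L : FirstOrder.Language.{u, v}} [L.IsRelational] {n k : ℕ}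

/-- Replaces the Hanf formulas in a formula. -/
def HNF.bind (χ : ℕ → Sphere L (k + 1) → HNF L n) : HNF L k → HNF L n
  | .verum => .verum
  | .falsum => .falsum
  | .hanf m σ => χ m σ
  | .neg φ => .neg (φ.bind χ)
  | .conj φ ψ => .conj (φ.bind χ) (ψ.bind χ)
  | .disj φ ψ => .disj (φ.bind χ) (ψ.bind χ)

variable {χ : ℕ → Sphere L (k + 1) → HNF L n}

lemma HNF.realize_bind {A : Type w} [L.Structure A] {d : ℕ} {b : Fin k → A} {a : Fin n → A}
    (h : ∀ m σ, σ.radius ≤ d → ((HNF.hanf m σ).Realize b ↔ (χ m σ).Realize a)) (φ : HNF L k)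
    (hφ : φ.maxRadius ≤ d) : φ.Realize b ↔ (φ.bind χ).Realize a := by
  induction φ with
  | verum => exact Iff.rfl
  | falsum => exact Iff.rfl
  | hanf m σ => exact h m σ hφ
  | neg φ ih => exact not_congr (ih hφ)
  | conj φ ψ ih₁ ih₂ =>
    exact and_congr (ih₁ ((le_max_left _ _).trans hφ)) (ih₂ ((le_max_right _ _).trans hφ))
  | disj φ ψ ih₁ ih₂ =>
    exact or_congr (ih₁ ((le_max_left _ _).trans hφ)) (ih₂ ((le_max_right _ _).trans hφ))

lemma HNF.maxRadius_bind (h : ∀ m σ, (χ m σ).maxRadius ≤ σ.radius) (φ : HNF L k) :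
    (φ.bind χ).maxRadius ≤ φ.maxRadius := by
  induction φ with
  | verum => exact le_rfl
  | falsum => exact le_rfl
  | hanf m σ => exact h m σ
  | neg φ ih => exact ih
  | conj φ ψ ih₁ ih₂ => exact max_le_max ih₁ ih₂
  | disj φ ψ ih₁ ih₂ => exact max_le_max ih₁ ih₂

lemma HNF.length_bind {B : ℕ} (hB : 1 ≤ B) (h : ∀ m σ, (χ m σ).length ≤ (HNF.hanf m σ).length * B)
    (φ : HNF L k) : (φ.bind χ).length ≤ φ.length * B := by
  induction φ with
  | verum => simpa [HNF.bind, HNF.length] using hB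
  | falsum => simpa [HNF.bind, HNF.length] using hB
  | hanf m σ => exact h m σ
  | neg φ ih => simp only [HNF.bind, HNF.length, Nat.add_mul]; omega
  | conj φ ψ ih₁ ih₂ => simp only [HNF.bind, HNF.length, Nat.add_mul]; omega
  | disj φ ψ ih₁ ih₂ => simp only [HNF.bind, HNF.length, Nat.add_mul]; omega

variable [Finite (Σ l, L.Relations l)]

/-- Replaces the Hanf formulas in the code of a formula. -/
noncomputable def HNF.bindVal (v : ℕ → Sphere L (k + 1) → Val) : HNF L k → Val
  | .verum => (HNF.verum : HNF L k).encode
  | .falsum => (HNF.falsum : HNF L k).encode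
  | .hanf m σ => v m σ
  | .neg φ => .node (.ofNat 3) (φ.bindVal v)
  | .conj φ ψ => .node (.ofNat 4) (.node (φ.bindVal v) (ψ.bindVal v))
  | .disj φ ψ => .node (.ofNat 5) (.node (φ.bindVal v) (ψ.bindVal v))

lemma HNF.encode_bind {v : ℕ → Sphere L (k + 1) → Val} (h : ∀ m σ, (χ m σ).encode = v m σ)
    (φ : HNF L k) : (φ.bind χ).encode = φ.bindVal v := by
  induction φ with
  | verum => rfl
  | falsum => rfl
  | hanf m σ => exact h m σ
  | neg φ ih => simp only [HNF.bind, HNF.encode, HNF.bindVal, ih]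
  | conj φ ψ ih₁ ih₂ => simp only [HNF.bind, HNF.encode, HNF.bindVal, ih₁, ih₂]
  | disj φ ψ ih₁ ih₂ => simp only [HNF.bind, HNF.encode, HNF.bindVal, ih₁, ih₂]

/-- Radii are positive, so such a formula contains no Hanf formula. Its code does not mention the
number of variables, and the input can be returned as it is. -/
lemma HNF.encode_bind_of_maxRadius (φ : HNF L k) (h : φ.maxRadius = 0) :
    (φ.bind χ).encode = φ.encode ∧ (φ.bind χ).length = φ.length ∧ (φ.bind χ).maxRadius = 0 := by
  induction φ with
  | verum => exact ⟨rfl, rfl, rfl⟩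
  | falsum => exact ⟨rfl, rfl, rfl⟩
  | hanf m σ => exact absurd h σ.radius_pos.ne'
  | neg φ ih => simpa [HNF.bind, HNF.encode, HNF.length, HNF.maxRadius] using ih h
  | conj φ ψ ih₁ ih₂ =>
    obtain ⟨h1, h2⟩ := Nat.max_eq_zero_iff.1 h
    simp [HNF.bind, HNF.encode, HNF.length, HNF.maxRadius, ih₁ h1, ih₂ h2]
  | disj φ ψ ih₁ ih₂ =>
    obtain ⟨h1, h2⟩ := Nat.max_eq_zero_iff.1 h
    simp [HNF.bind, HNF.encode, HNF.length, HNF.maxRadius, ih₁ h1, ih₂ h2]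

/-- Formulas with some number of variables. -/
abbrev AnyHNF (L : FirstOrder.Language.{u, v}) [L.IsRelational] := Σ n, HNF L (n + 1)

noncomputable instance : Enc (AnyHNF L) := ⟨fun φ => φ.2.encode⟩

variable (L) in
/-- The context for the treatment of a formula, for a given sphere of the parameters. -/
noncomputable def bindCtx : Ctx ((ℕ × ℕ × Raw) × AnyHNF L) where
  ok γ := γ.1.1 = γ.2.1 ∧ γ.2.1 + 2 ≤ γ.1.2.1 ∧ γ.1.2.2 ∈ raws (arities L) (γ.2.1 + 1) γ.1.2.1
  w γ := γ.2.2.length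
  μ γ := meas (arities L) γ.1.2.1

lemma length_facts_le (S : FinStr L) :
    S.rawFacts.length ≤ (S.facts.map fun F => F.1.1 + 1).sum := by
  rw [FinStr.rawFacts, List.length_map]
  induction S.facts with
  | nil => exact Nat.zero_le _
  | cons F l ih => simp only [List.length_cons, List.map_cons, List.sum_cons]; omega

/-- The linear factor in the cost of a Hanf formula is at most its own length. -/
lemma atomCtx_w_lt {n N m : ℕ} {τ : Raw} (σ : Sphere L (n + 2)) :
    (atomCtx L).w ((n, N, τ), (m, σ.code)) + 1 ≤ (HNF.hanf m σ).length := by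
  have := length_facts_le σ.base
  simp only [atomCtx, Sphere.code, HNF.length, Sphere.length]
  omega

/-- By `atomCtx_w_lt` the costs of the Hanf formulas add up to the length of the whole formula times
a polynomial in the measure. This is why the final bound is linear in `|φ|`. -/
lemma Tm.bindVal : Tm (bindCtx L) fun γ => γ.2.2.bindVal fun m σ =>
    HanfNF.atomVal (arities L) (γ.1, (m, σ.code)) := by
  obtain ⟨p, T, ⟨j, hT⟩, hp⟩ := Tm.atomVal (L := L)
  refine ⟨traverse .id p .id .id, fun γ => (((bindCtx L).μ γ + 2) ^ j + 1) + 400,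
    ((PB.add ⟨j, fun _ _ => le_rfl⟩ (PB.const _ 1))).add (PB.const _ 400), ?_⟩
  rintro ⟨⟨n, N, τ⟩, ⟨n', φ⟩⟩ ⟨h1, h2, h3⟩
  obtain rfl : n = n' := h1
  obtain ⟨t, ht, e⟩ := eval_traverse (env := enc (n, N, τ)) (V := .id) (A := p) (Kn := .id)
    (Kb := .id) (val := fun φ : HNF L (n + 1) => φ.bindVal fun m σ =>
      HanfNF.atomVal (arities L) ((n, N, τ), (m, σ.code)))
    (tm := fun φ => φ.length * ((meas (arities L) N + 2) ^ j + 1))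
    ⟨_, by simp [HNF.length], .id _⟩ ⟨_, by simp [HNF.length], .id _⟩
    (fun m σ => by
      have hok : (atomCtx L).ok ((n, N, τ), (m, σ.code)) := ⟨h2, h3, σ, rfl⟩
      obtain ⟨t, ht, e⟩ := hp _ hok
      refine ⟨t, ht.trans (Nat.mul_le_mul (atomCtx_w_lt σ) ((hT _ hok).trans (Nat.le_succ _))), ?_⟩
      rw [← Sphere.enc_code]
      exact e)
    (fun φ => ⟨_, by simp only [HNF.length, Nat.add_mul]; omega, .id _⟩)
    (fun φ ψ => ⟨_, by simp only [HNF.length, Nat.add_mul]; omega, .id _⟩)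
    (fun φ ψ => ⟨_, by simp only [HNF.length, Nat.add_mul]; omega, .id _⟩) φ
  refine ⟨t, ht.trans ?_, e⟩
  simp only [bindCtx]
  nlinarith [Nat.zero_le ((meas (arities L) N + 2) ^ j)]

end Bind

/-! ### The formula without the quantifier -/

section Disj
variable {L : FirstOrder.Language.{u, v}} [L.IsRelational] {n : ℕ} {α : Type*}

/-- Disjunctions. -/
def HNF.iSup (g : α → HNF L n) (l : List α) : HNF L n :=
  l.foldl (fun acc r => .disj (g r) acc) .falsum

variable {g : α → HNF L n}

lemma HNF.realize_iSup {A : Type w} [L.Structure A] {a : Fin n → A} (l : List α) :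
    (HNF.iSup g l).Realize a ↔ ∃ r ∈ l, (g r).Realize a := by
  induction l using List.reverseRecOn with
  | nil => simp [HNF.iSup, HNF.Realize]
  | append_singleton l r ih =>
    rw [HNF.iSup, List.foldl_append, ← HNF.iSup]
    simp only [List.foldl_cons, List.foldl_nil, HNF.Realize, ih, List.mem_append,
      List.mem_singleton]
    constructor
    · rintro (h | ⟨s, hs, h⟩)
      exacts [⟨r, .inr rfl, h⟩, ⟨s, .inl hs, h⟩]
    · rintro ⟨s, hs | rfl, h⟩
      exacts [.inr ⟨s, hs, h⟩, .inl h]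

lemma HNF.length_iSup {B : ℕ} (l : List α) (h : ∀ r ∈ l, (g r).length ≤ B) :
    (HNF.iSup g l).length ≤ l.length * (B + 1) + 1 := by
  induction l using List.reverseRecOn with
  | nil => simp [HNF.iSup, HNF.length]
  | append_singleton l r ih =>
    rw [HNF.iSup, List.foldl_append, ← HNF.iSup]
    have h1 := ih fun s hs => h s (by simp [hs])
    have h2 := h r (by simp)
    simp only [List.foldl_cons, List.foldl_nil, HNF.length, List.length_append,
      List.length_singleton, Nat.add_mul, Nat.one_mul] at h1 ⊢
    omega

lemma HNF.maxRadius_iSup {R : ℕ} (l : List α) (h : ∀ r ∈ l, (g r).maxRadius = R) (hl : l ≠ []) :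
    (HNF.iSup g l).maxRadius = R := by
  have key : ∀ l : List α, (∀ r ∈ l, (g r).maxRadius = R) → (HNF.iSup g l).maxRadius ≤ R := by
    intro l
    induction l using List.reverseRecOn with
    | nil => intro _; exact Nat.zero_le _
    | append_singleton l r ih =>
      intro h
      rw [HNF.iSup, List.foldl_append, ← HNF.iSup]
      exact max_le (h r (by simp)).le (ih fun s hs => h s (by simp [hs]))
  refine (key l h).antisymm ?_
  obtain ⟨l, r, rfl⟩ := (List.eq_nil_or_concat l).resolve_left hl
  rw [List.concat_eq_append] at h ⊢
  rw [HNF.iSup, List.foldl_append, ← HNF.iSup]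
  exact (h r (by simp)).ge.trans (le_max_left _ _)

lemma HNF.encode_iSup [Finite (Σ l, L.Relations l)] (v : α → Val) (l : List α)
    (h : ∀ r ∈ l, (g r).encode = v r) :
    (HNF.iSup g l).encode =
      l.foldl (fun acc r => .node (.ofNat 5) (.node (v r) acc)) (HNF.falsum : HNF L n).encode := by
  induction l using List.reverseRecOn with
  | nil => rfl
  | append_singleton l r ih =>
    rw [HNF.iSup, List.foldl_append, List.foldl_append, ← HNF.iSup,
      ← ih fun s hs => h s (by simp [hs])]
    simp only [List.foldl_cons, List.foldl_nil, HNF.encode, h r (by simp)]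

end Disj

/-! ### The disjunction over all large spheres, and its correctness -/

section Candidates
variable {L : FirstOrder.Language.{u, v}} [L.IsRelational] [Finite (Σ l, L.Relations l)] {n : ℕ}

/-- The written spheres of size at most `N`. -/
def spheres (ar : List (ℕ × ℕ)) (n N e : ℕ) : List Raw := (raws ar n N).filter (coversAll e)

/-- The code of the formula that is used if the parameters and the quantified element realise
`r`. -/
noncomputable def caseVal (N : ℕ) (r : Raw) (φ : HNF L (n + 1)) : Val :=
  .node (.ofNat 4) (.node (.node (.ofNat 2) (.node (.ofNat 1) (.node (.ofNat (3 * φ.maxRadius))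
    (.node (.ofNat r.1) (.node (enc r.2.1) (.node (enc r.2.2) .nil))))))
    (φ.bindVal fun m σ => atomVal (arities L) ((n, N, r), (m, σ.code))))

/-- The code of the formula without the quantifier. -/
noncomputable def elimVal (N : ℕ) (φ : HNF L (n + 1)) : Val :=
  (spheres (arities L) (n + 1) N (min (3 * φ.maxRadius) N)).foldl
    (fun acc r => .node (.ofNat 5) (.node (caseVal N r φ) acc)) (HNF.falsum : HNF L n).encode

lemma exists_sphere {d N : ℕ} (hd : 0 < d) {r : Raw}
    (h : r ∈ spheres (arities L) n N (min d N)) :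
    ∃ τ : Sphere L n, τ.radius = d ∧ τ.base.raw τ.center = r := by
  obtain ⟨h1, h2⟩ := List.mem_filter.1 h
  obtain ⟨S, a, rfl, hS⟩ := exists_of_mem_raws h1
  exact ⟨⟨S, a, d, hd, by rw [← ball_min hS, (S.rep_raw a).coversAll_iff.1 h2]⟩, rfl, rfl⟩

lemma exists_mem_spheres {A : Type w} [L.Structure A] {d N : ℕ} (a : Fin (n + 1) → A) (hd : 0 < d)
    (hN : (ball L d a).encard ≤ (N : ℕ∞)) : ∃ r ∈ spheres (arities L) (n + 1) N (min d N),
    ∀ (S : FinStr L) (c : Fin (n + 1) → S.Carrier), Rep r S c → SphereIso L d a c := by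
  obtain ⟨S, b, hS, hiso, hcov⟩ := exists_mem_raws a hd hN
  refine ⟨_, List.mem_filter.2 ⟨hS, ?_⟩, fun S' c hc => hiso.trans ?_⟩
  · rw [(S.rep_raw b).coversAll_iff, ball_min (size_le_of_mem_raws hS), hcov]
  -- Structures with a common description are isomorphic: `isoCheck` depends on the descriptions
  -- only, and it accepts this one because of the identity map of `S`.
  · have h1 := (isoCheck_iff (S.rep_raw b) (S.rep_raw b) d).2
      ⟨fun x => x, ⟨Set.bijOn_id _, fun _ _ _ _ => Iff.rfl⟩, fun _ => rfl⟩
    exact (isoCheck_iff (S.rep_raw b) hc d).1 h1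

variable (L n) in
-- The structure with one element and without facts is a sphere of every radius. With at least one
-- disjunct, the largest radius of the result is exactly `3d`, not just at most `3d`.
lemma spheres_ne_nil {d N : ℕ} (hd : 0 < d) (hN : 1 ≤ N) :
    spheres (arities L) (n + 1) N (min d N) ≠ [] := by
  obtain ⟨r, hr, -⟩ := exists_mem_spheres (A := (⟨1, []⟩ : FinStr L).Carrier) (L := L) (N := N)
    (fun _ : Fin (n + 1) => (0 : Fin 1)) hd
    ((encard_le_size _).trans (by exact_mod_cast hN))
  exact List.ne_nil_of_mem hr

/-- The elimination of a quantifier. -/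
theorem exists_elim {N f X Y : ℕ} (hf : 1 ≤ f) (φ : HNF L (n + 1)) (hd : 0 < φ.maxRadius)
    (hN : N = (n + 2 + (n + 2)) * (f * f * f) ^ φ.maxRadius)
    (hX : (enc (spheres (arities L) (n + 1) N (min (3 * φ.maxRadius) N))).size ≤ X)
    (hY : ∀ r ∈ raws (arities L) (n + 1) N, ∀ (m : ℕ) (σ : Sphere L (n + 2)),
      atomBound L ((n, N, r), (m, σ.code)) ≤ Y) :
    ∃ ψ : HNF L n, ψ.encode = elimVal N φ ∧ ψ.maxRadius = 3 * φ.maxRadius ∧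
      ψ.length ≤ (3 * φ.length + 1) * (X * (X + Y + 6) + 1) ∧
      ∀ (A : Type w) [L.Structure A], DegreeLE L A f → ∀ a : Fin n → A,
        (∃ b : A, φ.Realize (Fin.snoc a b : Fin (n + 1) → A)) ↔ ψ.Realize a := by
  set d := φ.maxRadius with hdef
  have hN1 : n + 2 + (n + 2) ≤ N := hN ▸ Nat.le_mul_of_pos_right _ (by positivity)
  -- The same `N` serves for the spheres of radius `3d` with `n + 1` centres and for the spheres in
  -- `φ`, with `n + 2` centres and radius at most `d`.
  have hball : ∀ (A : Type w) [L.Structure A], DegreeLE L A f → ∀ (k : ℕ) (a : Fin k → A) (r : ℕ),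
      k ≤ n + 2 → r ≤ 3 * d → (ball L r a).encard ≤ (N : ℕ∞) := by
    intro A _ hA k a r hk hr
    refine (encard_ball_le hA hf a r).trans (Nat.cast_le.2 ?_)
    rw [hN, show f * f * f = f ^ 3 by ring, ← pow_mul, show n + 2 + (n + 2) = (n + 2) * 2 by ring,
      mul_assoc]
    have := Nat.pow_le_pow_right (n := f) hf hr
    gcongr
  have hg : ∀ r ∈ spheres (arities L) (n + 1) N (min (3 * d) N), ∃ χ : HNF L n,
      χ.encode = caseVal N r φ ∧ χ.maxRadius = 3 * d ∧
      χ.length ≤ (3 * φ.length + 1) * (X + Y + 5) ∧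
      ∀ (A : Type w) [L.Structure A], DegreeLE L A f → ∀ a : Fin n → A,
        (χ.Realize a → ∃ b : A, φ.Realize (Fin.snoc a b : Fin (n + 1) → A)) ∧
        ∀ b : A, (∀ (S : FinStr L) (c : Fin (n + 1) → S.Carrier), Rep r S c →
          SphereIso L (3 * d) (Fin.snoc a b : Fin (n + 1) → A) c) →
          φ.Realize (Fin.snoc a b : Fin (n + 1) → A) → χ.Realize a := by
    intro r hr
    obtain ⟨τ, hτ, hτr⟩ := exists_sphere (by omega) hr
    have hrep : Rep r τ.base τ.center := hτr ▸ τ.base.rep_raw τ.center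
    have hraw := (List.mem_filter.1 hr).1
    have hatom := fun (m : ℕ) (σ : Sphere L (n + 2)) => exists_atom.{u, v, w} (m := m) hraw σ
    choose χ hχ1 hχ2 hχ3 hχ4 using hatom
    have hcong : ∀ (A : Type w) [L.Structure A], DegreeLE L A f → ∀ (a : Fin n → A) (b : A),
        τ.RealisedBy (Fin.snoc a b : Fin (n + 1) → A) →
        (φ.Realize (Fin.snoc a b : Fin (n + 1) → A) ↔ (φ.bind χ).Realize a) := by
      intro A _ hA a b hab
      obtain ⟨h, hh⟩ := realisedBy_iff.1 hab
      refine HNF.realize_bind (d := d) (fun m σ hσ => ?_) φ le_rfl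
      exact hχ4 m σ A a b τ.radius τ.base τ.center h hrep
        (fun y => hball A hA _ _ _ le_rfl (by omega)) hh (by omega)
    -- The first conjunct says that some element, together with the parameters, realises `τ`.
    refine ⟨.conj (.hanf 1 τ) (φ.bind χ), ?_, ?_, ?_, fun A _ hA a => ⟨?_, fun b hb hφ => ?_⟩⟩
    · rw [HNF.encode, HNF.encode, HNF.encode_bind hχ1, ← Sphere.enc_code, caseVal, ← hτr, ← hdef,
        ← hτ]
      rfl
    · have := HNF.maxRadius_bind hχ2 φ
      simp only [HNF.maxRadius]
      omega
    · have h1 := HNF.length_bind (B := Y + 1) (by omega) (fun m σ => (hχ3 m σ).trans ?_) φ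
      · have h2 := length_sphere_le τ
        have h3 : (enc r).size ≤ X := (size_enc_mem hr).trans hX
        have h4 := maxRadius_le_length φ
        rw [hτr, hτ] at h2
        simp only [HNF.length]
        have e : (3 * φ.length + 1) * (X + Y + 5) = 3 * (φ.length * X) + 2 * (φ.length * Y) +
          φ.length * (Y + 1) + 14 * φ.length + X + Y + 5 := by ring
        rw [e]
        omega
      · have h1 := hY r hraw m σ
        have h2 := one_le_length (HNF.hanf m σ)
        nlinarith
    -- Every element that realises `τ` together with `a` is a witness: among those elements, the
    -- truth of `φ` depends on `a` alone.
    · rintro ⟨⟨x, -, hx⟩, h⟩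
      exact ⟨x 0, (hcong A hA a (x 0) (hx 0)).2 h⟩
    · have hb' : τ.RealisedBy (Fin.snoc a b : Fin (n + 1) → A) :=
        realisedBy_iff.2 (hτ ▸ hb _ _ hrep)
      exact ⟨⟨fun _ => b, fun i j _ => Subsingleton.elim i j, fun _ => hb'⟩, (hcong A hA a b hb').1 hφ⟩
  have : Nonempty (HNF L n) := ⟨.falsum⟩
  choose! g hg1 hg2 hg3 hg4 using hg
  refine ⟨HNF.iSup g (spheres (arities L) (n + 1) N (min (3 * d) N)), HNF.encode_iSup _ _ hg1,
    HNF.maxRadius_iSup _ hg2 (spheres_ne_nil L n (by omega) (by omega)), ?_, ?_⟩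
  · refine (HNF.length_iSup _ hg3).trans ?_
    have h1 := (length_le_size _).trans hX
    calc _ ≤ X * ((3 * φ.length + 1) * (X + Y + 5) + 1) + 1 := by gcongr
      _ ≤ _ := by nlinarith [Nat.zero_le (X * φ.length)]
  · intro A _ hA a
    rw [HNF.realize_iSup]
    constructor
    · rintro ⟨b, hb⟩
      obtain ⟨r, hr, hrS⟩ := exists_mem_spheres (d := 3 * d) (Fin.snoc a b : Fin (n + 1) → A)
        (by omega) (hball A hA _ _ _ (by omega) le_rfl)
      exact ⟨r, hr, (hg4 r hr A hA a).2 b hrS hb⟩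
    · rintro ⟨r, hr, h⟩
      exact (hg4 r hr A hA a).1 h

end Candidates

/-! ### The construction -/

section Construction
variable {L : FirstOrder.Language.{u, v}} [L.IsRelational] [Finite (Σ l, L.Relations l)]

/-- The inputs of the construction. -/
abbrev Input (L : FirstOrder.Language.{u, v}) [L.IsRelational] := ℕ × ℕ × AnyHNF L

/-- A bound for the number of elements of the spheres to be considered. -/
def sphereBound (γ : Input L) : ℕ :=
  (γ.1 + 2 + (γ.1 + 2)) * (γ.2.1 * γ.2.1 * γ.2.1) ^ γ.2.2.2.maxRadius

variable (L) in
/-- The context of the construction. -/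
noncomputable def inputCtx : Ctx (Input L) where
  ok γ := γ.2.2.1 = γ.1 ∧ 1 ≤ γ.2.1
  w γ := 3 * γ.2.2.2.length
  μ γ := meas (arities L) (sphereBound γ)

variable (L) in
/-- The context of the construction if a sphere appears in the formula. -/
noncomputable abbrev properCtx : Ctx (Input L) :=
  (inputCtx L).restrict fun γ => decide (γ.2.2.2.maxRadius = 0) = false

lemma Tm.maxRadius : Tm (inputCtx L) fun γ => γ.2.2.2.maxRadius := by
  refine ⟨.seq (.cons .nil (.seq .tl .tl)) radiusProg, fun _ => 610, PB.const _ _, fun γ _ => ?_⟩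
  obtain ⟨t, ht, e⟩ := eval_radiusProg .nil γ.2.2.2
  refine ⟨_, ?_, .seq (.cons (.nil _) (.seq (.tl_node _ _) (.tl_node _ _))) e⟩
  simp only [inputCtx]
  omega

/-- A step takes constant time however large the accumulator is, so it is analysed in a context with
weight and measure zero, and the number of steps is charged to the weight. -/
lemma Tm.three_mul {Γ : Type*} [Enc Γ] {c : Ctx Γ} {a : Γ → ℕ} (ha : Tm c a)
    (hw : ∀ γ, c.ok γ → a γ ≤ c.w γ) : Tm c fun γ => 3 * a γ := by
  refine (Tm.foldl_core (c' := ⟨fun _ => True, fun _ => 0, fun _ => 0⟩) (ini := fun _ => 0)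
    (step := fun _ acc (_ : Val) => acc + 1 + 1 + 1) (fun _ _ _ => True) (fun _ => 0) (fun _ => 0)
    (fun _ => 1) ha.unary (Cmp.const 0).tm Tm.id.snd.fst.succ.succ.succ (PB.const _ _) (PB.const _ _)
    (fun _ _ => trivial) (fun _ _ _ _ _ _ _ => ⟨trivial, trivial, le_rfl, le_rfl⟩)
    fun γ hγ => ?_).congr fun γ _ => ?_
  · simpa using hw γ hγ
  · rw [foldl_replicate _ (fun x => x + 1 + 1 + 1)]
    generalize a γ = n
    induction n with
    | zero => rfl
    | succ n ih => rw [Function.iterate_succ_apply', ih]; ring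

lemma properCtx_pos {γ : Input L} (h : (properCtx L).ok γ) : 0 < γ.2.2.2.maxRadius :=
  Nat.pos_of_ne_zero (of_decide_eq_false h.2)

lemma le_sphereBound (γ : Input L) (h : 1 ≤ γ.2.1) : γ.1 + 2 + (γ.1 + 2) ≤ sphereBound γ :=
  Nat.le_mul_of_pos_right _ (by positivity)

/-- This fails for `d = 0`, where the bound does not involve `f`. It is one reason why formulas
without spheres are treated apart: the permitted time then does not depend on `f` either. -/
lemma degree_le_sphereBound {γ : Input L} (h : (properCtx L).ok γ) : γ.2.1 ≤ sphereBound γ := by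
  have hf := h.1.2
  have h1 : γ.2.1 ≤ γ.2.1 * γ.2.1 * γ.2.1 := by nlinarith
  have h2 : γ.2.1 * γ.2.1 * γ.2.1 ≤ (γ.2.1 * γ.2.1 * γ.2.1) ^ γ.2.2.2.maxRadius :=
    Nat.le_self_pow (properCtx_pos h).ne' _
  exact (h1.trans h2).trans (Nat.le_mul_of_pos_left _ (by omega))

lemma properCtx_sphereBound : PB (properCtx L).light sphereBound :=
  (PB.mu (properCtx L)).light.mono fun _ _ => le_meas _ _

/-- The power is computed by `d` multiplications. Their number is charged to the weight, since for
`f = 1` the radius is not bounded by `N`. The invariant, accumulator times the remaining power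
equals `N`, keeps all intermediate products at most `N`. -/
lemma Tm.sphereBound : Tm (properCtx L) sphereBound := by
  have hn : Cmp (properCtx L).light fun γ => γ.1 :=
    ⟨Tm.id.fst, (properCtx_sphereBound.mono fun γ h => by
      have := le_sphereBound γ h.1.2
      omega).size_nat⟩
  have hf : Cmp (properCtx L).light fun γ => γ.2.1 :=
    ⟨Tm.id.snd.fst, (properCtx_sphereBound.mono fun γ h => degree_le_sphereBound h).size_nat⟩
  refine (Tm.foldl_core (l := fun γ => List.replicate γ.2.2.2.maxRadius Val.nil)
    (c' := (properCtx L).light.ext fun γ (q : ℕ × Val) => True)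
    (ini := fun γ => γ.1 + 2 + (γ.1 + 2))
    (step := fun γ acc (_ : Val) => acc * (γ.2.1 * γ.2.1 * γ.2.1))
    (fun γ r acc => acc * (γ.2.1 * γ.2.1 * γ.2.1) ^ r.length = HanfNF.sphereBound γ)
    (fun γ => (properCtx L).μ γ + (2 * HanfNF.sphereBound γ + 3)) (fun _ => 0) (fun _ => 1)
    Tm.maxRadius.restrict.unary (hn.of_light.succ.succ.add hn.of_light.succ.succ).tm
    ?_ ?_ (PB.const _ _) ?_ ?_ ?_).congr ?_
  · exact (Cmp.var.fst.mul ((hf.weaken.mul hf.weaken).mul hf.weaken)).tm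
  · exact (PB.mu (properCtx L)).add (((PB.const _ 2).mul properCtx_sphereBound).add (PB.const _ 3))
  · intro γ _
    simp [HanfNF.sphereBound]
  · intro γ acc x m hγ h hx
    refine ⟨by rw [← h, List.length_cons, pow_succ]; ring, ⟨hγ, trivial⟩, le_rfl, ?_⟩
    have h1 := Nat.le_mul_of_pos_right acc
      (show 0 < (γ.2.1 * γ.2.1 * γ.2.1) ^ (x :: m).length by have := hγ.1.2; positivity)
    rw [h] at h1
    rw [List.eq_of_mem_replicate hx]
    have := size_enc_nat acc
    simp only [Ctx.ext, Ctx.light, enc_pair, enc_val, Val.size]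
    omega
  · intro γ _
    have := maxRadius_le_length γ.2.2.2
    simp only [Ctx.restrict, inputCtx, List.length_replicate]
    omega
  · intro γ _
    rw [foldl_replicate _ (fun x => x * (γ.2.1 * γ.2.1 * γ.2.1)), HanfNF.sphereBound]
    generalize γ.2.2.2.maxRadius = d
    induction d with
    | zero => simp
    | succ d ih => rw [Function.iterate_succ_apply', ih]; ring

variable (L) in
/-- The context of the construction, once the bound for the number of elements is known. -/
noncomputable def elimCtx : Ctx (ℕ × Input L) where
  ok γ := (properCtx L).ok γ.2 ∧ γ.1 = sphereBound γ.2
  w γ := 3 * γ.2.2.2.2.length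
  μ γ := meas (arities L) γ.1

lemma elimCtx_le {γ : ℕ × Input L} (h : (elimCtx L).ok γ) :
    γ.2.1 + 2 ≤ γ.1 ∧ γ.2.2.2.1 + 2 ≤ γ.1 := by
  have h1 := le_sphereBound γ.2 h.1.1.2
  have h2 := h.2
  have h3 := h.1.1.1
  omega

lemma elimCtx_bound : PB (elimCtx L).light fun γ => γ.1 :=
  (PB.mu (elimCtx L)).light.mono fun _ _ => le_meas _ _

lemma Cmp.elimCtx_bound : Cmp (elimCtx L).light fun γ => γ.1 :=
  ⟨Tm.id.fst, HanfNF.elimCtx_bound.size_nat⟩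

lemma Cmp.elimCtx_n : Cmp (elimCtx L).light fun γ => γ.2.1 :=
  ⟨Tm.id.snd.fst, (HanfNF.elimCtx_bound.mono fun γ h => by
    have := elimCtx_le h
    omega).size_nat⟩

lemma Tm.elimCtx_radius : Tm (elimCtx L) fun γ => 3 * γ.2.2.2.2.maxRadius := by
  have h : Tm (elimCtx L) fun γ => γ.2.2.2.2.maxRadius :=
    Tm.maxRadius.comp (f := fun γ : ℕ × Input L => γ.2) Tm.id.snd (fun _ h => h.1.1)
      (fun _ _ => le_rfl) ((PB.mu (elimCtx L)).mono fun γ h => by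
        simp only [elimCtx, inputCtx]
        rw [h.2])
  refine h.three_mul fun γ _ => ?_
  have := maxRadius_le_length γ.2.2.2.2
  simp only [elimCtx]
  omega

lemma Cmp.elimCtx_spheres : Cmp (elimCtx L) fun γ =>
    spheres (arities L) (γ.2.2.2.1 + 1) γ.1 (min (3 * γ.2.2.2.2.maxRadius) γ.1) := by
  have he : Cmp (elimCtx L) fun γ => min (3 * γ.2.2.2.2.maxRadius) γ.1 :=
    Cmp.min_big Tm.elimCtx_radius Cmp.elimCtx_bound fun γ _ => by
      have := maxRadius_le_length γ.2.2.2.2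
      simp only [elimCtx]
      omega
  refine (Cmp.filter (g := fun γ r => HanfNF.coversAll (min (3 * γ.2.2.2.2.maxRadius) γ.1) r)
    (Cmp.raws (arities L) Cmp.elimCtx_n.of_light.succ Cmp.elimCtx_bound.of_light ?_ ?_)
    (Cmp.coversAll he.weaken Cmp.var)).congr fun γ h => ?_
  · exact (PB.mu (elimCtx L)).mono fun γ h => pow_le_meas _ (by have := elimCtx_le h; omega)
  · exact (PB.mu (elimCtx L)).mono fun γ _ => two_pow_length_allFacts_le _ _
  · have h' : γ.2.1 = γ.2.2.2.1 := h.1.1.1.symm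
    rw [spheres, h']

/-- The number of cases is bounded in terms of the measure, and each case is linear in `|φ|`. The
disjunction built so far is large, but it is only placed under a new node and never measured. -/
lemma Tm.elimVal : Tm (elimCtx L) fun γ => elimVal γ.1 γ.2.2.2.2 := by
  refine Tm.foldl (l := fun γ : ℕ × Input L =>
      spheres (arities L) (γ.2.2.2.1 + 1) γ.1 (min (3 * γ.2.2.2.2.maxRadius) γ.1))
    (ini := fun γ : ℕ × Input L => (HNF.falsum : HNF L γ.2.2.2.1).encode)
    (step := fun γ acc r => Val.node (.ofNat 5) (.node (caseVal γ.1 r γ.2.2.2.2) acc))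
    Cmp.elimCtx_spheres (Cmp.const (Val.node (.ofNat 1) .nil)).tm
    (Tm.node (Cmp.const (Val.ofNat 5)).tm (Tm.node (Tm.weaken_step
      (g := fun (γ : ℕ × Input L) r => caseVal γ.1 r γ.2.2.2.2) ?_) Tm.id.snd.fst))
  have hatom : Tm ((elimCtx L).ext fun γ r => r ∈ spheres (arities L) (γ.2.2.2.1 + 1) γ.1
      (min (3 * γ.2.2.2.2.maxRadius) γ.1)) fun p => p.1.2.2.2.2.bindVal fun m σ =>
        HanfNF.atomVal (arities L) ((p.1.2.1, p.1.1, p.2), (m, σ.code)) := by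
    refine (Tm.bindVal (L := L)).comp
      (f := fun p : (ℕ × Input L) × Raw => ((p.1.2.1, p.1.1, p.2), p.1.2.2.2))
      ((Tm.id.fst.snd.fst.pair (Tm.id.fst.fst.pair Tm.id.snd)).pair Tm.id.fst.snd.snd.snd) ?_ ?_ ?_
    · rintro ⟨γ, r⟩ ⟨h, hr⟩
      exact ⟨h.1.1.1.symm, (elimCtx_le h).2, (List.mem_filter.1 hr).1⟩
    · rintro ⟨γ, r⟩ _
      simp only [bindCtx, Ctx.ext, elimCtx]
      omega
    · exact (PB.mu _).mono fun p _ => Nat.le_add_right _ _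
  have hr : Cmp ((elimCtx L).ext fun γ r => r ∈ spheres (arities L) (γ.2.2.2.1 + 1) γ.1
      (min (3 * γ.2.2.2.2.maxRadius) γ.1)) fun p => p.2 := Cmp.var
  refine Tm.recode ((Cmp.const 4).tm.pair (((Cmp.const 2).tm.pair ((Cmp.const 1).tm.pair
    (Tm.elimCtx_radius.weaken.pair (hr.tm.fst.pair (hr.tm.snd.fst.pair (hr.tm.snd.snd.pair
      (Cmp.const ()).tm)))))).pair hatom)) ?_
  rintro ⟨γ, r⟩ ⟨h, -⟩
  obtain ⟨N, n, f, ⟨n', φ⟩⟩ := γ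
  obtain rfl : n' = n := h.1.1.1
  rfl

/-- The output of the construction. -/
noncomputable def outVal (γ : Input L) : Val :=
  if decide (γ.2.2.2.maxRadius = 0) = true then γ.2.2.2.encode
  else elimVal (sphereBound γ) γ.2.2.2

lemma Tm.outVal : Tm (inputCtx L) outVal := by
  refine Tm.ite (Cmp.null Tm.maxRadius).tm ?_ ?_
  · exact Tm.id.snd.snd.recode fun _ _ => rfl
  · refine (Tm.elimVal (L := L)).comp (f := fun γ : Input L => (HanfNF.sphereBound γ, γ))
      (Tm.sphereBound.pair Tm.id) (fun γ h => ⟨h, rfl⟩) (fun γ _ => le_rfl) (PB.mu (properCtx L))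

lemma elimCtx_atomBound : ∃ k, ∀ γ, (elimCtx L).ok γ →
    ∀ r ∈ raws (arities L) (γ.2.2.2.1 + 1) γ.1, ∀ (m : ℕ) (σ : Sphere L (γ.2.2.2.1 + 2)),
      atomBound L ((γ.2.2.2.1, γ.1, r), (m, σ.code)) ≤ ((elimCtx L).μ γ + 2) ^ k := by
  obtain ⟨k, hk⟩ := PB.atomBound (L := L)
  exact ⟨k, fun γ h r hr m σ => hk _ ⟨(elimCtx_le h).2, hr, σ, rfl⟩⟩

/-- The bound for running time and length, in terms of the measure. -/
lemma exists_construction : ∃ (p : Prog) (k : ℕ), ∀ (n f : ℕ), 1 ≤ f → ∀ φ : HNF L (n + 1),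
    ∃ (ψ : HNF L n) (t : ℕ),
      (∀ (A : Type w) [L.Structure A] [Nonempty A], DegreeLE L A f → ∀ a : Fin n → A,
        (∃ b : A, φ.Realize (Fin.snoc a b : Fin (n + 1) → A)) ↔ ψ.Realize a) ∧
      p.Eval (encodeInput n f φ) ψ.encode t ∧
      t ≤ (3 * φ.length + 1) * (meas (arities L) (sphereBound ((n, f, ⟨n, φ⟩) : Input L)) + 2) ^ k ∧
      ψ.length ≤
        (3 * φ.length + 1) * (meas (arities L) (sphereBound ((n, f, ⟨n, φ⟩) : Input L)) + 2) ^ k ∧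
      ψ.maxRadius = 3 * φ.maxRadius := by
  obtain ⟨p, T, ⟨k₁, hT⟩, hp⟩ := Tm.outVal (L := L)
  obtain ⟨k₂, hk₂⟩ := elimCtx_atomBound (L := L)
  obtain ⟨k₃, hk₃⟩ := (Cmp.elimCtx_spheres (L := L)).sz
  obtain ⟨k₄, hk₄⟩ : PB (elimCtx L) fun γ =>
      ((elimCtx L).μ γ + 2) ^ k₃ * (((elimCtx L).μ γ + 2) ^ k₃ + ((elimCtx L).μ γ + 2) ^ k₂ + 6) + 1 :=
    ((PB.mul ⟨k₃, fun _ _ => le_rfl⟩ ((PB.add ⟨k₃, fun _ _ => le_rfl⟩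
      ⟨k₂, fun _ _ => le_rfl⟩).add (PB.const _ 6)))).add (PB.const _ 1)
  refine ⟨p, k₁ + k₄, fun n f hf φ => ?_⟩
  have hok : (inputCtx L).ok (n, f, ⟨n, φ⟩) := ⟨rfl, hf⟩
  obtain ⟨t, ht, e⟩ := hp _ hok
  replace e : p.Eval (encodeInput n f φ) (HanfNF.outVal ((n, f, ⟨n, φ⟩) : Input L)) t := e
  have ht' : t ≤ (3 * φ.length + 1) *
      (meas (arities L) (sphereBound ((n, f, ⟨n, φ⟩) : Input L)) + 2) ^ (k₁ + k₄) :=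
    ht.trans (Nat.mul_le_mul_left _ ((hT _ hok).trans
      (Nat.pow_le_pow_right (by omega) (Nat.le_add_right _ _))))
  rcases Nat.eq_zero_or_pos φ.maxRadius with hd | hd
  -- Without Hanf formulas there is nothing to replace. The substitution only changes the number of
  -- variables, and the value `falsum` is never used.
  · obtain ⟨h1, h2, h3⟩ := φ.encode_bind_of_maxRadius (χ := fun _ _ => (.falsum : HNF L n)) hd
    refine ⟨_, t, fun A _ _ hA a => ?_, ?_, ht', ?_, by rw [h3, hd]⟩
    · have key : ∀ b : A, φ.Realize (Fin.snoc a b : Fin (n + 1) → A) ↔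
          (φ.bind (fun _ _ => (.falsum : HNF L n))).Realize a := fun b =>
        HNF.realize_bind (d := 0) (fun m σ hσ => absurd hσ (by have := σ.radius_pos; omega)) φ hd.le
      simp only [key, exists_const]
    · rw [h1]
      simpa [HanfNF.outVal, hd] using e
    · rw [h2]
      exact (show φ.length ≤ 3 * φ.length + 1 by omega).trans
        (Nat.le_mul_of_pos_right _ (by positivity))
  · obtain ⟨N, hN⟩ : ∃ N, N = sphereBound ((n, f, ⟨n, φ⟩) : Input L) := ⟨_, rfl⟩
    have hok' : (elimCtx L).ok (N, (n, f, ⟨n, φ⟩)) := ⟨⟨hok, by simpa using hd.ne'⟩, hN⟩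
    have hX := hk₃ (N, (n, f, ⟨n, φ⟩)) hok'
    have hY := hk₂ (N, (n, f, ⟨n, φ⟩)) hok'
    have hN' : N = (n + 2 + (n + 2)) * (f * f * f) ^ φ.maxRadius := hN
    have hZ := hk₄ (N, (n, f, ⟨n, φ⟩)) hok'
    beta_reduce at hX hY hZ
    generalize hM : (elimCtx L).μ (N, (n, f, ⟨n, φ⟩)) + 2 = M at hX hY hZ
    replace hM : meas (arities L) N + 2 = M := hM
    obtain ⟨ψ, h1, h2, h3, h4⟩ := exists_elim.{u, v, w} hf φ hd hN' hX hY
    rw [← hN] at ht' ⊢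
    refine ⟨ψ, t, fun A _ _ hA a => h4 A hA a, ?_, ht', ?_, h2⟩
    · rw [h1, hN]
      simpa [HanfNF.outVal, hd.ne'] using e
    · rw [hM]
      exact h3.trans (Nat.mul_le_mul_left _ (hZ.trans
        (Nat.pow_le_pow_right (by omega) (Nat.le_add_left _ _))))

/-- The measure is a power of 2 whose exponent is a fixed power of `N + 2`, hence at most `(n + 2) ^
c * f ^ (c * d)` for a constant `c`. A fixed power of the measure multiplies this exponent by a
constant only. -/
lemma exists_exponent (ar : List (ℕ × ℕ)) (k : ℕ) : ∃ C, ∀ n f d l : ℕ, 1 ≤ f → 1 ≤ l →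
    (3 * l + 1) * (meas ar ((n + 2 + (n + 2)) * (f * f * f) ^ d) + 2) ^ k ≤
      l * 2 ^ ((n + 2) ^ C * f ^ (C * d)) := by
  -- The first summand comes from `N + 2 ≤ (n + 2) ^ 3 * f ^ (3 * d)`. The second absorbs the power
  -- `k` and the factor 4 in `3 * l + 1 ≤ 4 * l`, as `n + 2 ≥ 2`.
  refine ⟨3 * measExp ar + (2 * k + 2), fun n f d l hf hl => ?_⟩
  set N := (n + 2 + (n + 2)) * (f * f * f) ^ d with hN
  set y := (N + 2) ^ measExp ar with hy
  have hy1 : 1 ≤ y := Nat.one_le_pow _ _ (by omega)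
  have h1 : meas ar N + 2 ≤ 2 ^ (2 * y) := by
    have h2 : 2 ≤ 2 ^ y := Nat.le_self_pow (by omega) 2
    rw [meas, ← hy, two_mul, pow_add]
    nlinarith
  have hF : 1 ≤ f ^ (3 * d) := Nat.one_le_pow _ _ hf
  have hNF : N + 2 ≤ (n + 2) ^ 3 * f ^ (3 * d) := by
    rw [hN, show f * f * f = f ^ 3 by ring, ← pow_mul]
    have h4 : 4 * (n + 2) ≤ (n + 2) ^ 3 := by
      rw [show (n + 2) ^ 3 = (n + 2) ^ 2 * (n + 2) by ring]
      exact Nat.mul_le_mul_right _ (by nlinarith)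
    nlinarith
  have hyb : y ≤ (n + 2) ^ (3 * measExp ar) * f ^ (3 * measExp ar * d) := by
    calc y ≤ ((n + 2) ^ 3 * f ^ (3 * d)) ^ measExp ar := Nat.pow_le_pow_left hNF _
      _ = _ := by rw [mul_pow, ← pow_mul, ← pow_mul]; ring_nf
  have hexp : 2 + 2 * y * k ≤
      (n + 2) ^ (3 * measExp ar + (2 * k + 2)) * f ^ ((3 * measExp ar + (2 * k + 2)) * d) := by
    have h5 : 2 * k + 2 ≤ (n + 2) ^ (2 * k + 2) :=
      Nat.lt_two_pow_self.le.trans (Nat.pow_le_pow_left (by omega) _)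
    have h6 : f ^ (3 * measExp ar * d) ≤ f ^ ((3 * measExp ar + (2 * k + 2)) * d) :=
      Nat.pow_le_pow_right hf (Nat.mul_le_mul_right _ (by omega))
    calc 2 + 2 * y * k ≤ y * (2 * k + 2) := by nlinarith
      _ ≤ (n + 2) ^ (3 * measExp ar) * f ^ (3 * measExp ar * d) * (n + 2) ^ (2 * k + 2) :=
        Nat.mul_le_mul hyb h5
      _ = (n + 2) ^ (3 * measExp ar + (2 * k + 2)) * f ^ (3 * measExp ar * d) := by
        rw [pow_add]; ring
      _ ≤ _ := Nat.mul_le_mul_left _ h6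
  calc (3 * l + 1) * (meas ar N + 2) ^ k ≤ (l * 2 ^ 2) * (2 ^ (2 * y)) ^ k :=
        Nat.mul_le_mul (by omega) (Nat.pow_le_pow_left h1 k)
    _ = l * 2 ^ (2 + 2 * y * k) := by rw [pow_add, ← pow_mul, mul_assoc]
    _ ≤ _ := Nat.mul_le_mul_left _ (Nat.pow_le_pow_right (by omega) hexp)

end Construction
end HanfNF

theorem lemma4 (L : FirstOrder.Language.{u, v}) [L.IsRelational]
    [Finite (Σ l, L.Relations l)] :
    ∃ (p : HanfNF.Prog) (C : ℕ), ∀ (n f : ℕ), 1 ≤ f → ∀ φ : HanfNF.HNF L (n + 1),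
      ∃ (ψ : HanfNF.HNF L n) (t : ℕ),
        -- `∃ x_{n+1} : φ` and `ψ` are `f`-equivalent
        (∀ (A : Type w) [L.Structure A] [Nonempty A], HanfNF.DegreeLE L A f →
          ∀ a : Fin n → A,
            (∃ b : A, φ.Realize (Fin.snoc a b : Fin (n + 1) → A)) ↔ ψ.Realize a) ∧
        -- the construction of `ψ` from `(n, f, φ)`, with its running time
        p.Eval (HanfNF.encodeInput n f φ) ψ.encode t ∧
        t ≤ φ.length * 2 ^ ((n + 2) ^ C * f ^ (C * φ.maxRadius)) ∧
        ψ.length ≤ φ.length * 2 ^ ((n + 2) ^ C * f ^ (C * φ.maxRadius)) ∧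
        ψ.maxRadius = 3 * φ.maxRadius := by
  obtain ⟨p, k, h⟩ := HanfNF.exists_construction.{u, v, w} (L := L)
  obtain ⟨C, hC⟩ := HanfNF.exists_exponent (HanfNF.arities L) k
  refine ⟨p, C, fun n f hf φ => ?_⟩
  obtain ⟨ψ, t, h1, h2, h3, h4, h5⟩ := h n f hf φ
  have hb := hC n f φ.maxRadius φ.length hf (HanfNF.one_le_length φ)
  exact ⟨ψ, t, h1, h2, h3.trans hb, h4.trans hb, h5⟩
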